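/- Let $S$ be a connected Riemann surface and let $f:S\to S^5(1)\subset\mathbb R^6$ be a smooth conformal minimal immersion whose ellipse of curvature $E(p)=\{II(X,X): X\in T_pS,\ |X|=1\}$ is non-degenerate and not a circle at every point $p\in S$. Suppose that a continuous map $B:S\to\mathbb R^6$ is given such that $B(p)$ is a unit vector along the major axis of $E(p)$ for every $p$ (such a map exists, for example, if $S$ is simply connected). For a local complex coordinate $z=x+iy$ write $\partial=\partial/\partial z$, let $(\cdot,\cdot)$ be the complex bilinear extension of the inner product of $\mathbb R^6$, and for a map $g:S\to S^5(1)$ put $g_1=\partial g$ and $g_2=II_g(\partial,\partial)=a_g-ib_g$ with $a_g,b_g$ real, where $II_g$ is the complex bilinear extension of the second fundamental form of $g$ in $S^5(1)$. Call $z$ adapted if $(f_2,f_2)=-1$ and $b_f$ is a positive multiple of $B$; adapted coordinates exist near each point and are unique up to $z\mapsto\pm z+c$. For $\epsilon=\pm$ the $(\epsilon)$-transform of $g$ is $$g^{\epsilon}=-\frac{1}{\cosh\phi}\,\frac{b_g}{|b_g|}+\epsilon\tanh\phi\;N,$$ where $z$ is an adapted coordinate, $\phi\ge 0$ is given by $\sinh\phi=|a_g|$,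 and $N$ is the unit vector completing $g,\ \partial g/\partial x,\ \partial g/\partial y,\ II_g(\partial_x,\partial_x),\ II_g(\partial_x,\partial_y)$ to a positively oriented basis of $\mathbb R^6$ and orthogonal to these vectors (the term $\tanh\phi\,N$ is $0$ where $a_g=0$). Define the sequence $\{f^p\}_{p\in\mathbb Z}$ by $f^0=f$, $f^{p+1}=(f^p)^+$ for $p\ge 0$ and $f^{p-1}=(f^p)^-$ for $p\le 0$, always with the same adapted coordinates, and put $\gamma^{q+1}=(\partial f^q_1,f^{q+1}_1)$ for each adapted coordinate. Then for each integer $q$, $\gamma^{q+1}$ vanishes identically on $S$ (in all adapted coordinates) if and only if there is an orientation-reversing isometry $A\in O(6)$ such that $f^{q+1}=A(f^q)$. Moreover, every such $A$ is the reflection in a great subsphere of $S^5(1)$ (that is, for some linear subspace $0\neq V\subsetneq\mathbb R^6$, $A$ is the identity on $V$ and $-1$ on $V^\perp$), and $f^{q+1+r}=A(f^{q-r})$ for every integer $r$. -/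

import Mathlib

open scoped ContDiff Manifold RealInnerProductSpace

noncomputable section

namespace MinimalSurfaceS5

/-- Euclidean 6-space; the unit sphere `S⁵(1)` is the set of its unit vectors. -/
abbrev E6 : Type := EuclideanSpace ℝ (Fin 6)

/-! ### Local differential geometry of a map `u : ℂ → ℝ⁶` of a complex coordinate `z = x + iy`

Real tangent vectors in the coordinate domain are complex numbers: `1` is `∂/∂x` and `Complex.I`
is `∂/∂y`. -/

/-- Directional derivative of `u` at `z` along the coordinate vector `X`. -/
def D (u : ℂ → E6) (X : ℂ) (z : ℂ) : E6 := fderiv ℝ u z X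

/-- The normal space at `z` of the surface `u` in the unit sphere: the vectors orthogonal to the
position vector and to the tangent plane. -/
def normalSpace (u : ℂ → E6) (z : ℂ) : Submodule ℝ E6 :=
  (Submodule.span ℝ {u z, D u 1 z, D u Complex.I z})ᗮ

/-- Second fundamental form of `u` in the unit sphere: the normal component of the second
derivative. -/
def II (u : ℂ → E6) (z : ℂ) (X Y : ℂ) : E6 :=
  (normalSpace u z).starProjection (D (D u Y) X z)

/-- The ellipse of curvature `{II(X, X) | X a unit tangent vector}`. -/
def curvatureEllipse (u : ℂ → E6) (z : ℂ) : Set E6 :=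
  {v | ∃ X : ℂ, ‖D u X z‖ = 1 ∧ v = II u z X X}

/-- At `z` the map `u` is an immersion, `z` is a conformal coordinate, and the mean curvature
vector in the unit sphere vanishes. -/
def IsConformalMinimalAt (u : ℂ → E6) (z : ℂ) : Prop :=
  D u 1 z ≠ 0 ∧ ‖D u 1 z‖ = ‖D u Complex.I z‖ ∧ ⟪D u 1 z, D u Complex.I z⟫ = 0 ∧
    II u z 1 1 + II u z Complex.I Complex.I = 0

/-- A central ellipse is non-degenerate if it spans a plane. -/
def NondegenerateEllipse (E : Set E6) : Prop := Module.finrank ℝ (Submodule.span ℝ E) = 2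

/-- A central ellipse is a circle (possibly a point) if all its points have the same norm. -/
def NoncircularEllipse (E : Set E6) : Prop := ¬ ∃ r : ℝ, ∀ v ∈ E, ‖v‖ = r

/-- `B` is a unit vector on the major axis of the central ellipse `E`. -/
def IsMajorUnitVector (E : Set E6) (B : E6) : Prop :=
  ‖B‖ = 1 ∧ ∃ v ∈ E, (∀ w ∈ E, ‖w‖ ≤ ‖v‖) ∧ v = ‖v‖ • B

/-- Real part `a` of `f₂ = II(∂, ∂) = a - i b`, where `∂ = (∂/∂x - i ∂/∂y) / 2`. -/
def aVec (u : ℂ → E6) (z : ℂ) : E6 :=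
  (1 / 4 : ℝ) • (II u z 1 1 - II u z Complex.I Complex.I)

/-- The vector `b` in `f₂ = II(∂, ∂) = a - i b`. -/
def bVec (u : ℂ → E6) (z : ℂ) : E6 :=
  (1 / 4 : ℝ) • (II u z 1 Complex.I + II u z Complex.I 1)

/-- `f₂ = II(∂, ∂) = a - i b`, with values in `ℂ⁶`. The complex bilinear extension of the inner
product is the dot product `⬝ᵥ` on `ℂ⁶`. -/
def f₂ (u : ℂ → E6) (z : ℂ) : Fin 6 → ℂ :=
  fun k => (aVec u z k : ℂ) - Complex.I * (bVec u z k : ℂ)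

/-- The non-negative number `φ` with `|a| = sinh φ`. -/
def phi (u : ℂ → E6) (z : ℂ) : ℝ := Real.arsinh ‖aVec u z‖

/-- The cross product of five vectors of `ℝ⁶`: `⟪cross₅ v, w⟫ = det (v₀, …, v₄, w)`. -/
def cross₅ (v₀ v₁ v₂ v₃ v₄ : E6) : E6 :=
  WithLp.toLp 2 fun k =>
    Matrix.det (Matrix.of ![(v₀ : Fin 6 → ℝ), v₁, v₂, v₃, v₄, (Pi.single k 1 : Fin 6 → ℝ)])

/-- The unit vector `N` for which
`(u, ∂u/∂x, ∂u/∂y, II(∂/∂x, ∂/∂x), II(∂/∂x, ∂/∂y), N)` is positively oriented and `N` is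
orthogonal to the other five vectors. It is `0` where these five are linearly dependent. -/
def unitNormal (u : ℂ → E6) (z : ℂ) : E6 :=
  let c := cross₅ (u z) (D u 1 z) (D u Complex.I z) (II u z 1 1) (II u z 1 Complex.I)
  ‖c‖⁻¹ • c

/-- The `(ε)`-construction in the coordinate `z`, for `ε = 1` or `ε = -1`:
`-(1 / cosh φ) (b / |b|) + ε tanh φ N`. -/
def localTransform (ε : ℝ) (u : ℂ → E6) (z : ℂ) : E6 :=
  -((1 / Real.cosh (phi u z)) • (‖bVec u z‖⁻¹ • bVec u z)) +
    (ε * Real.tanh (phi u z)) • unitNormal u z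

/-- The inclusion of `ℝ⁶`-valued maps in `ℂ⁶`-valued maps. -/
def complexify (u : ℂ → E6) : ℂ → (Fin 6 → ℂ) := fun z k => (u z k : ℂ)

/-- The operator `∂ = ∂/∂z = (∂/∂x - i ∂/∂y) / 2` on `ℂ⁶`-valued maps. -/
def wirtinger (U : ℂ → (Fin 6 → ℂ)) : ℂ → (Fin 6 → ℂ) := fun z =>
  (1 / 2 : ℂ) • (fderiv ℝ U z 1 - Complex.I • fderiv ℝ U z Complex.I)

/-- `(∂ u₁, v₁)` with `u₁ = ∂u`, `v₁ = ∂v`. -/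
def localGamma (u v : ℂ → E6) (z : ℂ) : ℂ :=
  wirtinger (wirtinger (complexify u)) z ⬝ᵥ wirtinger (complexify v) z

/-! ### Maps from a Riemann surface -/

section Surface

variable {S : Type*} [TopologicalSpace S] [ChartedSpace ℂ S]

/-- The local complex coordinates of the Riemann surface `S`. -/
def complexCoordinates (S : Type*) [TopologicalSpace S] [ChartedSpace ℂ S] :
    Set (OpenPartialHomeomorph S ℂ) :=
  IsManifold.maximalAtlas 𝓘(ℂ) ω S

/-- A map into `ℝ⁶` read in the coordinate `e`. -/
def inCoord (f : S → E6) (e : OpenPartialHomeomorph S ℂ) : ℂ → E6 := fun z => f (e.symm z)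

/-- `f` is a (smooth, conformal) minimal immersion of the Riemann surface `S` into `S⁵(1)`. -/
structure IsMinimalImmersion (f : S → E6) : Prop where
  smooth : ContMDiff 𝓘(ℝ, ℂ) 𝓘(ℝ, E6) ∞ f
  norm_eq_one : ∀ p, ‖f p‖ = 1
  conformalMinimal : ∀ e ∈ complexCoordinates S, ∀ p ∈ e.source,
    IsConformalMinimalAt (inCoord f e) (e p)

/-- The ellipse of curvature of `f` is everywhere non-degenerate and not a circle. -/
def HasNondegenerateNoncircularEllipse (f : S → E6) : Prop :=
  ∀ e ∈ complexCoordinates S, ∀ p ∈ e.source,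
    NondegenerateEllipse (curvatureEllipse (inCoord f e) (e p)) ∧
      NoncircularEllipse (curvatureEllipse (inCoord f e) (e p))

/-- `B` is a continuous choice of a unit vector on the major axis of the ellipse of curvature
of `f`. -/
def IsMajorAxisField (f B : S → E6) : Prop :=
  Continuous B ∧ ∀ e ∈ complexCoordinates S, ∀ p ∈ e.source,
    IsMajorUnitVector (curvatureEllipse (inCoord f e) (e p)) (B p)

/-- The complex coordinates that are adapted for `f`, `(f₂, f₂) = -1`, and for which `b` points in
the direction of `B`. (The first condition determines a coordinate up to translation and rotation
by multiples of `π / 2`; both together determine it up to translation and sign.) -/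
def adaptedCoordinates (f B : S → E6) : Set (OpenPartialHomeomorph S ℂ) :=
  {e | e ∈ complexCoordinates S ∧ ∀ p ∈ e.source,
    f₂ (inCoord f e) (e p) ⬝ᵥ f₂ (inCoord f e) (e p) = -1 ∧
      bVec (inCoord f e) (e p) = ‖bVec (inCoord f e) (e p)‖ • B p}

open Classical in
/-- The `(ε)`-transform of `g`, computed at each point in a coordinate from the family `𝒜`. -/
def transform (𝒜 : Set (OpenPartialHomeomorph S ℂ)) (ε : ℝ) (g : S → E6) : S → E6 := fun p =>
  if h : ∃ e ∈ 𝒜, p ∈ e.source then localTransform ε (inCoord g h.choose) (h.choose p) else 0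

/-- The sequence `f^p`, `p ∈ ℤ`: `f⁰ = f`, and then `(+)`-transforms in the positive direction and
`(-)`-transforms in the negative direction, all with respect to the adapted coordinates of `f`
given by `B`. -/
def transformSeq (f B : S → E6) : ℤ → S → E6
  | Int.ofNat n => (transform (adaptedCoordinates f B) 1)^[n] f
  | Int.negSucc n => (transform (adaptedCoordinates f B) (-1))^[n + 1] f

/-- The invariant `γ^{q+1} = (∂ f₁^q, f₁^{q+1})` in the coordinate `e`, at the point `p`. -/
def gammaInvariant (f B : S → E6) (q : ℤ) (e : OpenPartialHomeomorph S ℂ) (p : S) : ℂ :=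
  localGamma (inCoord (transformSeq f B q) e) (inCoord (transformSeq f B (q + 1)) e) (e p)

end Surface

/-- `A` is an orientation-reversing element of `O(6)`. -/
def IsOrientationReversing (A : E6 ≃ₗᵢ[ℝ] E6) : Prop :=
  LinearMap.det (A.toLinearEquiv : E6 →ₗ[ℝ] E6) = -1

/-- `A` is the reflection in a great subsphere of `S⁵(1)`, that is, in the unit sphere of a
proper non-zero linear subspace `V`: the identity on `V` and `-1` on its orthogonal complement. -/
def IsGreatSubsphereReflection (A : E6 ≃ₗᵢ[ℝ] E6) : Prop :=
  ∃ V : Submodule ℝ E6, V ≠ ⊥ ∧ V ≠ ⊤ ∧ A = V.reflection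

end MinimalSurfaceS5

end

open scoped ContDiff Manifold RealInnerProductSpace

noncomputable section

namespace MinimalSurfaceS5

open Complex ComplexConjugate Set Filter Topology Matrix

/-! ### The Wirtinger operators -/

section Wirtinger

variable {W : Type*} [NormedAddCommGroup W] [NormedSpace ℝ W]

/-! Fix an adapted coordinate and write `E = |∂g|²`, `g₂` for the normal part of `∂∂g`, and `γ =
(∂∂g, ∂h)`. A transform `h` of a minimal surface `g` is a real unit vector field orthogonal to `g`
and `∂g` with `(h, ∂∂g) = i`; this is `IsPair`, and it is symmetric in `g` and `h`. The vector `ξ =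
g₂ - ih` is isotropic, and `g`, `∂g`, its conjugate, `ξ`, its conjugate and `h` form a frame
wherever `|g₂|² ≠ 1` (`IsPair.isIsotropicFrame`). Expanding `∂h` and `∂∂h` in it shows that `h` is
again minimal with the same adapted coordinate (`IsPair.isAdapted`). On open sets where `|g₂|² = 1`
the formulas are obtained directly from `ξ = 0`, and continuity joins the two cases
(`eqOn_of_dichotomy`).

The sign `ε` is not seen by `IsPair`; it is the sign of the determinant of `(g, ∂g, its conjugate,
∂∂g, its conjugate, h)`. Exchanging `g` and `h` multiplies this determinant by a non-positive number
(`IsPair.exists_det_eq`), so the `(-ε)`-transform inverts the `(ε)`-transform and the sequence obeys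
the same rule at every index (`isTransformSeq`). An orientation-reversing isometry interchanges the
two transforms (`localTransform_applyIsom`). Hence a congruence `f^{q+1} = A(f^q)` reflects the
whole sequence of indices (`IsTransformSeq.applyIsom_reflect`). In particular `A` swaps `f^q` and
`f^{q+1}`, which together span `ℝ⁶`, so `A² = 1`. Since `γ` changes sign when the two surfaces are
exchanged (`IsPair.dz_g_dz_dz`) and is preserved by `A`, it vanishes.

Conversely, `∂̄γ = i(E_g - E_h)`, so `γ = 0` makes the two metrics equal. Then the frames built from
`(g, h)` and from `(h, g)` have the same Gram matrix and the same connection coefficients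
(`IsPair.gram_swapFrame`, `IsPair.connection_swapFrame`). Where `E² ≠ 1` they are bases, hence
congruent, and the congruence has determinant `-1` because it swaps three pairs of vectors
(`exists_local_congruence`). If `E² = 1` on an open set, the ellipse of `f^q` would be degenerate
there, and this would propagate back to `f`. To cross the remaining zeros of `E² - 1`, the local
congruences are rewritten as maps from `f⁰`, `f¹` to `f^{2q+1}`, `f^{2q}`: the derivative frame of
`f` is never degenerate, so the identities extend by continuity and integrate over a full ball
(`IsTransformSeq.exists_congruence`). Uniqueness of the local isometry and connectedness of `S` give
a single `A` (`exists_isom`). -/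

/-- Smoothness on a set in the real sense. -/
abbrev Smooth (U : Set ℂ) (F : ℂ → W) : Prop := ContDiffOn ℝ ∞ F U

theorem Smooth.differentiableAt {U : Set ℂ} {F : ℂ → W} (hF : Smooth U F) (hU : IsOpen U) {z : ℂ}
    (hz : z ∈ U) : DifferentiableAt ℝ F z :=
  (hF.contDiffAt (hU.mem_nhds hz)).differentiableAt (by simp)

theorem eventuallyEq_of_eqOn {α : Type*} {U : Set ℂ} {F G : ℂ → α} (hU : IsOpen U)
    (h : EqOn F G U) {z : ℂ} (hz : z ∈ U) : F =ᶠ[𝓝 z] G :=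
  h.eventuallyEq_of_mem (hU.mem_nhds hz)

theorem smooth_fderiv_apply {U : Set ℂ} {F : ℂ → W} (hU : IsOpen U) (hF : Smooth U F) (X : ℂ) :
    Smooth U (fun z => fderiv ℝ F z X) :=
  (hF.fderiv_of_isOpen hU (m := ∞) (by simp)).clm_apply contDiffOn_const

variable [NormedSpace ℂ W]

/-- The operator `∂/∂z` on maps with values in a complex vector space. -/
def dz (F : ℂ → W) (z : ℂ) : W := (1 / 2 : ℂ) • (fderiv ℝ F z 1 - I • fderiv ℝ F z I)

/-- The operator `∂/∂z̄` on maps with values in a complex vector space. -/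
def dzb (F : ℂ → W) (z : ℂ) : W := (1 / 2 : ℂ) • (fderiv ℝ F z 1 + I • fderiv ℝ F z I)

theorem dz_congr {U : Set ℂ} {F G : ℂ → W} (hU : IsOpen U) (h : EqOn F G U) {z : ℂ} (hz : z ∈ U) :
    dz F z = dz G z := by
  simp only [dz, (eventuallyEq_of_eqOn hU h hz).fderiv_eq]

theorem dzb_congr {U : Set ℂ} {F G : ℂ → W} (hU : IsOpen U) (h : EqOn F G U) {z : ℂ} (hz : z ∈ U) :
    dzb F z = dzb G z := by
  simp only [dzb, (eventuallyEq_of_eqOn hU h hz).fderiv_eq]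

theorem fderiv_one_eq (F : ℂ → W) (z : ℂ) : fderiv ℝ F z 1 = dz F z + dzb F z := by
  simp only [dz, dzb]; module

theorem fderiv_I_eq (F : ℂ → W) (z : ℂ) : fderiv ℝ F z I = I • (dz F z - dzb F z) := by
  simp only [dz, dzb, ← smul_sub, smul_smul]
  have : fderiv ℝ F z 1 - I • fderiv ℝ F z I - (fderiv ℝ F z 1 + I • fderiv ℝ F z I)
      = (-2 * I) • fderiv ℝ F z I := by module
  have h2 : I * (1 / 2) * (-2 * I) = 1 := by ring_nf; simp
  rw [this, smul_smul, h2, one_smul]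

theorem Smooth.const_smul' [IsScalarTower ℝ ℂ W] {U : Set ℂ} {F : ℂ → W} (hF : Smooth U F) (c : ℂ) :
    Smooth U (fun z => c • F z) :=
  ContDiff.comp_contDiffOn (g := fun w : W => c • w)
    ((c • (ContinuousLinearMap.id ℝ W)).contDiff) hF

theorem Smooth.dz [IsScalarTower ℝ ℂ W] {U : Set ℂ} {F : ℂ → W} (hF : Smooth U F) (hU : IsOpen U) : Smooth U (dz F) :=
  Smooth.const_smul' ((smooth_fderiv_apply hU hF 1).sub
    (Smooth.const_smul' (smooth_fderiv_apply hU hF I) I)) _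

theorem Smooth.dzb [IsScalarTower ℝ ℂ W] {U : Set ℂ} {F : ℂ → W} (hF : Smooth U F) (hU : IsOpen U) : Smooth U (dzb F) :=
  Smooth.const_smul' ((smooth_fderiv_apply hU hF 1).add
    (Smooth.const_smul' (smooth_fderiv_apply hU hF I) I)) _

theorem Smooth.smul' [IsScalarTower ℝ ℂ W] {U : Set ℂ} {c : ℂ → ℂ} {F : ℂ → W} (hc : Smooth U c) (hF : Smooth U F) :
    Smooth U (fun z => c z • F z) := by
  have : IsBoundedBilinearMap ℝ (fun p : ℂ × W => p.1 • p.2) :=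
    ContinuousLinearMap.isBoundedBilinearMap (ContinuousLinearMap.lsmul ℝ ℂ : ℂ →L[ℝ] W →L[ℝ] W)
  exact this.contDiff.comp_contDiffOn (hc.prodMk hF)

theorem fderiv_smul_apply [IsScalarTower ℝ ℂ W] {c : ℂ → ℂ} {F : ℂ → W} {z : ℂ} (hc : DifferentiableAt ℝ c z)
    (hF : DifferentiableAt ℝ F z) (X : ℂ) :
    fderiv ℝ (fun z => c z • F z) z X = c z • fderiv ℝ F z X + fderiv ℝ c z X • F z := by
  have : IsBoundedBilinearMap ℝ (fun p : ℂ × W => p.1 • p.2) :=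
    ContinuousLinearMap.isBoundedBilinearMap (ContinuousLinearMap.lsmul ℝ ℂ : ℂ →L[ℝ] W →L[ℝ] W)
  have h := (this.hasFDerivAt (c z, F z)).comp z (hc.hasFDerivAt.prodMk hF.hasFDerivAt)
  have h' : fderiv ℝ (fun z => c z • F z) z = _ := h.fderiv
  rw [h']
  simp [IsBoundedBilinearMap.deriv_apply]

theorem dz_smul [IsScalarTower ℝ ℂ W] {c : ℂ → ℂ} {F : ℂ → W} {z : ℂ} (hc : DifferentiableAt ℝ c z)
    (hF : DifferentiableAt ℝ F z) :
    dz (fun z => c z • F z) z = c z • dz F z + dz c z • F z := by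
  simp only [dz, fderiv_smul_apply hc hF, smul_eq_mul]; module

theorem dzb_smul [IsScalarTower ℝ ℂ W] {c : ℂ → ℂ} {F : ℂ → W} {z : ℂ} (hc : DifferentiableAt ℝ c z)
    (hF : DifferentiableAt ℝ F z) :
    dzb (fun z => c z • F z) z = c z • dzb F z + dzb c z • F z := by
  simp only [dzb, fderiv_smul_apply hc hF, smul_eq_mul]; module

theorem dz_const (c : W) (z : ℂ) : dz (fun _ => c) z = 0 := by simp [dz]

theorem dzb_const (c : W) (z : ℂ) : dzb (fun _ => c) z = 0 := by simp [dzb]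

theorem dz_const_smul [IsScalarTower ℝ ℂ W] {F : ℂ → W} {z : ℂ} (hF : DifferentiableAt ℝ F z) (c : ℂ) :
    dz (fun z => c • F z) z = c • dz F z := by
  have := dz_smul (c := fun _ => c) (differentiableAt_const c) hF
  simpa [dz_const] using this

theorem dzb_const_smul [IsScalarTower ℝ ℂ W] {F : ℂ → W} {z : ℂ} (hF : DifferentiableAt ℝ F z) (c : ℂ) :
    dzb (fun z => c • F z) z = c • dzb F z := by
  have := dzb_smul (c := fun _ => c) (differentiableAt_const c) hF
  simpa [dzb_const] using this

theorem dz_add {F G : ℂ → W} {z : ℂ} (hF : DifferentiableAt ℝ F z) (hG : DifferentiableAt ℝ G z) :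
    dz (fun z => F z + G z) z = dz F z + dz G z := by
  simp only [dz, fderiv_fun_add hF hG, _root_.add_apply]; module

theorem dz_sub {F G : ℂ → W} {z : ℂ} (hF : DifferentiableAt ℝ F z) (hG : DifferentiableAt ℝ G z) :
    dz (fun z => F z - G z) z = dz F z - dz G z := by
  simp only [dz, fderiv_fun_sub hF hG, _root_.sub_apply]; module

theorem dzb_sub {F G : ℂ → W} {z : ℂ} (hF : DifferentiableAt ℝ F z) (hG : DifferentiableAt ℝ G z) :
    dzb (fun z => F z - G z) z = dzb F z - dzb G z := by
  simp only [dzb, fderiv_fun_sub hF hG, _root_.sub_apply]; module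

theorem dz_neg (F : ℂ → W) (z : ℂ) : dz (fun z => -F z) z = -dz F z := by
  simp only [dz, fderiv_fun_neg, _root_.neg_apply]; module

/-- The Wirtinger operators commute on smooth maps. -/
theorem dzb_dz [IsScalarTower ℝ ℂ W] {U : Set ℂ} {F : ℂ → W} (hU : IsOpen U) (hF : Smooth U F)
    {z : ℂ} (hz : z ∈ U) : dzb (dz F) z = dz (dzb F) z := by
  have h1 := (smooth_fderiv_apply hU hF 1).differentiableAt hU hz
  have hI := (smooth_fderiv_apply hU hF I).differentiableAt hU hz
  have hI' : DifferentiableAt ℝ (fun z => I • fderiv ℝ F z I) z :=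
    (Smooth.const_smul' (smooth_fderiv_apply hU hF I) I).differentiableAt hU hz
  have hd : DifferentiableAt ℝ (fderiv ℝ F) z :=
    ((hF.fderiv_of_isOpen hU (m := ∞) (by simp)).contDiffAt (hU.mem_nhds hz)).differentiableAt
      (by simp)
  have hap : ∀ X Y : ℂ, fderiv ℝ (fun z => fderiv ℝ F z X) z Y = fderiv ℝ (fderiv ℝ F) z Y X := by
    intro X Y
    rw [fderiv_clm_apply hd (differentiableAt_const X)]
    simp
  have hs : fderiv ℝ (fderiv ℝ F) z 1 I = fderiv ℝ (fderiv ℝ F) z I 1 := by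
    have := (hF.contDiffAt (hU.mem_nhds hz)).isSymmSndFDerivAt (n := ∞) (by
      simp only [minSmoothness_of_isRCLikeNormedField]; exact WithTop.coe_le_coe.2 (le_top : (2 : ℕ∞) ≤ ⊤))
    exact this 1 I
  have e1 : dzb (dz F) z = (1 / 2 : ℂ) • dzb (fun z => fderiv ℝ F z 1 - I • fderiv ℝ F z I) z :=
    dzb_const_smul (h1.sub hI') _
  have e2 : dz (dzb F) z = (1 / 2 : ℂ) • dz (fun z => fderiv ℝ F z 1 + I • fderiv ℝ F z I) z :=
    dz_const_smul (h1.add hI') _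
  rw [e1, e2, dzb_sub h1 hI', dz_add h1 hI', dzb_const_smul hI, dz_const_smul hI]
  simp only [dz, dzb, hap, hs]
  module

end Wirtinger

/-- The space `ℂ⁶`. -/
abbrev V6 : Type := Fin 6 → ℂ

theorem fderiv_star_apply {F : ℂ → V6} {z : ℂ} (hF : DifferentiableAt ℝ F z) (X : ℂ) :
    fderiv ℝ (fun z => star (F z)) z X = star (fderiv ℝ F z X) := by
  ext k
  have h1 := hasFDerivAt_pi'.1 hF.hasFDerivAt
  have h2 : HasFDerivAt (fun z => star (F z))
      (ContinuousLinearMap.pi fun k => (conjCLE : ℂ →L[ℝ] ℂ).comp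
        ((ContinuousLinearMap.proj k).comp (fderiv ℝ F z))) z := by
    rw [hasFDerivAt_pi']
    intro k
    exact (conjCLE : ℂ →L[ℝ] ℂ).hasFDerivAt.comp z (h1 k)
  rw [h2.fderiv]
  simp

theorem dz_star {F : ℂ → V6} {z : ℂ} (hF : DifferentiableAt ℝ F z) :
    dz (fun z => star (F z)) z = star (dzb F z) := by
  simp only [dz, dzb, fderiv_star_apply hF]
  ext k; simp; ring

theorem dzb_star {F : ℂ → V6} {z : ℂ} (hF : DifferentiableAt ℝ F z) :
    dzb (fun z => star (F z)) z = star (dz F z) := by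
  simp only [dz, dzb, fderiv_star_apply hF]
  ext k; simp

theorem Smooth.star' {U : Set ℂ} {F : ℂ → V6} (hF : Smooth U F) :
    Smooth U (fun z => star (F z)) := by
  refine contDiffOn_pi.2 fun k => ?_
  exact (conjCLE : ℂ →L[ℝ] ℂ).contDiff.comp_contDiffOn (contDiffOn_pi.1 hF k)

theorem Smooth.dot {U : Set ℂ} {F G : ℂ → V6} (hF : Smooth U F) (hG : Smooth U G) :
    Smooth U (fun z => F z ⬝ᵥ G z) := by
  exact ContDiffOn.sum fun k _ => (contDiffOn_pi.1 hF k).mul (contDiffOn_pi.1 hG k)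

theorem fderiv_dot_apply {F G : ℂ → V6} {z : ℂ} (hF : DifferentiableAt ℝ F z)
    (hG : DifferentiableAt ℝ G z) (X : ℂ) :
    fderiv ℝ (fun z => F z ⬝ᵥ G z) z X = fderiv ℝ F z X ⬝ᵥ G z + F z ⬝ᵥ fderiv ℝ G z X := by
  have h1 := hasFDerivAt_pi'.1 hF.hasFDerivAt
  have h2 := hasFDerivAt_pi'.1 hG.hasFDerivAt
  have h3 := HasFDerivAt.fun_sum (u := Finset.univ) fun k _ => (h1 k).mul (h2 k)
  have h' : fderiv ℝ (fun z => F z ⬝ᵥ G z) z = _ := h3.fderiv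
  rw [h']
  simp only [dotProduct, _root_.sum_apply, ← Finset.sum_add_distrib]
  refine Finset.sum_congr rfl fun k _ => ?_
  simp; ring

theorem dz_dot {F G : ℂ → V6} {z : ℂ} (hF : DifferentiableAt ℝ F z)
    (hG : DifferentiableAt ℝ G z) :
    dz (fun z => F z ⬝ᵥ G z) z = dz F z ⬝ᵥ G z + F z ⬝ᵥ dz G z := by
  simp only [dz, fderiv_dot_apply hF hG, smul_dotProduct, dotProduct_smul, sub_dotProduct,
    dotProduct_sub, smul_eq_mul]
  ring

theorem dzb_dot {F G : ℂ → V6} {z : ℂ} (hF : DifferentiableAt ℝ F z)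
    (hG : DifferentiableAt ℝ G z) :
    dzb (fun z => F z ⬝ᵥ G z) z = dzb F z ⬝ᵥ G z + F z ⬝ᵥ dzb G z := by
  simp only [dzb, fderiv_dot_apply hF hG, smul_dotProduct, dotProduct_smul, add_dotProduct,
    dotProduct_add, smul_eq_mul]
  ring

/-- The value of `(∂F, G)` when `(F, G)` is constant on an open set. -/
theorem dz_dot_of_const {U : Set ℂ} (hU : IsOpen U) {F G : ℂ → V6} (hF : Smooth U F)
    (hG : Smooth U G) {c : ℂ} (h : ∀ z ∈ U, F z ⬝ᵥ G z = c) {z : ℂ} (hz : z ∈ U) :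
    dz F z ⬝ᵥ G z = -(F z ⬝ᵥ dz G z) := by
  have h1 := dz_dot (hF.differentiableAt hU hz) (hG.differentiableAt hU hz)
  rw [dz_congr hU (G := fun _ => c) h hz, dz_const] at h1
  linear_combination -h1

theorem dzb_dot_of_const {U : Set ℂ} (hU : IsOpen U) {F G : ℂ → V6} (hF : Smooth U F)
    (hG : Smooth U G) {c : ℂ} (h : ∀ z ∈ U, F z ⬝ᵥ G z = c) {z : ℂ} (hz : z ∈ U) :
    dzb F z ⬝ᵥ G z = -(F z ⬝ᵥ dzb G z) := by
  have h1 := dzb_dot (hF.differentiableAt hU hz) (hG.differentiableAt hU hz)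
  rw [dzb_congr hU (G := fun _ => c) h hz, dzb_const] at h1
  linear_combination -h1

theorem dot_star_comm (X Y : V6) : star X ⬝ᵥ star Y = conj (X ⬝ᵥ Y) := by
  simp [dotProduct, map_sum]

theorem dot_star_self_eq_zero {X : V6} (h : X ⬝ᵥ star X = 0) : X = 0 := by
  open ComplexOrder in
  exact dotProduct_star_self_eq_zero.1 ((dotProduct_comm _ _).trans h)

theorem dot_star_self_conj (X : V6) : conj (X ⬝ᵥ star X) = X ⬝ᵥ star X := by
  rw [← dot_star_comm, star_star, dotProduct_comm]

/-- An identity of continuous functions on an open set holds if it holds on all open subsets on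
which a given continuous function has no zeros or vanishes identically. -/
theorem eqOn_of_dichotomy {α : Type*} [TopologicalSpace α] [T2Space α] {U : Set ℂ} (hU : IsOpen U)
    {σ : ℂ → ℂ} (hσ : ContinuousOn σ U) {F G : ℂ → α} (hF : ContinuousOn F U)
    (hG : ContinuousOn G U)
    (h : ∀ O ⊆ U, IsOpen O → ((∀ z ∈ O, σ z ≠ 0) ∨ ∀ z ∈ O, σ z = 0) → EqOn F G O) :
    EqOn F G U := by
  have hO1 : IsOpen (U ∩ σ ⁻¹' {0}ᶜ) := hσ.isOpen_inter_preimage hU isOpen_compl_singleton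
  have h1 := h _ inter_subset_left hO1 (Or.inl fun z hz => hz.2)
  have h2 := h (interior (U ∩ σ ⁻¹' {0})) (interior_subset.trans inter_subset_left)
    isOpen_interior (Or.inr fun z hz => (interior_subset hz).2)
  have hd : EqOn F G (U ∩ σ ⁻¹' {0}ᶜ ∪ interior (U ∩ σ ⁻¹' {0})) := by
    rintro z (hz | hz)
    exacts [h1 hz, h2 hz]
  -- The two open sets together are dense in `U`: a point of `U` outside the closure of the first
  -- has a neighbourhood on which `σ` vanishes, so it is interior to the zero set.
  refine hd.of_subset_closure hF hG
    (union_subset inter_subset_left (interior_subset.trans inter_subset_left)) ?_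
  intro z hz
  by_contra hc
  rw [closure_union, mem_union, not_or] at hc
  refine hc.2 (subset_closure (mem_interior.2 ⟨U ∩ (closure (U ∩ σ ⁻¹' {0}ᶜ))ᶜ, ?_, ?_, hz, hc.1⟩))
  · rintro w ⟨hw, hw'⟩
    refine ⟨hw, ?_⟩
    by_contra hne
    exact hw' (subset_closure ⟨hw, hne⟩)
  · exact hU.inter isClosed_closure.isOpen_compl

/-! ### Frames of `ℂ⁶` -/

/-- The matrix with six given rows. -/
def rows (a b c d e f : V6) : Matrix (Fin 6) (Fin 6) ℂ := Matrix.of ![a, b, c, d, e, f]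

/-- The matrix with independent rows is injective. Expansions in a frame are verified through this
instead of solving for coefficients. -/
theorem dot_ext {a b c d e f : V6} (h : (rows a b c d e f).det ≠ 0) {X Y : V6}
    (ha : a ⬝ᵥ X = a ⬝ᵥ Y) (hb : b ⬝ᵥ X = b ⬝ᵥ Y) (hc : c ⬝ᵥ X = c ⬝ᵥ Y)
    (hd : d ⬝ᵥ X = d ⬝ᵥ Y) (he : e ⬝ᵥ X = e ⬝ᵥ Y) (hf : f ⬝ᵥ X = f ⬝ᵥ Y) : X = Y := by
  have hinj := Matrix.mulVec_injective_of_isUnit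
    ((Matrix.isUnit_iff_isUnit_det _).2 (isUnit_iff_ne_zero.2 h))
  apply hinj
  ext i
  fin_cases i
  exacts [ha, hb, hc, hd, he, hf]

/-- A frame consisting of two orthogonal unit vectors and two orthogonal pairs of dual isotropic
vectors. -/
structure IsIsotropicFrame (g p p' ξ ξ' h : V6) (E σ : ℂ) : Prop where
  gg : g ⬝ᵥ g = 1
  gp : g ⬝ᵥ p = 0
  gp' : g ⬝ᵥ p' = 0
  gξ : g ⬝ᵥ ξ = 0
  gξ' : g ⬝ᵥ ξ' = 0
  gh : g ⬝ᵥ h = 0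
  pp : p ⬝ᵥ p = 0
  pp' : p ⬝ᵥ p' = E
  pξ : p ⬝ᵥ ξ = 0
  pξ' : p ⬝ᵥ ξ' = 0
  ph : p ⬝ᵥ h = 0
  p'p' : p' ⬝ᵥ p' = 0
  p'ξ : p' ⬝ᵥ ξ = 0
  p'ξ' : p' ⬝ᵥ ξ' = 0
  p'h : p' ⬝ᵥ h = 0
  ξξ : ξ ⬝ᵥ ξ = 0
  ξξ' : ξ ⬝ᵥ ξ' = σ
  ξh : ξ ⬝ᵥ h = 0
  ξ'ξ' : ξ' ⬝ᵥ ξ' = 0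
  ξ'h : ξ' ⬝ᵥ h = 0
  hh : h ⬝ᵥ h = 1

/-- The dual frame is explicit: `g` and `h` are self-dual, while `p`, `p'` and `ξ`, `ξ'` are
exchanged and divided by `E` and `σ`. -/
theorem IsIsotropicFrame.det_ne_zero {g p p' ξ ξ' h : V6} {E σ : ℂ}
    (H : IsIsotropicFrame g p p' ξ ξ' h E σ) (hE : E ≠ 0) (hσ : σ ≠ 0) :
    (rows g p p' ξ ξ' h).det ≠ 0 := by
  have key : rows g p p' ξ ξ' h *
      (rows g (E⁻¹ • p') (E⁻¹ • p) (σ⁻¹ • ξ') (σ⁻¹ • ξ) h)ᵀ = 1 := by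
    ext i j
    change ![g, p, p', ξ, ξ', h] i ⬝ᵥ
      ![g, E⁻¹ • p', E⁻¹ • p, σ⁻¹ • ξ', σ⁻¹ • ξ, h] j = _
    fin_cases i <;> fin_cases j <;>
    simp [H.gg, H.gp, H.gp', H.gξ, H.gξ', H.gh, H.pp, H.pp', H.pξ, H.pξ', H.ph, H.p'p',
      H.p'ξ, H.p'ξ', H.p'h, H.ξξ, H.ξξ', H.ξh, H.ξ'ξ', H.ξ'h, H.hh, dotProduct_comm p g,
      dotProduct_comm p' g, dotProduct_comm ξ g, dotProduct_comm ξ' g, dotProduct_comm h g,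
      dotProduct_comm p' p, dotProduct_comm ξ p, dotProduct_comm ξ' p, dotProduct_comm h p,
      dotProduct_comm ξ p', dotProduct_comm ξ' p', dotProduct_comm h p', dotProduct_comm ξ' ξ,
      dotProduct_comm h ξ, dotProduct_comm h ξ', hE, hσ]
  intro h0
  have := congrArg Matrix.det key
  rw [Matrix.det_mul, h0, zero_mul, Matrix.det_one] at this
  exact zero_ne_one this

/-- Reduces the determinant of a new frame to that of its coefficient matrix over the old one. -/
theorem rows_eq_mul {a b c d e f a' b' c' d' e' f' : V6} (C : Matrix (Fin 6) (Fin 6) ℂ)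
    (h0 : a' = C 0 0 • a + C 0 1 • b + C 0 2 • c + C 0 3 • d + C 0 4 • e + C 0 5 • f)
    (h1 : b' = C 1 0 • a + C 1 1 • b + C 1 2 • c + C 1 3 • d + C 1 4 • e + C 1 5 • f)
    (h2 : c' = C 2 0 • a + C 2 1 • b + C 2 2 • c + C 2 3 • d + C 2 4 • e + C 2 5 • f)
    (h3 : d' = C 3 0 • a + C 3 1 • b + C 3 2 • c + C 3 3 • d + C 3 4 • e + C 3 5 • f)
    (h4 : e' = C 4 0 • a + C 4 1 • b + C 4 2 • c + C 4 3 • d + C 4 4 • e + C 4 5 • f)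
    (h5 : f' = C 5 0 • a + C 5 1 • b + C 5 2 • c + C 5 3 • d + C 5 4 • e + C 5 5 • f) :
    rows a' b' c' d' e' f' = C * rows a b c d e f := by
  ext i k
  fin_cases i <;> simp [rows, Matrix.mul_apply, Fin.sum_univ_six, h0, h1, h2, h3, h4, h5]

/-- Passing from `(g, p, p', ξ, ξ', h)` to the derivatives of `g` does not change the
determinant. -/
theorem det_rows_add (g p p' ξ ξ' h : V6) (s s' t t' : ℂ) :
    (rows g p p' (ξ + s • h + t • p) (ξ' + s' • h + t' • p') h).det
      = (rows g p p' ξ ξ' h).det := by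
  rw [rows_eq_mul (a := g) (b := p) (c := p') (d := ξ) (e := ξ') (f := h)
    !![1, 0, 0, 0, 0, 0; 0, 1, 0, 0, 0, 0; 0, 0, 1, 0, 0, 0; 0, t, 0, 1, 0, s;
      0, 0, t', 0, 1, s'; 0, 0, 0, 0, 0, 1] (by simp) (by simp) (by simp)
      (by simp; abel) (by simp; abel) (by simp), Matrix.det_mul]
  rw [Matrix.det_succ_row_zero]; simp [Fin.sum_univ_succ]
  rw [Matrix.det_succ_row_zero]; simp [Fin.sum_univ_succ]
  rw [Matrix.det_succ_row_zero]; simp [Fin.sum_univ_succ]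
  rw [Matrix.det_fin_three]; simp

/-- This is the change from the derivative frame of `g` to that of its transform `h`. When the
primed coefficients are the conjugates of the others, the factor is minus a squared modulus; this
sign is what separates the two transforms. -/
theorem det_rows_transform (g p p' ξ ξ' h : V6) (m m' l l' u u' B B' C C' : ℂ) :
    (rows h (m • p' + l • ξ') (m' • p + l' • ξ) (u • g + B • p' + C • ξ')
      (u' • g + B' • p + C' • ξ) g).det
      = -((m * C - l * B) * (m' * C' - l' * B')) * (rows g p p' ξ ξ' h).det := by
  rw [rows_eq_mul (a := g) (b := p) (c := p') (d := ξ) (e := ξ') (f := h)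
    !![0, 0, 0, 0, 0, 1; 0, 0, m, 0, l, 0; 0, m', 0, l', 0, 0; u, 0, B, 0, C, 0;
      u', B', 0, C', 0, 0; 1, 0, 0, 0, 0, 0] (by simp) (by simp) (by simp)
      (by simp) (by simp) (by simp), Matrix.det_mul]
  congr 1
  rw [Matrix.det_succ_row_zero]; simp [Fin.sum_univ_succ]
  rw [Matrix.det_succ_row _ (4 : Fin 5)]; simp [Fin.sum_univ_succ]
  rw [Matrix.det_succ_row_zero]; simp [Fin.sum_univ_succ]
  simp [Matrix.det_fin_three, Fin.succAbove]
  ring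

/-- The determinant of the real frame of a surface in terms of its complex derivatives. -/
theorem det_rows_real (g p p' q q' h : V6) :
    (rows g (p + p') (I • (p - p')) (q + q') (I • (q - q')) h).det
      = -4 * (rows g p p' q q' h).det := by
  rw [rows_eq_mul (a := g) (b := p) (c := p') (d := q) (e := q') (f := h)
    !![1, 0, 0, 0, 0, 0; 0, 1, 1, 0, 0, 0; 0, I, -I, 0, 0, 0; 0, 0, 0, 1, 1, 0;
      0, 0, 0, I, -I, 0; 0, 0, 0, 0, 0, 1] (by simp) (by simp) (by simp [smul_sub]; abel)
      (by simp) (by simp [smul_sub]; abel) (by simp), Matrix.det_mul]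
  congr 1
  rw [Matrix.det_succ_row_zero]; simp [Fin.sum_univ_succ]
  rw [Matrix.det_succ_row _ (4 : Fin 5)]; simp [Fin.sum_univ_succ]
  rw [Matrix.det_succ_row_zero]; simp [Fin.sum_univ_succ]
  simp [Matrix.det_fin_three, Fin.succAbove]
  ring_nf

/-! ### Minimal surfaces in a complex coordinate -/

/-- The conformal factor `|∂g|²`. -/
def metricFactor (g : ℂ → V6) (z : ℂ) : ℂ := dz g z ⬝ᵥ star (dz g z)

/-- The component of `∂∂g` orthogonal to the tangent plane. -/
def sff (g : ℂ → V6) (z : ℂ) : V6 :=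
  dz (dz g) z - (dz (dz g) z ⬝ᵥ star (dz g z) / metricFactor g z) • dz g z

/-- The quantity `|g₂|² - 1`, which is `2 |a|²` in an adapted coordinate. -/
def defect (g : ℂ → V6) (z : ℂ) : ℂ := sff g z ⬝ᵥ star (sff g z) - 1

/-- A conformal minimal immersion of a coordinate domain into the unit sphere. -/
structure IsMinimal (U : Set ℂ) (g : ℂ → V6) : Prop where
  smooth : Smooth U g
  real : ∀ z ∈ U, star (g z) = g z
  unit : ∀ z ∈ U, g z ⬝ᵥ g z = 1
  immersed : ∀ z ∈ U, dz g z ≠ 0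
  conformal : ∀ z ∈ U, dz g z ⬝ᵥ dz g z = 0
  harmonic : ∀ z ∈ U, dzb (dz g) z = -(metricFactor g z) • g z

/-- A conformal minimal immersion in a coordinate with `(g₂, g₂) = -1`. -/
structure IsAdapted (U : Set ℂ) (g : ℂ → V6) : Prop extends IsMinimal U g where
  quartic : ∀ z ∈ U, dz (dz g) z ⬝ᵥ dz (dz g) z = -1

/-- The algebraic relations between a minimal surface and its transforms. -/
structure IsPair (U : Set ℂ) (g h : ℂ → V6) : Prop where
  smooth : Smooth U h
  real : ∀ z ∈ U, star (h z) = h z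
  unit : ∀ z ∈ U, h z ⬝ᵥ h z = 1
  hg : ∀ z ∈ U, h z ⬝ᵥ g z = 0
  hg1 : ∀ z ∈ U, h z ⬝ᵥ dz g z = 0
  hp : ∀ z ∈ U, h z ⬝ᵥ dz (dz g) z = I

theorem IsAdapted.mono {O U : Set ℂ} (hOU : O ⊆ U) {g : ℂ → V6} (H : IsAdapted U g) : IsAdapted O g :=
  ⟨⟨H.smooth.mono hOU, fun z hz => H.real z (hOU hz), fun z hz => H.unit z (hOU hz),
    fun z hz => H.immersed z (hOU hz), fun z hz => H.conformal z (hOU hz),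
    fun z hz => H.harmonic z (hOU hz)⟩, fun z hz => H.quartic z (hOU hz)⟩

theorem IsPair.mono {O U : Set ℂ} (hOU : O ⊆ U) {g h : ℂ → V6} (H : IsPair U g h) :
    IsPair O g h :=
  ⟨H.smooth.mono hOU, fun z hz => H.real z (hOU hz), fun z hz => H.unit z (hOU hz),
    fun z hz => H.hg z (hOU hz), fun z hz => H.hg1 z (hOU hz), fun z hz => H.hp z (hOU hz)⟩

theorem dzb_eq_star_dz {U : Set ℂ} (hU : IsOpen U) {g : ℂ → V6} (hs : Smooth U g)
    (hr : ∀ z ∈ U, star (g z) = g z) {z : ℂ} (hz : z ∈ U) : dzb g z = star (dz g z) := by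
  rw [← dzb_star (hs.differentiableAt hU hz)]
  exact (dzb_congr hU hr hz).symm

theorem dz_star_dz {U : Set ℂ} (hU : IsOpen U) {g : ℂ → V6} (hs : Smooth U g) {z : ℂ}
    (hz : z ∈ U) : dz (fun z => star (dz g z)) z = star (dzb (dz g) z) :=
  dz_star ((hs.dz hU).differentiableAt hU hz)

/-- For a real map the mixed second derivative is real. -/
theorem star_dzb_dz {U : Set ℂ} (hU : IsOpen U) {g : ℂ → V6} (hs : Smooth U g)
    (hr : ∀ z ∈ U, star (g z) = g z) {z : ℂ} (hz : z ∈ U) :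
    star (dzb (dz g) z) = dzb (dz g) z := by
  rw [← dz_star_dz hU hs hz, dzb_dz hU hs hz]
  exact dz_congr hU (fun w hw => (dzb_eq_star_dz hU hs hr hw).symm) hz

/-- Conjugation of the product with a real vector. -/
theorem dot_star_of_real {X Y : V6} (hX : star X = X) : X ⬝ᵥ star Y = conj (X ⬝ᵥ Y) := by
  rw [← dot_star_comm, hX]

theorem dz_dz_eq (g : ℂ → V6) (z : ℂ) : dz (dz g) z
    = sff g z + (dz (dz g) z ⬝ᵥ star (dz g z) / metricFactor g z) • dz g z := by
  rw [sff]; abel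

namespace IsMinimal

variable {U : Set ℂ} {g : ℂ → V6} (H : IsMinimal U g) (hU : IsOpen U) {z : ℂ}

include H

theorem metricFactor_ne (hz : z ∈ U) : metricFactor g z ≠ 0 := fun h0 =>
  H.immersed z hz (dot_star_self_eq_zero h0)

theorem sff_g1' (hz : z ∈ U) : sff g z ⬝ᵥ star (dz g z) = 0 := by
  have hE := H.metricFactor_ne hz
  have : dz g z ⬝ᵥ star (dz g z) = metricFactor g z := rfl
  rw [sff, sub_dotProduct, smul_dotProduct, this, smul_eq_mul]
  field_simp
  ring

include hU

theorem smooth_metricFactor : Smooth U (metricFactor g) :=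
  (H.smooth.dz hU).dot (H.smooth.dz hU).star'

theorem g_g1 (hz : z ∈ U) : g z ⬝ᵥ dz g z = 0 := by
  have h1 := dz_dot_of_const hU H.smooth H.smooth H.unit hz
  rw [dotProduct_comm] at h1
  linear_combination h1 / 2

theorem g_g1' (hz : z ∈ U) : g z ⬝ᵥ star (dz g z) = 0 := by
  rw [dot_star_of_real (H.real z hz), H.g_g1 hU hz, map_zero]

theorem dz_star_g1 (hz : z ∈ U) :
    dz (fun z => star (dz g z)) z = -(metricFactor g z) • g z := by
  rw [dz_star_dz hU H.smooth hz, star_dzb_dz hU H.smooth H.real hz, H.harmonic z hz]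

theorem p_g (hz : z ∈ U) : dz (dz g) z ⬝ᵥ g z = 0 := by
  rw [dz_dot_of_const hU (H.smooth.dz hU) H.smooth (c := 0)
    (fun w hw => by rw [dotProduct_comm]; exact H.g_g1 hU hw) hz, H.conformal z hz, neg_zero]

theorem p_g1 (hz : z ∈ U) : dz (dz g) z ⬝ᵥ dz g z = 0 := by
  have h1 := dz_dot_of_const hU (H.smooth.dz hU) (H.smooth.dz hU) H.conformal hz
  have h2 := dotProduct_comm (dz g z) (dz (dz g) z)
  linear_combination h1 / 2 - h2 / 2

/-- The other term of the product rule is a multiple of `(∂g, g) = 0`, since `∂` of the conjugate of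
`∂g` is `-E g`. -/
theorem dz_metricFactor (hz : z ∈ U) :
    dz (metricFactor g) z = dz (dz g) z ⬝ᵥ star (dz g z) := by
  have h1 := dz_dot ((H.smooth.dz hU).differentiableAt hU hz)
    ((H.smooth.dz hU).star'.differentiableAt hU hz)
  rw [H.dz_star_g1 hU hz, dotProduct_smul, dotProduct_comm (dz g z) (g z), H.g_g1 hU hz,
    smul_zero, add_zero] at h1
  exact h1

theorem sff_g (hz : z ∈ U) : sff g z ⬝ᵥ g z = 0 := by
  rw [sff, sub_dotProduct, smul_dotProduct, H.p_g hU hz, dotProduct_comm (dz g z),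
    H.g_g1 hU hz, smul_zero, sub_zero]

theorem sff_g1 (hz : z ∈ U) : sff g z ⬝ᵥ dz g z = 0 := by
  rw [sff, sub_dotProduct, smul_dotProduct, H.p_g1 hU hz, H.conformal z hz, smul_zero, sub_zero]

theorem sff_sff (hz : z ∈ U) : sff g z ⬝ᵥ sff g z = dz (dz g) z ⬝ᵥ dz (dz g) z := by
  have h := dz_dz_eq g z
  set c := dz (dz g) z ⬝ᵥ star (dz g z) / metricFactor g z
  rw [h]
  simp only [add_dotProduct, dotProduct_add, smul_dotProduct, dotProduct_smul,
    H.sff_g1 hU hz, H.conformal z hz, dotProduct_comm (dz g z) (sff g z)]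
  simp

theorem smooth_coeff : Smooth U
    (fun z => dz (dz g) z ⬝ᵥ star (dz g z) / metricFactor g z) :=
  (((H.smooth.dz hU).dz hU).dot (H.smooth.dz hU).star').mul
    ((H.smooth_metricFactor hU).inv fun _ hz => H.metricFactor_ne hz)

theorem smooth_sff : Smooth U (sff g) :=
  ((H.smooth.dz hU).dz hU).sub (Smooth.smul' (H.smooth_coeff hU) (H.smooth.dz hU))

theorem smooth_defect : Smooth U (defect g) :=
  ((H.smooth_sff hU).dot (H.smooth_sff hU).star').sub contDiffOn_const

/-- The Codazzi equation. -/
theorem exists_dzb_sff (hz : z ∈ U) : ∃ κ : ℂ, dzb (sff g) z = κ • dz g z := by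
  have hE := H.metricFactor_ne hz
  have s1 := H.smooth.dz hU
  have h1 : dzb (dz (dz g)) z = -(dz (metricFactor g) z • g z + metricFactor g z • dz g z) := by
    rw [dzb_dz hU s1 hz, dz_congr hU (G := fun z => -(metricFactor g z • g z))
      (fun w hw => by rw [H.harmonic w hw, neg_smul]) hz, dz_neg,
      dz_smul ((H.smooth_metricFactor hU).differentiableAt hU hz) (H.smooth.differentiableAt hU hz),
      add_comm]
  have h2 := dzb_smul ((H.smooth_coeff hU).differentiableAt hU hz) (s1.differentiableAt hU hz)
  -- The `g`-components of `∂̄∂∂g` and of `∂̄` of the tangential term cancel because the tangential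
  -- coefficient times `E` is `∂E`; only multiples of `∂g` remain.
  refine ⟨-(metricFactor g z +
    dzb (fun z => dz (dz g) z ⬝ᵥ star (dz g z) / metricFactor g z) z), ?_⟩
  have h3 : dzb (sff g) z = _ := dzb_sub ((s1.dz hU).differentiableAt hU hz)
    ((Smooth.smul' (H.smooth_coeff hU) s1).differentiableAt hU hz)
  rw [h3, h2, h1, H.harmonic z hz, H.dz_metricFactor hU hz, smul_smul, mul_neg,
    div_mul_cancel₀ _ hE]
  module

/-- By Codazzi, `∂̄g₂` is tangential while `g₂` is normal. This holomorphy of the quartic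
differential is what makes adapted coordinates possible. -/
theorem dzb_sff_sff (hz : z ∈ U) : dzb (fun z => sff g z ⬝ᵥ sff g z) z = 0 := by
  obtain ⟨κ, hκ⟩ := H.exists_dzb_sff hU hz
  have d := (H.smooth_sff hU).differentiableAt hU hz
  rw [dzb_dot d d, hκ, smul_dotProduct, dotProduct_smul, dotProduct_comm (dz g z), H.sff_g1 hU hz]
  simp

end IsMinimal

namespace IsPair

variable {U : Set ℂ} {g h : ℂ → V6} (P : IsPair U g h) (H : IsMinimal U g) (hU : IsOpen U) {z : ℂ}

include P

theorem hg1' (hz : z ∈ U) : h z ⬝ᵥ star (dz g z) = 0 := by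
  rw [dot_star_of_real (P.real z hz), P.hg1 z hz, map_zero]

theorem h_sff (hz : z ∈ U) : h z ⬝ᵥ sff g z = I := by
  rw [sff, dotProduct_sub, dotProduct_smul, P.hp z hz, P.hg1 z hz, smul_zero, sub_zero]

theorem h_sff' (hz : z ∈ U) : h z ⬝ᵥ star (sff g z) = -I := by
  rw [dot_star_of_real (P.real z hz), P.h_sff hz, conj_I]

include hU

theorem h1_h (hz : z ∈ U) : dz h z ⬝ᵥ h z = 0 := by
  have h1 := dz_dot_of_const hU P.smooth P.smooth P.unit hz
  rw [dotProduct_comm (h z)] at h1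
  linear_combination h1 / 2

include H

theorem h1_g (hz : z ∈ U) : dz h z ⬝ᵥ g z = 0 := by
  rw [dz_dot_of_const hU P.smooth H.smooth P.hg hz, P.hg1 z hz, neg_zero]

theorem h1_g1 (hz : z ∈ U) : dz h z ⬝ᵥ dz g z = -I := by
  rw [dz_dot_of_const hU P.smooth (H.smooth.dz hU) P.hg1 hz, P.hp z hz]

/-- Differentiating the orthogonality of `h` and the conjugate of `∂g` leaves `E (h, g)`, by
harmonicity of `g`. -/
theorem h1_g1' (hz : z ∈ U) : dz h z ⬝ᵥ star (dz g z) = 0 := by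
  rw [dz_dot_of_const hU P.smooth (H.smooth.dz hU).star' (fun w hw => P.hg1' hw) hz,
    H.dz_star_g1 hU hz, dotProduct_smul, P.hg z hz, smul_zero, neg_zero]

/-- The product of `h` with the conjugate of `g₂` is the constant `-i`, and the conjugate Codazzi
equation makes the derivative of that second factor orthogonal to `h`. -/
theorem h1_sff' (hz : z ∈ U) : dz h z ⬝ᵥ star (sff g z) = 0 := by
  obtain ⟨κ, hκ⟩ := H.exists_dzb_sff hU hz
  rw [dz_dot_of_const hU P.smooth (H.smooth_sff hU).star' (fun w hw => P.h_sff' hw) hz,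
    dz_star ((H.smooth_sff hU).differentiableAt hU hz), hκ, star_smul, dotProduct_smul,
    P.hg1' hz, smul_zero, neg_zero]

end IsPair

/-! ### The transform of a minimal surface is a minimal surface -/

theorem conj_metricFactor (g : ℂ → V6) (z : ℂ) : conj (metricFactor g z) = metricFactor g z :=
  dot_star_self_conj _

/-- The isotropic vector `g₂ - i h`. -/
def isoVec (g h : ℂ → V6) (z : ℂ) : V6 := sff g z - I • h z

theorem dz_dz_eq_isoVec (g h : ℂ → V6) (z : ℂ) : dz (dz g) z
    = isoVec g h z + I • h z + (dz (dz g) z ⬝ᵥ star (dz g z) / metricFactor g z) • dz g z := by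
  rw [isoVec, sub_add_cancel]; exact dz_dz_eq g z

namespace IsPair

variable {U : Set ℂ} {g h : ℂ → V6} (P : IsPair U g h) (H : IsAdapted U g) (hU : IsOpen U) {z : ℂ}

include P

theorem star_isoVec (hz : z ∈ U) : star (isoVec g h z) = star (sff g z) + I • h z := by
  simp [isoVec, star_smul, P.real z hz]

/-- The determinant of the frame given by a surface and its transform. -/
theorem det_rows (hz : z ∈ U) :
    (rows (g z) (dz g z) (star (dz g z)) (dz (dz g) z) (star (dz (dz g) z)) (h z)).det
      = (rows (g z) (dz g z) (star (dz g z)) (isoVec g h z) (star (isoVec g h z)) (h z)).det := by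
  have h1 := dz_dz_eq_isoVec g h z
  have h2 : star (dz (dz g) z) = star (isoVec g h z) + (-I) • h z +
      conj (dz (dz g) z ⬝ᵥ star (dz g z) / metricFactor g z) • star (dz g z) := by
    conv_lhs => rw [h1]
    rw [star_add, star_add, star_smul, star_smul, P.real z hz]
    simp
  have h3 := det_rows_add (g z) (dz g z) (star (dz g z)) (isoVec g h z) (star (isoVec g h z)) (h z)
    I (-I) (dz (dz g) z ⬝ᵥ star (dz g z) / metricFactor g z)
    (conj (dz (dz g) z ⬝ᵥ star (dz g z) / metricFactor g z))
  rwa [← h1, ← h2] at h3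

include hU

theorem dzb_dz_h (hz : z ∈ U) : dzb (dz h) z ⬝ᵥ h z = -metricFactor h z := by
  rw [dzb_dot_of_const hU (P.smooth.dz hU) P.smooth (fun w hw => P.h1_h hU hw) hz,
    dzb_eq_star_dz hU P.smooth P.real hz]
  rfl

include H

theorem smooth_isoVec : Smooth U (isoVec g h) :=
  (H.smooth_sff hU).sub (P.smooth.const_smul' I)

/-- `(g₂ - ih, g₂ - ih) = (g₂, g₂) - 2i(h, g₂) - (h, h) = -1 + 2 - 1`. -/
theorem isoVec_isoVec (hz : z ∈ U) : isoVec g h z ⬝ᵥ isoVec g h z = 0 := by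
  simp only [isoVec, sub_dotProduct, dotProduct_sub, smul_dotProduct, dotProduct_smul,
    H.sff_sff hU hz, H.quartic z hz, P.h_sff hz, dotProduct_comm (sff g z) (h z), P.unit z hz,
    smul_eq_mul, mul_one, I_mul_I]
  ring

/-- All relations follow from the orthogonality of `g`, its tangent plane and the normal vectors
`ξ`, `h`. The one computation is the Hermitian norm of `ξ`, which equals `|g₂|² - 1`; hence the
frame degenerates exactly where the defect vanishes. -/
theorem isIsotropicFrame (hz : z ∈ U) :
    IsIsotropicFrame (g z) (dz g z) (star (dz g z)) (isoVec g h z) (star (isoVec g h z)) (h z)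
      (metricFactor g z) (defect g z) := by
  have hr := H.real z hz
  have e1 : dz g z ⬝ᵥ isoVec g h z = 0 := by
    rw [isoVec, dotProduct_sub, dotProduct_smul, dotProduct_comm, H.sff_g1 hU hz,
      dotProduct_comm, P.hg1 z hz, smul_zero, sub_zero]
  have e2 : star (dz g z) ⬝ᵥ isoVec g h z = 0 := by
    rw [isoVec, dotProduct_sub, dotProduct_smul, dotProduct_comm, H.sff_g1' hz,
      dotProduct_comm, P.hg1' hz, smul_zero, sub_zero]
  have e3 : g z ⬝ᵥ isoVec g h z = 0 := by
    rw [isoVec, dotProduct_sub, dotProduct_smul, dotProduct_comm, H.sff_g hU hz,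
      dotProduct_comm, P.hg z hz, smul_zero, sub_zero]
  have e4 : isoVec g h z ⬝ᵥ h z = 0 := by
    rw [isoVec, sub_dotProduct, smul_dotProduct, dotProduct_comm, P.h_sff hz, P.unit z hz]
    simp
  have e5 := P.isoVec_isoVec H hU hz
  refine ⟨H.unit z hz, H.g_g1 hU hz, H.g_g1' hU hz, e3, ?_, ?_, H.conformal z hz, rfl, e1, ?_, ?_,
    ?_, e2, ?_, ?_, e5, ?_, e4, ?_, ?_, P.unit z hz⟩
  · rw [dot_star_of_real hr, e3, map_zero]
  · rw [dotProduct_comm, P.hg z hz]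
  · rw [← star_star (dz g z), dot_star_comm, e2, map_zero]
  · rw [dotProduct_comm, P.hg1 z hz]
  · rw [dot_star_comm, H.conformal z hz, map_zero]
  · rw [dot_star_comm, e1, map_zero]
  · rw [dotProduct_comm, P.hg1' hz]
  · rw [P.star_isoVec hz]
    simp only [isoVec, sub_dotProduct, dotProduct_add, smul_dotProduct, dotProduct_smul,
      P.h_sff' hz, P.unit z hz, dotProduct_comm (sff g z) (h z), P.h_sff hz, smul_eq_mul, defect]
    linear_combination I_mul_I
  · rw [dot_star_comm, e5, map_zero]
  · rw [← P.real z hz, dot_star_comm, e4, map_zero]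

theorem det_rows_ne_zero (hz : z ∈ U) (hσ : defect g z ≠ 0) :
    (rows (g z) (dz g z) (star (dz g z)) (dz (dz g) z) (star (dz (dz g) z)) (h z)).det ≠ 0 := by
  rw [P.det_rows hz]
  exact (P.isIsotropicFrame H hU hz).det_ne_zero (H.metricFactor_ne hz) hσ

theorem isoVec_eq_zero (hz : z ∈ U) (hσ : defect g z = 0) : isoVec g h z = 0 :=
  dot_star_self_eq_zero ((P.isIsotropicFrame H hU hz).ξξ'.trans hσ)

/-- The derivative of the transform in terms of the frame of the surface. -/
theorem exists_dz_eq (hσ : (∀ z ∈ U, defect g z ≠ 0) ∨ ∀ z ∈ U, defect g z = 0) :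
    ∃ l : ℂ → ℂ, Smooth U l ∧ ∀ z ∈ U, dz h z =
      (-I * (metricFactor g z)⁻¹) • star (dz g z) + l z • star (isoVec g h z) := by
  rcases hσ with hσ | hσ
  -- Each coefficient is the product with the dual frame vector. All except two of these products
  -- vanish; the one with `∂g` is `-i`, and the one with `ξ` defines `l`.
  · refine ⟨fun z => (dz h z ⬝ᵥ isoVec g h z) * (defect g z)⁻¹,
      ((P.smooth.dz hU).dot (P.smooth_isoVec H hU)).mul ((H.smooth_defect hU).inv hσ),
      fun z hz => ?_⟩
    have F := P.isIsotropicFrame H hU hz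
    have hE := H.metricFactor_ne hz
    refine dot_ext (F.det_ne_zero hE (hσ z hz)) ?_ ?_ ?_ ?_ ?_ ?_
    · rw [dotProduct_comm, P.h1_g H.toIsMinimal hU hz]
      simp [F.gp', F.gξ']
    · rw [dotProduct_comm, P.h1_g1 H.toIsMinimal hU hz]
      simp [F.pp', F.pξ', hE]
    · rw [dotProduct_comm, P.h1_g1' H.toIsMinimal hU hz]
      simp [F.p'p', F.p'ξ']
    · rw [dotProduct_comm]
      simp [F.ξξ', dotProduct_comm _ (star (dz g z)), F.p'ξ, hσ z hz]
    · rw [dotProduct_comm]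
      simp [F.ξ'ξ', dotProduct_comm _ (star (dz g z)), F.p'ξ']
      rw [P.star_isoVec hz, dotProduct_add, P.h1_sff' H.toIsMinimal hU hz, dotProduct_smul,
        P.h1_h hU hz, smul_zero, add_zero]
    · rw [dotProduct_comm, P.h1_h hU hz]
      simp [dotProduct_comm (h z), F.p'h, F.ξ'h]
  · refine ⟨fun _ => 0, contDiffOn_const, fun z hz => ?_⟩
    -- Here `ξ = 0`, so `h` is a multiple of `g₂` and Codazzi gives `∂̄h` at once; conjugation gives
    -- `∂h`.
    have hh : EqOn h (fun z => -I • sff g z) U := fun w hw => by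
      have := P.isoVec_eq_zero H hU hw (hσ w hw)
      rw [isoVec, sub_eq_zero] at this
      simp only [this, smul_smul]; simp
    obtain ⟨κ, hκ⟩ := H.exists_dzb_sff hU hz
    have h1 : dzb h z = (-I * κ) • dz g z := by
      rw [dzb_congr hU hh hz, dzb_const_smul ((H.smooth_sff hU).differentiableAt hU hz), hκ,
        smul_smul]
    have h2 : dz h z = conj (-I * κ) • star (dz g z) := by
      rw [← star_star (dz h z), ← dzb_eq_star_dz hU P.smooth P.real hz, h1, star_smul,
        starRingEnd_apply]
    have h3 := P.h1_g1 H.toIsMinimal hU hz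
    rw [h2, smul_dotProduct, dotProduct_comm, smul_eq_mul] at h3
    rw [h2, zero_smul, add_zero]
    congr 1
    exact (eq_mul_inv_iff_mul_eq₀ (H.metricFactor_ne hz)).2 h3

/-- The second derivative of the transform in terms of the frame of the surface. -/
theorem exists_dz_dz_eq {l : ℂ → ℂ} (hl : Smooth U l)
    (hh : ∀ z ∈ U, dz h z =
      (-I * (metricFactor g z)⁻¹) • star (dz g z) + l z • star (isoVec g h z)) (hz : z ∈ U) :
    ∃ B C : ℂ, dz (dz h) z = I • g z + B • star (dz g z) + C • star (isoVec g h z) := by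
  have hE := H.metricFactor_ne hz
  have sc : Smooth U (fun z => -I * (metricFactor g z)⁻¹) :=
    contDiffOn_const.mul ((H.smooth_metricFactor hU).inv fun _ hz => H.metricFactor_ne hz)
  have s1 := (H.smooth.dz hU).star'
  have s2 := (P.smooth_isoVec H hU).star'
  obtain ⟨κ, hκ⟩ := H.exists_dzb_sff hU hz
  -- By the conjugate Codazzi equation this derivative stays in the span of the conjugates of `∂g`
  -- and `ξ`, since `∂h` itself lies there.
  have h1 : dz (fun z => star (isoVec g h z)) z = conj κ • star (dz g z) + I • dz h z := by
    rw [dz_star ((P.smooth_isoVec H hU).differentiableAt hU hz)]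
    have : dzb (isoVec g h) z = _ := dzb_sub ((H.smooth_sff hU).differentiableAt hU hz)
      ((P.smooth.const_smul' I).differentiableAt hU hz)
    rw [this, hκ, dzb_const_smul (P.smooth.differentiableAt hU hz),
      dzb_eq_star_dz hU P.smooth P.real hz]
    simp [star_smul]
  have h2 := dz_add ((Smooth.smul' sc s1).differentiableAt hU hz)
    ((Smooth.smul' hl s2).differentiableAt hU hz)
  rw [dz_smul (sc.differentiableAt hU hz) (s1.differentiableAt hU hz),
    dz_smul (hl.differentiableAt hU hz) (s2.differentiableAt hU hz), h1, H.dz_star_g1 hU hz,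
    hh z hz, ← dz_congr hU hh hz] at h2
  set c' := dz (fun z => -I * (metricFactor g z)⁻¹) z
  -- The only term along `g` arises from `∂` of the conjugate of `∂g`, and the conformal factor
  -- cancels.
  have h3 : (-I * (metricFactor g z)⁻¹) • -metricFactor g z • g z = I • g z := by
    rw [smul_smul]; congr 1; field_simp
  refine ⟨c' + l z * (conj κ + I * (-I * (metricFactor g z)⁻¹)), dz l z + l z * (I * l z), ?_⟩
  rw [h2, h3]
  module

/-- Differentiating `(∂h, g) = 0` gives `(∂∂h, g) = -(∂h, ∂g) = i`. The choice of `ε` does not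
enter. -/
theorem symm : IsPair U h g := by
  refine ⟨H.smooth, H.real, H.unit, fun z hz => by rw [dotProduct_comm, P.hg z hz], fun z hz => by
    rw [dotProduct_comm, P.h1_g H.toIsMinimal hU hz], fun z hz => ?_⟩
  rw [dotProduct_comm, dz_dot_of_const hU (P.smooth.dz hU) H.smooth
    (fun w hw => P.h1_g H.toIsMinimal hU hw) hz, P.h1_g1 H.toIsMinimal hU hz, neg_neg]

theorem dz_ne_zero (hz : z ∈ U) : dz h z ≠ 0 := fun h0 => by
  have := P.h1_g1 H.toIsMinimal hU hz
  rw [h0, zero_dotProduct] at this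
  exact I_ne_zero (neg_eq_zero.1 this.symm)

/-- `∂h` lies in the totally isotropic span of the conjugates of `∂g` and `ξ`. -/
theorem conformal_of_expansion {l : ℂ → ℂ}
    (hh : ∀ z ∈ U, dz h z =
      (-I * (metricFactor g z)⁻¹) • star (dz g z) + l z • star (isoVec g h z)) (hz : z ∈ U) :
    dz h z ⬝ᵥ dz h z = 0 := by
  have F := P.isIsotropicFrame H hU hz
  rw [hh z hz]
  simp [F.p'p', F.p'ξ', F.ξ'ξ', dotProduct_comm (star (isoVec g h z)) (star (dz g z))]

/-- `∂∂h` is `i g` plus a vector of a totally isotropic space orthogonal to `g`, so its square is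
`i²`. -/
theorem quartic_of_expansion {l : ℂ → ℂ} (hl : Smooth U l)
    (hh : ∀ z ∈ U, dz h z =
      (-I * (metricFactor g z)⁻¹) • star (dz g z) + l z • star (isoVec g h z)) (hz : z ∈ U) :
    dz (dz h) z ⬝ᵥ dz (dz h) z = -1 := by
  have F := P.isIsotropicFrame H hU hz
  obtain ⟨B, C, hBC⟩ := P.exists_dz_dz_eq H hU hl hh hz
  rw [hBC]
  simp [F.p'p', F.p'ξ', F.ξ'ξ', F.gg, F.gp', F.gξ', dotProduct_comm (star (isoVec g h z)) (star (dz g z)),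
    dotProduct_comm (star (isoVec g h z)) (g z), dotProduct_comm (star (dz g z)) (g z)]

theorem dzb_dz_g (hz : z ∈ U) : dzb (dz h) z ⬝ᵥ g z = 0 := by
  rw [dzb_dot_of_const hU (P.smooth.dz hU) H.smooth (fun w hw => P.h1_g H.toIsMinimal hU hw) hz,
    dzb_eq_star_dz hU H.smooth H.real hz, P.h1_g1' H.toIsMinimal hU hz, neg_zero]

theorem dzb_dz_g1 (hz : z ∈ U) : dzb (dz h) z ⬝ᵥ dz g z = 0 := by
  rw [dzb_dot_of_const hU (P.smooth.dz hU) (H.smooth.dz hU)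
    (fun w hw => P.h1_g1 H.toIsMinimal hU hw) hz,
    H.harmonic z hz, dotProduct_smul, P.h1_g H.toIsMinimal hU hz, smul_zero, neg_zero]

/-- The real vector `∂̄∂h` is shown to be orthogonal to every frame vector except `h`; if the frame
degenerates, `∂̄∂h` is instead computed from `∂h`, which is then a multiple of the conjugate of
`∂g`. -/
theorem harmonic_of_expansion (hσ : (∀ z ∈ U, defect g z ≠ 0) ∨ ∀ z ∈ U, defect g z = 0)
    (hz : z ∈ U) : dzb (dz h) z = -(metricFactor h z) • h z := by
  obtain ⟨l, hl, hh⟩ := P.exists_dz_eq H hU hσ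
  have F := P.isIsotropicFrame H hU hz
  have hE := H.metricFactor_ne hz
  have hr := star_dzb_dz hU P.smooth P.real hz
  have hg := P.dzb_dz_g H hU hz
  have hg1 := P.dzb_dz_g1 H hU hz
  have hg1' : dzb (dz h) z ⬝ᵥ star (dz g z) = 0 := by rw [dot_star_of_real hr, hg1, map_zero]
  have hhh := P.dzb_dz_h hU hz
  rcases hσ with hσ | hσ
  · have hξ : dz g z ⬝ᵥ dz (isoVec g h) z = 0 := by
      rw [dotProduct_comm, dz_dot_of_const hU (P.smooth_isoVec H hU) (H.smooth.dz hU) (c := 0)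
        (fun w hw => by rw [dotProduct_comm]; exact (P.isIsotropicFrame H hU hw).pξ) hz,
        dz_dz_eq_isoVec g h z, dotProduct_add, dotProduct_add, F.ξξ, dotProduct_smul, F.ξh,
        dotProduct_smul, dotProduct_comm (isoVec g h z), F.pξ]
      simp
    have hξξ : isoVec g h z ⬝ᵥ dz (isoVec g h) z = 0 := by
      have h1 := dz_dot_of_const hU (P.smooth_isoVec H hU) (P.smooth_isoVec H hU)
        (fun w hw => P.isoVec_isoVec H hU hw) hz
      rw [dotProduct_comm] at h1
      linear_combination h1 / 2
    have h1ξ : ∀ w ∈ U, dz h w ⬝ᵥ star (isoVec g h w) = 0 := fun w hw => by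
      rw [P.star_isoVec hw, dotProduct_add, P.h1_sff' H.toIsMinimal hU hw, dotProduct_smul,
        P.h1_h hU hw, smul_zero, add_zero]
    -- Moving `∂̄` to the other factor yields the conjugate of `∂ξ` against `∂h`, and `∂h` is a
    -- combination of the conjugates of `∂g` and `ξ`, both of whose unconjugated products with `∂ξ`
    -- vanish.
    have hξ' : dzb (dz h) z ⬝ᵥ star (isoVec g h z) = 0 := by
      rw [dzb_dot_of_const hU (P.smooth.dz hU) (P.smooth_isoVec H hU).star' h1ξ hz,
        dzb_star ((P.smooth_isoVec H hU).differentiableAt hU hz), hh z hz]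
      simp [dot_star_comm, hξ, hξξ]
    refine dot_ext (F.det_ne_zero hE (hσ z hz)) ?_ ?_ ?_ ?_ ?_ ?_
    · rw [dotProduct_comm, hg]; simp [F.gh]
    · rw [dotProduct_comm, hg1]; simp [F.ph]
    · rw [dotProduct_comm, hg1']; simp [F.p'h]
    · rw [dotProduct_comm, ← hr, ← star_star (isoVec g h z), dot_star_comm, hξ']; simp [F.ξh]
    · rw [dotProduct_comm, hξ']; simp [F.ξ'h]
    · rw [dotProduct_comm, hhh]; simp [F.hh]
  · have sc : Smooth U (fun z => -I * (metricFactor g z)⁻¹) :=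
      contDiffOn_const.mul ((H.smooth_metricFactor hU).inv fun _ hz => H.metricFactor_ne hz)
    have s1 := (H.smooth.dz hU).star'
    have hh' : ∀ z ∈ U, dz h z = (-I * (metricFactor g z)⁻¹) • star (dz g z) := fun w hw => by
      rw [hh w hw, P.isoVec_eq_zero H hU hw (hσ w hw)]; simp
    have h2 := dzb_smul (sc.differentiableAt hU hz) (s1.differentiableAt hU hz)
    rw [← dzb_congr hU hh' hz, dzb_star ((H.smooth.dz hU).differentiableAt hU hz),
      dz_dz_eq_isoVec g h z, P.isoVec_eq_zero H hU hz (hσ z hz)] at h2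
    simp only [zero_add, star_add, star_smul, P.real z hz] at h2
    obtain ⟨x, y, hxy⟩ : ∃ x y : ℂ, dzb (dz h) z = x • h z + y • star (dz g z) :=
      ⟨_, _, h2.trans (by rw [smul_add, smul_smul, smul_smul, add_assoc, ← add_smul])⟩
    rw [hxy] at hg1 hhh ⊢
    -- Pairing with `∂g` isolates the tangential coefficient.
    have hy : y = 0 := by
      simpa [P.hg1 z hz, dotProduct_comm (star (dz g z)), F.pp', hE] using hg1
    have hx : x = -metricFactor h z := by
      simpa [F.hh, F.p'h] using hhh
    rw [hx, hy, zero_smul, add_zero]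

/-- The transform of a minimal surface is a minimal surface with the same adapted coordinates. -/
theorem isAdapted : IsAdapted U h := by
  -- The expansion of `∂h` needs a defect that is nowhere zero or identically zero. Each identity to
  -- prove is between continuous functions, so it suffices to have it on open sets of these two
  -- kinds.
  have cσ := (H.smooth_defect hU).continuousOn
  have s1 := P.smooth.dz hU
  have s2 := s1.dz hU
  refine ⟨⟨P.smooth, P.real, P.unit, fun z hz => P.dz_ne_zero H hU hz, ?_, ?_⟩, ?_⟩
  · refine eqOn_of_dichotomy hU cσ (s1.dot s1).continuousOn continuousOn_const
      fun O hO hO' hσ z hz => ?_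
    obtain ⟨l, hl, hh⟩ := (P.mono hO).exists_dz_eq (H.mono hO) hO' hσ
    exact (P.mono hO).conformal_of_expansion (H.mono hO) hO' hh hz
  · refine eqOn_of_dichotomy hU cσ (s1.dzb hU).continuousOn
      (Smooth.smul' ((s1.dot s1.star').neg) P.smooth).continuousOn fun O hO hO' hσ z hz => ?_
    exact (P.mono hO).harmonic_of_expansion (H.mono hO) hO' hσ hz
  · refine eqOn_of_dichotomy hU cσ (s2.dot s2).continuousOn continuousOn_const
      fun O hO hO' hσ z hz => ?_
    obtain ⟨l, hl, hh⟩ := (P.mono hO).exists_dz_eq (H.mono hO) hO' hσ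
    exact (P.mono hO).quartic_of_expansion (H.mono hO) hO' hl hh hz

/-- The determinants of the frames of a surface and its transform have opposite signs. -/
theorem exists_det_eq (hσ : (∀ z ∈ U, defect g z ≠ 0) ∨ ∀ z ∈ U, defect g z = 0) (hz : z ∈ U) :
    ∃ r : ℝ, 0 ≤ r ∧
      (rows (h z) (dz h z) (star (dz h z)) (dz (dz h) z) (star (dz (dz h) z)) (g z)).det
        = -(r : ℂ) *
          (rows (g z) (dz g z) (star (dz g z)) (dz (dz g) z) (star (dz (dz g) z)) (h z)).det := by
  obtain ⟨l, hl, hh⟩ := P.exists_dz_eq H hU hσ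
  obtain ⟨B, C, hBC⟩ := P.exists_dz_dz_eq H hU hl hh hz
  set m := -I * (metricFactor g z)⁻¹
  -- The minor of the coefficients of `∂h` and `∂∂h` on the conjugates of `∂g` and `ξ`; the
  -- conjugated rows contribute its conjugate.
  refine ⟨normSq (m * C - l z * B), normSq_nonneg _, ?_⟩
  have h1 : star (dz h z) = conj m • dz g z + conj (l z) • isoVec g h z := by
    rw [hh z hz]; simp only [star_add, star_smul, star_star, starRingEnd_apply, m]
  have h2 : star (dz (dz h) z) = (-I) • g z + conj B • dz g z + conj C • isoVec g h z := by
    rw [hBC]; simp only [star_add, star_smul, star_star, starRingEnd_apply, H.real z hz]; simp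
  rw [P.det_rows hz, h1, h2, hh z hz, hBC, det_rows_transform, ← mul_conj]
  simp only [map_sub, map_mul, m]

/-- With `ξ = 0` on an open set, `∂h` is a multiple of the conjugate of `∂g` and `∂∂h` is `i g` plus
such a multiple. Hence the normal part is `i g`, of norm one. -/
theorem defect_eq_zero (hσ : ∀ z ∈ U, defect g z = 0) (hz : z ∈ U) : defect h z = 0 := by
  obtain ⟨l, hl, hh⟩ := P.exists_dz_eq H hU (Or.inr hσ)
  obtain ⟨B, C, hBC⟩ := P.exists_dz_dz_eq H hU hl hh hz
  have h0 := P.isoVec_eq_zero H hU hz (hσ z hz)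
  have hE := H.metricFactor_ne hz
  have hh' := hh z hz
  rw [h0, star_zero, smul_zero, add_zero] at hBC hh'
  have H' := (P.isAdapted H hU).toIsMinimal
  have e1 := H'.sff_g1' hz
  obtain ⟨y, hy⟩ : ∃ y : ℂ, sff h z = I • g z + y • star (dz g z) := by
    refine ⟨B - dz (dz h) z ⬝ᵥ star (dz h z) / metricFactor h z * (-I * (metricFactor g z)⁻¹), ?_⟩
    rw [sff, hBC]
    nth_rw 2 [hh']
    module
  have : dz g z ⬝ᵥ star (dz g z) = metricFactor g z := rfl
  rw [hy, hh', star_smul, star_star, add_dotProduct, dotProduct_smul, smul_dotProduct,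
    smul_dotProduct, H.g_g1 hU hz, dotProduct_smul, dotProduct_comm, this] at e1
  have hy0 : y = 0 := by
    simpa [hE, conj_metricFactor] using e1
  rw [defect, hy, hy0, zero_smul, add_zero, star_smul, H.real z hz, smul_dotProduct,
    dotProduct_smul, H.unit z hz]
  simp

end IsPair

/-! ### Complexification -/

/-- The inclusion of `ℝ⁶` in `ℂ⁶`. -/
def cv : E6 →L[ℝ] V6 :=
  ContinuousLinearMap.pi fun k => Complex.ofRealCLM.comp (EuclideanSpace.proj k)

@[simp] theorem cv_apply (x : E6) (k : Fin 6) : cv x k = (x k : ℂ) := rfl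

theorem complexify_eq (u : ℂ → E6) (z : ℂ) : complexify u z = cv (u z) := rfl

theorem star_cv (x : E6) : star (cv x) = cv x := by ext k; simp

theorem cv_smul (c : ℝ) (x : E6) : cv (c • x) = (c : ℂ) • cv x := by ext k; simp

theorem cv_dot (x y : E6) : cv x ⬝ᵥ cv y = ((⟪x, y⟫ : ℝ) : ℂ) := by
  simp [dotProduct, PiLp.inner_apply, mul_comm]

theorem cv_injective : Function.Injective cv := fun x y h => by
  ext k
  have := congrFun h k
  simpa using this

/-- The real part of a vector of `ℂ⁶`. -/
def rePart (v : V6) : E6 := WithLp.toLp 2 fun k => (v k).re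

/-- The imaginary part of a vector of `ℂ⁶`. -/
def imPart (v : V6) : E6 := WithLp.toLp 2 fun k => (v k).im

theorem eq_re_add_im (v : V6) : v = cv (rePart v) + I • cv (imPart v) := by
  ext k
  simp only [Pi.add_apply, Pi.smul_apply, cv_apply, smul_eq_mul, rePart, imPart, mul_comm I]
  exact (re_add_im _).symm

theorem re_im_unique {x y x' y' : E6} (h : cv x + I • cv y = cv x' + I • cv y') :
    x = x' ∧ y = y' := by
  constructor <;> ext k <;> have := congrFun h k
  · simpa using congrArg Complex.re this
  · simpa using congrArg Complex.im this

theorem smooth_complexify_iff {U : Set ℂ} {u : ℂ → E6} :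
    Smooth U (complexify u) ↔ ContDiffOn ℝ ∞ u U := by
  constructor
  · intro h
    rw [contDiffOn_euclidean]
    intro k
    exact Complex.reCLM.contDiff.comp_contDiffOn (contDiffOn_pi.1 h k)
  · intro h
    exact cv.contDiff.comp_contDiffOn h

theorem fderiv_complexify {u : ℂ → E6} {z : ℂ} (hu : DifferentiableAt ℝ u z) (X : ℂ) :
    fderiv ℝ (complexify u) z X = cv (D u X z) := by
  have h : HasFDerivAt (complexify u) (cv.comp (fderiv ℝ u z)) z :=
    cv.hasFDerivAt.comp z hu.hasFDerivAt
  rw [h.fderiv]; rfl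

theorem dz_complexify {u : ℂ → E6} {z : ℂ} (hu : DifferentiableAt ℝ u z) :
    dz (complexify u) z = (1 / 2 : ℂ) • (cv (D u 1 z) - I • cv (D u I z)) := by
  rw [dz, fderiv_complexify hu, fderiv_complexify hu]

theorem dzb_complexify {u : ℂ → E6} {z : ℂ} (hu : DifferentiableAt ℝ u z) :
    dzb (complexify u) z = (1 / 2 : ℂ) • (cv (D u 1 z) + I • cv (D u I z)) := by
  rw [dzb, fderiv_complexify hu, fderiv_complexify hu]

theorem cv_D_one {u : ℂ → E6} {z : ℂ} (hu : DifferentiableAt ℝ u z) :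
    cv (D u 1 z) = dz (complexify u) z + star (dz (complexify u) z) := by
  rw [dz_complexify hu]
  simp only [star_smul, star_sub, star_cv]
  ext k; simp; ring

theorem cv_D_I {u : ℂ → E6} {z : ℂ} (hu : DifferentiableAt ℝ u z) :
    cv (D u I z) = I • (dz (complexify u) z - star (dz (complexify u) z)) := by
  rw [dz_complexify hu]
  simp only [star_smul, star_sub, star_cv]
  ext k; simp; ring_nf; simp

section

variable {U : Set ℂ} {u : ℂ → E6} (hU : IsOpen U) (hu : ContDiffOn ℝ ∞ u U) {z : ℂ}

include hU hu

theorem differentiableAt_of_contDiffOn (hz : z ∈ U) : DifferentiableAt ℝ u z :=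
  (hu.contDiffAt (hU.mem_nhds hz)).differentiableAt (by simp)

theorem contDiffOn_D (X : ℂ) : ContDiffOn ℝ ∞ (D u X) U := smooth_fderiv_apply hU hu X

theorem D_comm (hz : z ∈ U) (X Y : ℂ) : D (D u X) Y z = D (D u Y) X z := by
  have hd : DifferentiableAt ℝ (fderiv ℝ u) z :=
    ((hu.fderiv_of_isOpen hU (m := ∞) (by simp)).contDiffAt (hU.mem_nhds hz)).differentiableAt
      (by simp)
  have hap : ∀ X Y : ℂ, D (D u X) Y z = fderiv ℝ (fderiv ℝ u) z Y X := by
    intro X Y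
    change fderiv ℝ (fun z => fderiv ℝ u z X) z Y = _
    rw [fderiv_clm_apply hd (differentiableAt_const X)]
    simp
  rw [hap, hap]
  exact (hu.contDiffAt (hU.mem_nhds hz)).isSymmSndFDerivAt (n := ∞) (by
    simp only [minSmoothness_of_isRCLikeNormedField]
    exact WithTop.coe_le_coe.2 (le_top : (2 : ℕ∞) ≤ ⊤)) Y X

theorem dz_complexify_eqOn : EqOn (dz (complexify u))
    (fun z => (1 / 2 : ℂ) • (complexify (D u 1) z - I • complexify (D u I) z)) U :=
  fun _ hw => dz_complexify (differentiableAt_of_contDiffOn hU hu hw)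

theorem dz_dz_complexify (hz : z ∈ U) : dz (dz (complexify u)) z =
    cv ((1 / 4 : ℝ) • (D (D u 1) 1 z - D (D u I) I z))
      - I • cv ((1 / 4 : ℝ) • (D (D u I) 1 z + D (D u 1) I z)) := by
  have s1 := smooth_complexify_iff.2 (contDiffOn_D hU hu 1)
  have s2 := smooth_complexify_iff.2 (contDiffOn_D hU hu I)
  have d1 := s1.differentiableAt hU hz
  have d2 := s2.differentiableAt hU hz
  have d2' := (s2.const_smul' I).differentiableAt hU hz
  rw [dz_congr hU (dz_complexify_eqOn hU hu) hz, dz_const_smul (d1.fun_sub d2'), dz_sub d1 d2',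
    dz_const_smul d2,
    dz_complexify (differentiableAt_of_contDiffOn hU (contDiffOn_D hU hu 1) hz),
    dz_complexify (differentiableAt_of_contDiffOn hU (contDiffOn_D hU hu I) hz)]
  ext k; simp; ring_nf; simp; ring

theorem dzb_dz_complexify (hz : z ∈ U) : dzb (dz (complexify u)) z =
    cv ((1 / 4 : ℝ) • (D (D u 1) 1 z + D (D u I) I z)) := by
  have s1 := smooth_complexify_iff.2 (contDiffOn_D hU hu 1)
  have s2 := smooth_complexify_iff.2 (contDiffOn_D hU hu I)
  have d1 := s1.differentiableAt hU hz
  have d2 := s2.differentiableAt hU hz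
  have d2' := (s2.const_smul' I).differentiableAt hU hz
  rw [dzb_congr hU (dz_complexify_eqOn hU hu) hz, dzb_const_smul (d1.fun_sub d2'), dzb_sub d1 d2',
    dzb_const_smul d2,
    dzb_complexify (differentiableAt_of_contDiffOn hU (contDiffOn_D hU hu 1) hz),
    dzb_complexify (differentiableAt_of_contDiffOn hU (contDiffOn_D hU hu I) hz),
    D_comm hU hu hz I 1]
  ext k; simp; ring_nf; simp; ring

end

/-! ### The second fundamental form -/

section SecondFundamentalForm

variable {U : Set ℂ} {u : ℂ → E6} (H : IsMinimal U (complexify u)) (hU : IsOpen U) {z : ℂ}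

include H

theorem IsMinimal.contDiffOn : ContDiffOn ℝ ∞ u U := smooth_complexify_iff.1 H.smooth

include hU

theorem IsMinimal.differentiableAt (hz : z ∈ U) : DifferentiableAt ℝ u z :=
  differentiableAt_of_contDiffOn hU H.contDiffOn hz

theorem IsMinimal.norm_D_one_sq (hz : z ∈ U) :
    ((‖D u 1 z‖ ^ 2 : ℝ) : ℂ) = 2 * metricFactor (complexify u) z := by
  rw [← real_inner_self_eq_norm_sq, ← cv_dot, cv_D_one (H.differentiableAt hU hz)]
  have := H.conformal z hz
  simp only [add_dotProduct, dotProduct_add, this, dot_star_comm, map_zero,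
    dotProduct_comm (star (dz (complexify u) z)) (dz (complexify u) z)]
  simp only [metricFactor]; ring

theorem IsMinimal.norm_D_I_sq (hz : z ∈ U) :
    ((‖D u I z‖ ^ 2 : ℝ) : ℂ) = 2 * metricFactor (complexify u) z := by
  rw [← real_inner_self_eq_norm_sq, ← cv_dot, cv_D_I (H.differentiableAt hU hz)]
  have := H.conformal z hz
  simp only [sub_dotProduct, dotProduct_sub, this, dot_star_comm, map_zero, smul_dotProduct,
    dotProduct_smul, dotProduct_comm (star (dz (complexify u) z)) (dz (complexify u) z), smul_eq_mul]
  simp only [metricFactor]; ring_nf; simp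

theorem IsMinimal.norm_D_I (hz : z ∈ U) : ‖D u I z‖ = ‖D u 1 z‖ := by
  have : ‖D u I z‖ ^ 2 = ‖D u 1 z‖ ^ 2 := by
    exact_mod_cast (H.norm_D_I_sq hU hz).trans (H.norm_D_one_sq hU hz).symm
  exact (sq_eq_sq₀ (norm_nonneg _) (norm_nonneg _)).1 this

theorem IsMinimal.D_one_ne_zero (hz : z ∈ U) : D u 1 z ≠ 0 := by
  intro h0
  have := H.norm_D_one_sq hU hz
  rw [h0, norm_zero] at this
  have hE := H.metricFactor_ne hz
  simp [hE] at this

theorem IsMinimal.inner_D (hz : z ∈ U) : ⟪D u 1 z, D u I z⟫ = 0 := by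
  have : ((⟪D u 1 z, D u I z⟫ : ℝ) : ℂ) = 0 := by
    rw [← cv_dot, cv_D_one (H.differentiableAt hU hz), cv_D_I (H.differentiableAt hU hz)]
    have := H.conformal z hz
    simp only [add_dotProduct, dotProduct_sub, this, dot_star_comm, map_zero,
      dotProduct_smul, dotProduct_comm (star (dz (complexify u) z)) (dz (complexify u) z),
      smul_eq_mul]
    ring
  exact_mod_cast this

omit hU in
theorem IsMinimal.norm_eq (hz : z ∈ U) : ‖u z‖ = 1 := by
  have h := H.unit z hz
  rw [complexify_eq, cv_dot, real_inner_self_eq_norm_sq] at h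
  have h' : ‖u z‖ ^ 2 = 1 := by exact_mod_cast h
  exact (pow_eq_one_iff_of_nonneg (norm_nonneg _) two_ne_zero).1 h'

theorem IsMinimal.inner_u_D_one (hz : z ∈ U) : ⟪u z, D u 1 z⟫ = 0 := by
  have : ((⟪u z, D u 1 z⟫ : ℝ) : ℂ) = 0 := by
    rw [← cv_dot, cv_D_one (H.differentiableAt hU hz), dotProduct_add]
    have h1 := H.g_g1 hU hz
    have h2 := H.g_g1' hU hz
    rw [complexify_eq] at h1 h2
    rw [h1, h2, add_zero]
  exact_mod_cast this

theorem IsMinimal.inner_u_D_I (hz : z ∈ U) : ⟪u z, D u I z⟫ = 0 := by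
  have : ((⟪u z, D u I z⟫ : ℝ) : ℂ) = 0 := by
    rw [← cv_dot, cv_D_I (H.differentiableAt hU hz), dotProduct_smul, dotProduct_sub]
    have h1 := H.g_g1 hU hz
    have h2 := H.g_g1' hU hz
    rw [complexify_eq] at h1 h2
    rw [h1, h2, sub_zero, smul_zero]
  exact_mod_cast this

omit H hU in
theorem mem_normalSpace_iff {x : E6} : x ∈ normalSpace u z ↔
    ⟪u z, x⟫ = 0 ∧ ⟪D u 1 z, x⟫ = 0 ∧ ⟪D u I z, x⟫ = 0 := by
  rw [normalSpace, Submodule.mem_orthogonal]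
  constructor
  · intro h
    exact ⟨h _ (Submodule.subset_span (by simp)), h _ (Submodule.subset_span (by simp)),
      h _ (Submodule.subset_span (by simp))⟩
  · rintro ⟨h1, h2, h3⟩ y hy
    induction hy using Submodule.span_induction with
    | mem y hy => rcases hy with rfl | rfl | rfl <;> assumption
    | zero => simp
    | add y y' _ _ h h' => rw [inner_add_left, h, h', add_zero]
    | smul c y _ h => rw [inner_smul_left, h, mul_zero]

omit H hU in
theorem aVec_eq_proj : aVec u z = (normalSpace u z).starProjection
    ((1 / 4 : ℝ) • (D (D u 1) 1 z - D (D u I) I z)) := by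
  simp only [aVec, II, map_smul, map_sub]

omit H hU in
theorem bVec_eq_proj : bVec u z = (normalSpace u z).starProjection
    ((1 / 4 : ℝ) • (D (D u I) 1 z + D (D u 1) I z)) := by
  simp only [bVec, II, map_smul, map_add]

/-- `g₂` is orthogonal to `g`, `∂g` and its conjugate, hence to the real vectors spanning the
position and tangent directions; products with real vectors may be split into real and imaginary
parts. -/
theorem IsMinimal.starProjection_eq (hz : z ∈ U) {x y : E6} (h : cv x - I • cv y
    = sff (complexify u) z) :
    x ∈ normalSpace u z ∧ y ∈ normalSpace u z := by
  have h0 := H.sff_g hU hz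
  have h1 := H.sff_g1 hU hz
  have h2 := H.sff_g1' hz
  have key : ∀ w : E6, sff (complexify u) z ⬝ᵥ cv w = 0 → ⟪w, x⟫ = 0 ∧ ⟪w, y⟫ = 0 := by
    intro w hw
    rw [← h, sub_dotProduct, smul_dotProduct, cv_dot, cv_dot] at hw
    have e1 := congrArg Complex.re hw
    have e2 := congrArg Complex.im hw
    simp at e1 e2
    exact ⟨(real_inner_comm _ _).trans e1, (real_inner_comm _ _).trans e2⟩
  have k0 := key (u z) h0
  have k1 := key (D u 1 z) (by
    rw [cv_D_one (H.differentiableAt hU hz), dotProduct_add, h1, h2, add_zero])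
  have k2 := key (D u I z) (by
    rw [cv_D_I (H.differentiableAt hU hz), dotProduct_smul, dotProduct_sub, h1, h2, sub_zero,
      smul_zero])
  exact ⟨mem_normalSpace_iff.2 ⟨k0.1, k1.1, k2.1⟩, mem_normalSpace_iff.2 ⟨k0.2, k1.2, k2.2⟩⟩

/-- The vector `a - i b` of the surface is the normal component of `∂∂u`. -/
theorem IsMinimal.aVec_bVec (hz : z ∈ U) :
    cv (aVec u z) - I • cv (bVec u z) = sff (complexify u) z := by
  set s := sff (complexify u) z with hs
  set α := (1 / 4 : ℝ) • (D (D u 1) 1 z - D (D u I) I z)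
  set β := (1 / 4 : ℝ) • (D (D u I) 1 z + D (D u 1) I z)
  have hs' : s = cv (rePart s) - I • cv (-imPart s) := by
    conv_lhs => rw [eq_re_add_im s]
    rw [map_neg, smul_neg, sub_neg_eq_add]
  have hN := H.starProjection_eq hU hz hs'.symm
  obtain ⟨p, q, hp⟩ : ∃ p q : ℝ, dz (dz (complexify u)) z
      = sff (complexify u) z + (p + q * I : ℂ) • dz (complexify u) z :=
    ⟨_, _, by rw [re_add_im]; exact dz_dz_eq (complexify u) z⟩
  rw [← hs, dz_dz_complexify hU H.contDiffOn hz, dz_complexify (H.differentiableAt hU hz)] at hp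
  -- The difference between `∂∂u` and its normal part is `(p + qi) ∂u`, whose real and imaginary
  -- parts are combinations of `u_x` and `u_y`. The projection to the normal space therefore removes
  -- both.
  have hsplit : cv (α - rePart s) + I • cv (-(β + imPart s)) =
      cv ((p / 2) • D u 1 z + (q / 2) • D u I z)
        + I • cv ((q / 2) • D u 1 z - (p / 2) • D u I z) := by
    have e1 : cv (α - rePart s) + I • cv (-(β + imPart s)) = cv α - I • cv β - s := by
      conv_rhs => rw [eq_re_add_im s]
      simp only [map_sub, map_add, map_neg]; module
    have e2 : cv α - I • cv β - s = (p + q * I : ℂ) • (1 / 2 : ℂ) • (cv (D u 1 z) - I • cv (D u I z)) := by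
      rw [sub_eq_iff_eq_add, add_comm]; exact hp
    rw [e1, e2]
    ext k
    simp
    ring_nf
    simp
    ring
  obtain ⟨r1, r2⟩ := re_im_unique hsplit
  have mem1 : D u 1 z ∈ Submodule.span ℝ {u z, D u 1 z, D u I z} :=
    Submodule.subset_span (by simp)
  have memI : D u I z ∈ Submodule.span ℝ {u z, D u 1 z, D u I z} :=
    Submodule.subset_span (by simp)
  have pa : aVec u z = rePart s := by
    rw [aVec_eq_proj]
    refine Submodule.eq_starProjection_of_mem_orthogonal hN.1 ?_
    change α - _ ∈ _
    rw [r1]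
    exact Submodule.le_orthogonal_orthogonal _
      (Submodule.add_mem _ (Submodule.smul_mem _ _ mem1) (Submodule.smul_mem _ _ memI))
  have pb : bVec u z = -imPart s := by
    rw [bVec_eq_proj]
    refine Submodule.eq_starProjection_of_mem_orthogonal hN.2 ?_
    change β - _ ∈ _
    rw [sub_neg_eq_add, ← neg_neg (β + imPart s), r2]
    exact Submodule.neg_mem _ (Submodule.le_orthogonal_orthogonal _
      (Submodule.sub_mem _ (Submodule.smul_mem _ _ mem1) (Submodule.smul_mem _ _ memI)))
  rw [pa, pb, ← hs']

/-- Harmonicity makes the Laplacian a multiple of `u`, whose normal projection is zero; thus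
`II(∂_y, ∂_y) = -II(∂_x, ∂_x)`. -/
theorem IsMinimal.II_one_one (hz : z ∈ U) : II u z 1 1 = (2 : ℝ) • aVec u z := by
  have h : II u z 1 1 + II u z I I = 0 := by
    have h1 := H.harmonic z hz
    rw [dzb_dz_complexify hU H.contDiffOn hz] at h1
    have hE : metricFactor (complexify u) z = ((‖D u 1 z‖ ^ 2 / 2 : ℝ) : ℂ) := by
      have := H.norm_D_one_sq hU hz
      push_cast at this ⊢
      rw [this]; ring
    rw [hE, ← ofReal_neg, complexify_eq, ← cv_smul] at h1
    have h2 : D (D u 1) 1 z + D (D u I) I z = (4 * -(‖D u 1 z‖ ^ 2 / 2)) • u z := by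
      rw [mul_smul, ← cv_injective h1, smul_smul]; norm_num
    rw [II, II, ← map_add, h2, map_smul]
    have : u z ∈ (normalSpace u z)ᗮ :=
      Submodule.le_orthogonal_orthogonal _ (Submodule.subset_span (by simp))
    rw [(Submodule.starProjection_apply_eq_zero_iff _).2 this, smul_zero]
  rw [aVec, eq_neg_of_add_eq_zero_right h, smul_smul, sub_neg_eq_add, ← two_smul ℝ, smul_smul]
  norm_num

theorem IsMinimal.II_one_I (hz : z ∈ U) : II u z 1 I = (2 : ℝ) • bVec u z := by
  have h : II u z I 1 = II u z 1 I := by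
    rw [II, II, D_comm hU H.contDiffOn hz]
  rw [bVec, h, smul_smul, ← two_smul ℝ, smul_smul]
  norm_num

theorem IsMinimal.f₂_eq (hz : z ∈ U) : f₂ u z = sff (complexify u) z := by
  rw [← H.aVec_bVec hU hz]; rfl

end SecondFundamentalForm

/-! ### The cross product -/

/-- The determinant is linear in its last row, which is expanded in the standard basis. -/
theorem inner_cross₅ (v₀ v₁ v₂ v₃ v₄ w : E6) :
    ⟪cross₅ v₀ v₁ v₂ v₃ v₄, w⟫ = (Matrix.of ![(v₀ : Fin 6 → ℝ), v₁, v₂, v₃, v₄, w]).det := by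
  have hup : ∀ x : Fin 6 → ℝ, Matrix.of ![(v₀ : Fin 6 → ℝ), v₁, v₂, v₃, v₄, x]
      = (Matrix.of ![(v₀ : Fin 6 → ℝ), v₁, v₂, v₃, v₄, 0]).updateRow 5 x := by
    intro x; ext i j; fin_cases i <;> simp [Matrix.updateRow_apply]
  set M := Matrix.of ![(v₀ : Fin 6 → ℝ), v₁, v₂, v₃, v₄, 0]
  let L : (Fin 6 → ℝ) →ₗ[ℝ] ℝ :=
    { toFun := fun x => (M.updateRow 5 x).det
      map_add' := fun x y => Matrix.det_updateRow_add M 5 x y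
      map_smul' := fun c x => Matrix.det_updateRow_smul M 5 c x }
  have hlin : ∀ x : Fin 6 → ℝ, (Matrix.of ![(v₀ : Fin 6 → ℝ), v₁, v₂, v₃, v₄, x]).det = L x :=
    fun x => by rw [hup x]; rfl
  have hw : (w : Fin 6 → ℝ) = ∑ k, w k • (Pi.single k 1 : Fin 6 → ℝ) := by
    ext j; simp [Pi.single_apply]
  rw [hlin]
  conv_rhs => rw [hw]
  rw [map_sum, PiLp.inner_apply]
  refine Finset.sum_congr rfl fun k _ => ?_
  rw [map_smul, ← hlin]
  simp [cross₅]

theorem ofReal_inner_cross₅ (v₀ v₁ v₂ v₃ v₄ w : E6) :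
    ((⟪cross₅ v₀ v₁ v₂ v₃ v₄, w⟫ : ℝ) : ℂ)
      = (rows (cv v₀) (cv v₁) (cv v₂) (cv v₃) (cv v₄) (cv w)).det := by
  rw [inner_cross₅]
  change Complex.ofRealHom _ = _
  rw [RingHom.map_det]
  congr 1
  ext i j
  fin_cases i <;> simp [rows]

theorem cross₅_orthogonal (v₀ v₁ v₂ v₃ v₄ : E6) :
    ⟪cross₅ v₀ v₁ v₂ v₃ v₄, v₀⟫ = 0 ∧ ⟪cross₅ v₀ v₁ v₂ v₃ v₄, v₁⟫ = 0 ∧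
    ⟪cross₅ v₀ v₁ v₂ v₃ v₄, v₂⟫ = 0 ∧ ⟪cross₅ v₀ v₁ v₂ v₃ v₄, v₃⟫ = 0 ∧
    ⟪cross₅ v₀ v₁ v₂ v₃ v₄, v₄⟫ = 0 := by
  simp only [inner_cross₅]
  refine ⟨?_, ?_, ?_, ?_, ?_⟩
  · exact Matrix.det_zero_of_row_eq (i := 0) (j := 5) (by decide) rfl
  · exact Matrix.det_zero_of_row_eq (i := 1) (j := 5) (by decide) rfl
  · exact Matrix.det_zero_of_row_eq (i := 2) (j := 5) (by decide) rfl
  · exact Matrix.det_zero_of_row_eq (i := 3) (j := 5) (by decide) rfl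
  · exact Matrix.det_zero_of_row_eq (i := 4) (j := 5) (by decide) rfl

theorem exists_unit_orthogonal (v : Fin 5 → E6) : ∃ w : E6, ‖w‖ = 1 ∧ ∀ i, ⟪v i, w⟫ = 0 := by
  have hne : (Submodule.span ℝ (Set.range v))ᗮ ≠ ⊥ := by
    intro h
    rw [Submodule.orthogonal_eq_bot_iff] at h
    have h1 := finrank_range_le_card (R := ℝ) v
    rw [Set.finrank, h, finrank_top] at h1
    simp at h1
  obtain ⟨x, hx, hx0⟩ := Submodule.exists_mem_ne_zero_of_ne_bot hne
  refine ⟨‖x‖⁻¹ • x, by rw [norm_smul, norm_inv, norm_norm, inv_mul_cancel₀ (norm_ne_zero_iff.2 hx0)],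
    fun i => ?_⟩
  rw [inner_smul_right, (Submodule.mem_orthogonal _ _).1 hx _ (Submodule.subset_span ⟨i, rfl⟩),
    mul_zero]

/-- For a unit vector `w` orthogonal to the five, the square of the determinant is the Gram
determinant, which is diagonal here. -/
theorem norm_cross₅_sq {v₀ v₁ v₂ v₃ v₄ : E6} (h01 : ⟪v₀, v₁⟫ = 0) (h02 : ⟪v₀, v₂⟫ = 0)
    (h03 : ⟪v₀, v₃⟫ = 0) (h04 : ⟪v₀, v₄⟫ = 0) (h12 : ⟪v₁, v₂⟫ = 0) (h13 : ⟪v₁, v₃⟫ = 0)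
    (h14 : ⟪v₁, v₄⟫ = 0) (h23 : ⟪v₂, v₃⟫ = 0) (h24 : ⟪v₂, v₄⟫ = 0) (h34 : ⟪v₃, v₄⟫ = 0) :
    ‖cross₅ v₀ v₁ v₂ v₃ v₄‖ ^ 2 =
      ‖v₀‖ ^ 2 * ‖v₁‖ ^ 2 * ‖v₂‖ ^ 2 * ‖v₃‖ ^ 2 * ‖v₄‖ ^ 2 := by
  set c := cross₅ v₀ v₁ v₂ v₃ v₄ with hc
  have key : ∀ w : E6, ‖w‖ = 1 → ⟪v₀, w⟫ = 0 → ⟪v₁, w⟫ = 0 → ⟪v₂, w⟫ = 0 → ⟪v₃, w⟫ = 0 →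
      ⟪v₄, w⟫ = 0 → ⟪c, w⟫ ^ 2 = ‖v₀‖ ^ 2 * ‖v₁‖ ^ 2 * ‖v₂‖ ^ 2 * ‖v₃‖ ^ 2 * ‖v₄‖ ^ 2 := by
    intro w hw h05 h15 h25 h35 h45
    rw [hc, inner_cross₅]
    set M := Matrix.of ![(v₀ : Fin 6 → ℝ), v₁, v₂, v₃, v₄, w]
    have hG : M * Mᵀ = Matrix.diagonal
        ![‖v₀‖ ^ 2, ‖v₁‖ ^ 2, ‖v₂‖ ^ 2, ‖v₃‖ ^ 2, ‖v₄‖ ^ 2, 1] := by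
      have hin : ∀ x y : E6, (x : Fin 6 → ℝ) ⬝ᵥ (y : Fin 6 → ℝ) = ⟪x, y⟫ := fun x y => by
        simp [dotProduct, PiLp.inner_apply, mul_comm]
      ext i j
      change ![(v₀ : Fin 6 → ℝ), v₁, v₂, v₃, v₄, w] i ⬝ᵥ
        ![(v₀ : Fin 6 → ℝ), v₁, v₂, v₃, v₄, w] j = _
      fin_cases i <;> fin_cases j <;>
      simp [hin, h01, h02, h03, h04, h12, h13, h14, h23, h24, h34, h05, h15, h25, h35, h45,
        real_inner_comm v₀, real_inner_comm v₁, real_inner_comm v₂, real_inner_comm v₃,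
        real_inner_comm v₄, hw]
    have := congrArg Matrix.det hG
    rw [Matrix.det_mul, Matrix.det_transpose, Matrix.det_diagonal, Fin.prod_univ_six] at this
    simpa [sq] using this
  -- If `c = 0`, any unit normal of the five vectors shows that the product of norms is zero;
  -- otherwise take `w = c / |c|`.
  by_cases h0 : c = 0
  · obtain ⟨w, hw, hw'⟩ := exists_unit_orthogonal ![v₀, v₁, v₂, v₃, v₄]
    have := key w hw (hw' 0) (hw' 1) (hw' 2) (hw' 3) (hw' 4)
    rw [← this, h0]; simp
  · obtain ⟨o0, o1, o2, o3, o4⟩ := cross₅_orthogonal v₀ v₁ v₂ v₃ v₄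
    have hn : ‖c‖ ≠ 0 := norm_ne_zero_iff.2 h0
    have := key (‖c‖⁻¹ • c) (by rw [norm_smul, norm_inv, norm_norm, inv_mul_cancel₀ hn])
      (by rw [inner_smul_right, real_inner_comm, o0, mul_zero])
      (by rw [inner_smul_right, real_inner_comm, o1, mul_zero])
      (by rw [inner_smul_right, real_inner_comm, o2, mul_zero])
      (by rw [inner_smul_right, real_inner_comm, o3, mul_zero])
      (by rw [inner_smul_right, real_inner_comm, o4, mul_zero])
    rw [← this, inner_smul_right, real_inner_self_eq_norm_sq, sq ‖c‖, inv_mul_cancel_left₀ hn, sq]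

/-! ### The transform of an adapted surface -/

/-- The vector completing the frame of the surface to a positively oriented basis. -/
def crossVec (u : ℂ → E6) (z : ℂ) : E6 :=
  cross₅ (u z) (D u 1 z) (D u I z) (II u z 1 1) (II u z 1 I)

/-- The properties characterizing the `(ε)`-transform at a point. -/
structure IsTransformAt (ε : ℝ) (u : ℂ → E6) (z : ℂ) (k : E6) : Prop where
  norm : ‖k‖ = 1
  inner_u : ⟪k, u z⟫ = 0
  inner_x : ⟪k, D u 1 z⟫ = 0
  inner_y : ⟪k, D u I z⟫ = 0
  inner_a : ⟪k, aVec u z⟫ = 0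
  inner_b : ⟪k, bVec u z⟫ = -1
  sign : 0 ≤ ε * ⟪crossVec u z, k⟫

section

variable {U : Set ℂ} {u : ℂ → E6} (H : IsAdapted U (complexify u)) (hU : IsOpen U) {z : ℂ}

include H hU

/-- Real and imaginary parts of `(a - ib, a - ib) = -1`. -/
theorem IsAdapted.inner_aVec_bVec (hz : z ∈ U) :
    ⟪aVec u z, bVec u z⟫ = 0 ∧ ‖bVec u z‖ ^ 2 = 1 + ‖aVec u z‖ ^ 2 := by
  have h := H.sff_sff hU hz
  rw [H.quartic z hz, ← H.aVec_bVec hU hz] at h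
  simp only [sub_dotProduct, dotProduct_sub, smul_dotProduct, dotProduct_smul, cv_dot,
    smul_eq_mul, real_inner_self_eq_norm_sq, real_inner_comm (aVec u z)] at h
  have h1 := congrArg Complex.re h
  have h2 := congrArg Complex.im h
  simp [-ofReal_pow] at h1 h2
  constructor <;> linarith

theorem IsAdapted.defect_eq (hz : z ∈ U) :
    defect (complexify u) z = ((2 * ‖aVec u z‖ ^ 2 : ℝ) : ℂ) := by
  have h := (H.inner_aVec_bVec hU hz).2
  have h' : ((‖bVec u z‖ : ℂ)) ^ 2 = 1 + (‖aVec u z‖ : ℂ) ^ 2 := by exact_mod_cast h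
  rw [defect, ← H.aVec_bVec hU hz]
  simp only [star_sub, star_smul, star_cv, sub_dotProduct, dotProduct_sub, smul_dotProduct,
    dotProduct_smul, cv_dot, smul_eq_mul, real_inner_self_eq_norm_sq, real_inner_comm (aVec u z)]
  simp
  linear_combination h' - (‖bVec u z‖ : ℂ) ^ 2 * I_mul_I

theorem IsAdapted.inner_normal (hz : z ∈ U) :
    (⟪u z, aVec u z⟫ = 0 ∧ ⟪D u 1 z, aVec u z⟫ = 0 ∧ ⟪D u I z, aVec u z⟫ = 0) ∧
    (⟪u z, bVec u z⟫ = 0 ∧ ⟪D u 1 z, bVec u z⟫ = 0 ∧ ⟪D u I z, bVec u z⟫ = 0) :=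
  ⟨mem_normalSpace_iff.1 (H.starProjection_eq hU hz (H.aVec_bVec hU hz)).1,
    mem_normalSpace_iff.1 (H.starProjection_eq hU hz (H.aVec_bVec hU hz)).2⟩

/-- The five vectors are `u`, `u_x`, `u_y`, `2a`, `2b`, pairwise orthogonal, with `|u_y| = |u_x|` by
conformality. -/
theorem IsAdapted.norm_crossVec_sq (hz : z ∈ U) :
    ‖crossVec u z‖ ^ 2 = (4 * ‖D u 1 z‖ ^ 2 * ‖aVec u z‖ * ‖bVec u z‖) ^ 2 := by
  obtain ⟨⟨a0, a1, a2⟩, b0, b1, b2⟩ := H.inner_normal hU hz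
  rw [crossVec, H.II_one_one hU hz, H.II_one_I hU hz, norm_cross₅_sq
    (H.inner_u_D_one hU hz) (H.inner_u_D_I hU hz) (by rw [inner_smul_right, a0, mul_zero])
    (by rw [inner_smul_right, b0, mul_zero]) (H.inner_D hU hz)
    (by rw [inner_smul_right, a1, mul_zero]) (by rw [inner_smul_right, b1, mul_zero])
    (by rw [inner_smul_right, a2, mul_zero]) (by rw [inner_smul_right, b2, mul_zero])
    (by rw [inner_smul_right, inner_smul_left, (H.inner_aVec_bVec hU hz).1, mul_zero, mul_zero]),
    H.norm_eq hz, H.norm_D_I hU hz, norm_smul, norm_smul]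
  simp
  ring

theorem IsAdapted.crossVec_orthogonal (hz : z ∈ U) :
    ⟪crossVec u z, u z⟫ = 0 ∧ ⟪crossVec u z, D u 1 z⟫ = 0 ∧ ⟪crossVec u z, D u I z⟫ = 0 ∧
    ⟪crossVec u z, aVec u z⟫ = 0 ∧ ⟪crossVec u z, bVec u z⟫ = 0 := by
  obtain ⟨o0, o1, o2, o3, o4⟩ := cross₅_orthogonal (u z) (D u 1 z) (D u I z) (II u z 1 1)
    (II u z 1 I)
  refine ⟨o0, o1, o2, ?_, ?_⟩
  · rw [H.II_one_one hU hz, inner_smul_right] at o3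
    rw [crossVec, H.II_one_one hU hz]
    simpa using o3
  · rw [H.II_one_I hU hz, inner_smul_right] at o4
    rw [crossVec, H.II_one_I hU hz]
    simpa using o4

theorem IsAdapted.norm_bVec_pos (hz : z ∈ U) : 0 < ‖bVec u z‖ := by
  have h := (H.inner_aVec_bVec hU hz).2
  have : ‖bVec u z‖ ≠ 0 := fun h0 => by rw [h0] at h; nlinarith [sq_nonneg ‖aVec u z‖]
  exact lt_of_le_of_ne (norm_nonneg _) this.symm

/-- The transform in terms of the unnormalized vectors. -/
theorem IsAdapted.localTransform_eq (hz : z ∈ U) (ε : ℝ) : localTransform ε u z =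
    -((‖bVec u z‖ ^ 2)⁻¹ • bVec u z)
      + (ε * (4 * ‖D u 1 z‖ ^ 2 * ‖bVec u z‖ ^ 2)⁻¹) • crossVec u z := by
  have hb := (H.norm_bVec_pos hU hz).ne'
  have hcosh : Real.cosh (phi u z) = ‖bVec u z‖ := by
    rw [phi, Real.cosh_arsinh, ← (H.inner_aVec_bVec hU hz).2, Real.sqrt_sq (norm_nonneg _)]
  have hsinh : Real.sinh (phi u z) = ‖aVec u z‖ := Real.sinh_arsinh _
  -- The factor `|a|` here cancels the one in `tanh φ = |a| / |b|`, so the resulting formula remains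
  -- regular where `a = 0`.
  have hc : ‖crossVec u z‖ = 4 * ‖D u 1 z‖ ^ 2 * ‖aVec u z‖ * ‖bVec u z‖ :=
    (sq_eq_sq₀ (norm_nonneg _) (by positivity)).1 (H.norm_crossVec_sq hU hz)
  have hD := norm_ne_zero_iff.2 (H.D_one_ne_zero hU hz)
  have hN : unitNormal u z = ‖crossVec u z‖⁻¹ • crossVec u z := rfl
  rw [localTransform, hN, Real.tanh_eq_sinh_div_cosh, hcosh, hsinh, hc, smul_smul, smul_smul]
  by_cases ha : ‖aVec u z‖ = 0
  · have h0 : crossVec u z = 0 := norm_eq_zero.1 (by rw [hc, ha]; ring)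
    rw [h0]
    simp [sq]
  · congr 2
    · congr 1; field_simp
    · field_simp

/-- The transform satisfies the properties that characterize it. -/
theorem IsAdapted.isTransformAt (hz : z ∈ U) {ε : ℝ} (hε : ε ^ 2 = 1) :
    IsTransformAt ε u z (localTransform ε u z) := by
  obtain ⟨⟨a0, a1, a2⟩, b0, b1, b2⟩ := H.inner_normal hU hz
  obtain ⟨c0, c1, c2, c3, c4⟩ := H.crossVec_orthogonal hU hz
  obtain ⟨ab, hab⟩ := H.inner_aVec_bVec hU hz
  have hb := (H.norm_bVec_pos hU hz).ne'
  have hD := norm_ne_zero_iff.2 (H.D_one_ne_zero hU hz)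
  have hc := H.norm_crossVec_sq hU hz
  rw [H.localTransform_eq hU hz]
  set t := (4 * ‖D u 1 z‖ ^ 2 * ‖bVec u z‖ ^ 2)⁻¹ with ht
  have c4' : ⟪bVec u z, crossVec u z⟫ = 0 := by rw [real_inner_comm, c4]
  refine ⟨?_, ?_, ?_, ?_, ?_, ?_, ?_⟩
  · refine (pow_eq_one_iff_of_nonneg (norm_nonneg _) two_ne_zero).1 ?_
    rw [← real_inner_self_eq_norm_sq]
    simp only [inner_add_left, inner_add_right, inner_neg_left, inner_neg_right, inner_smul_left,
      inner_smul_right, c4, c4', real_inner_self_eq_norm_sq, hc, RCLike.conj_to_real, ht]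
    trans (‖bVec u z‖ ^ 2)⁻¹ + ε ^ 2 * (‖aVec u z‖ ^ 2 * (‖bVec u z‖ ^ 2)⁻¹)
    · field_simp
      ring
    · rw [hε, one_mul, ← one_add_mul, ← hab, mul_inv_cancel₀ (pow_ne_zero 2 hb)]
  · simp [inner_add_left, inner_neg_left, inner_smul_left, c0, (real_inner_comm _ _).trans b0]
  · simp [inner_add_left, inner_neg_left, inner_smul_left, c1, (real_inner_comm _ _).trans b1]
  · simp [inner_add_left, inner_neg_left, inner_smul_left, c2, (real_inner_comm _ _).trans b2]
  · simp [inner_add_left, inner_neg_left, inner_smul_left, c3, (real_inner_comm _ _).trans ab]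
  · simp [inner_add_left, inner_neg_left, inner_smul_left, c4]
    field_simp
  · simp only [inner_add_right, inner_neg_right, inner_smul_right, c4,
      real_inner_self_eq_norm_sq]
    have : ε * (-((‖bVec u z‖ ^ 2)⁻¹ * 0) + ε * t * ‖crossVec u z‖ ^ 2)
      = ε ^ 2 * t * ‖crossVec u z‖ ^ 2 := by ring
    rw [this]
    positivity

theorem IsAdapted.crossVec_ne_zero (hz : z ∈ U) (ha : aVec u z ≠ 0) : crossVec u z ≠ 0 := by
  intro h0
  have := H.norm_crossVec_sq hU hz
  rw [h0, norm_zero] at this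
  refine pow_ne_zero 2 ?_ (this.symm.trans (zero_pow two_ne_zero))
  exact mul_ne_zero (mul_ne_zero (mul_ne_zero four_ne_zero
    (pow_ne_zero 2 (norm_ne_zero_iff.2 (H.D_one_ne_zero hU hz)))) (norm_ne_zero_iff.2 ha))
    (H.norm_bVec_pos hU hz).ne'

/-- The determinant of the complex frame of a surface and a further vector. -/
theorem IsAdapted.inner_crossVec (hz : z ∈ U) (w : E6) : ((⟪crossVec u z, w⟫ : ℝ) : ℂ) =
    -4 * (rows (complexify u z) (dz (complexify u) z) (star (dz (complexify u) z))
      (dz (dz (complexify u)) z) (star (dz (dz (complexify u)) z)) (cv w)).det := by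
  have hs := H.aVec_bVec hU hz
  set s := sff (complexify u) z
  have ea : cv ((2 : ℝ) • aVec u z) = s + star s := by
    rw [← hs, cv_smul]
    simp only [star_sub, star_smul, star_cv]
    ext k; simp; ring
  have eb : cv ((2 : ℝ) • bVec u z) = I • (s - star s) := by
    rw [← hs, cv_smul]
    simp only [star_sub, star_smul, star_cv]
    ext k; simp; ring_nf; simp
  have hp := dz_dz_eq (complexify u) z
  set c := dz (dz (complexify u)) z ⬝ᵥ star (dz (complexify u) z) / metricFactor (complexify u) z
  have h := det_rows_add (complexify u z) (dz (complexify u) z) (star (dz (complexify u) z)) s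
    (star s) (cv w) 0 0 c (conj c)
  have hp' : dz (dz (complexify u)) z = s + (0 : ℂ) • cv w + c • dz (complexify u) z := by
    rw [zero_smul, add_zero]; exact hp
  have hp'' : star (dz (dz (complexify u)) z)
      = star s + (0 : ℂ) • cv w + conj c • star (dz (complexify u) z) := by
    rw [hp, star_add, star_smul, zero_smul, add_zero]; rfl
  rw [← hp', ← hp''] at h
  rw [crossVec, H.II_one_one hU hz, H.II_one_I hU hz, ofReal_inner_cross₅, ea, eb,
    cv_D_one (H.differentiableAt hU hz), cv_D_I (H.differentiableAt hU hz), h, ← complexify_eq,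
    det_rows_real]

/-- The transform is determined by its properties. -/
theorem IsAdapted.isTransformAt_unique (hz : z ∈ U) {ε : ℝ} (hε : ε ^ 2 = 1) {k h : E6}
    (hk : IsTransformAt ε u z k) (hh : IsTransformAt ε u z h) : k = h := by
  -- Then `|b| = 1`, and `(k, b) = -1` between unit vectors forces `k = -b`.
  by_cases ha : aVec u z = 0
  · have hb : ‖bVec u z‖ ^ 2 = 1 := by rw [(H.inner_aVec_bVec hU hz).2, ha]; simp
    have key : ∀ x : E6, IsTransformAt ε u z x → x = -bVec u z := fun x hx => by
      have : ‖x + bVec u z‖ ^ 2 = 0 := by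
        rw [norm_add_sq_real, hx.norm, hx.inner_b, hb]; norm_num
      exact eq_neg_of_add_eq_zero_left (norm_eq_zero.1 (pow_eq_zero_iff two_ne_zero |>.1 this))
    rw [key k hk, key h hh]
  · set c := crossVec u z with hc
    have hc0 : ‖c‖ ^ 2 ≠ 0 := pow_ne_zero 2 (norm_ne_zero_iff.2 (H.crossVec_ne_zero hU hz ha))
    obtain ⟨c0, c1, c2, c3, c4⟩ := H.crossVec_orthogonal hU hz
    have hdet : (rows (cv (u z)) (cv (D u 1 z)) (cv (D u I z)) (cv (II u z 1 1))
        (cv (II u z 1 I)) (cv c)).det ≠ 0 := by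
      rw [← ofReal_inner_cross₅]
      change ((⟪c, c⟫ : ℝ) : ℂ) ≠ 0
      rw [real_inner_self_eq_norm_sq]
      exact_mod_cast hc0
    set τ := ⟪c, k - h⟫ / ‖c‖ ^ 2 with hτ
    -- The difference is orthogonal to the first five vectors of a basis whose sixth vector is `c`,
    -- itself orthogonal to those five.
    have hkh : k - h = τ • c := by
      apply cv_injective
      have comm : ∀ x y : E6, ⟪x, y⟫ = ⟪y, x⟫ := fun x y => real_inner_comm y x
      refine dot_ext hdet ?_ ?_ ?_ ?_ ?_ ?_ <;> rw [cv_dot, cv_dot] <;> congr 1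
      · rw [comm, inner_sub_left, hk.inner_u, hh.inner_u, comm, inner_smul_left, c0]; simp
      · rw [comm, inner_sub_left, hk.inner_x, hh.inner_x, comm, inner_smul_left, c1]; simp
      · rw [comm, inner_sub_left, hk.inner_y, hh.inner_y, comm, inner_smul_left, c2]; simp
      · rw [H.II_one_one hU hz, inner_smul_left, inner_smul_left, comm, inner_sub_left, hk.inner_a,
          hh.inner_a, comm, inner_smul_left, c3]; simp
      · rw [H.II_one_I hU hz, inner_smul_left, inner_smul_left, comm, inner_sub_left, hk.inner_b,
          hh.inner_b, comm, inner_smul_left, c4]; simp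
      · rw [inner_smul_right, real_inner_self_eq_norm_sq, hτ, div_mul_cancel₀ _ hc0]
    have hk' : k = h + τ • c := by rw [← hkh]; abel
    have hn : τ * (2 * ⟪c, h⟫ + τ * ‖c‖ ^ 2) = 0 := by
      have h1 := hk.norm
      have h2 : ‖k‖ ^ 2 = ‖h‖ ^ 2 := by rw [h1, hh.norm]
      rw [hk', norm_add_sq_real, inner_smul_right, norm_smul, mul_pow, real_inner_comm] at h2
      simp at h2
      nlinarith
    -- Equal norms leave only `k = h` or `k` the mirror image of `h` along `c`. In the second case
    -- the products with `c` are opposite, so the two sign conditions make both zero, and again `k =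
    -- h`.
    rcases mul_eq_zero.1 hn with h0 | h0
    · rw [hk', h0, zero_smul, add_zero]
    · have h1 := hk.sign
      have h2 := hh.sign
      rw [hk', inner_add_right, inner_smul_right, real_inner_self_eq_norm_sq] at h1
      have h3 : ε * ⟪c, h⟫ = 0 := by
        have : τ * ‖c‖ ^ 2 = -2 * ⟪c, h⟫ := by linarith
        rw [this] at h1
        exact le_antisymm (by linarith) h2
      have h4 : ε ≠ 0 := fun h => by rw [h] at hε; norm_num at hε
      have h5 : ⟪c, h⟫ = 0 := by simpa [h4] using h3
      rw [h5, mul_zero, zero_add] at h0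
      have h6 : τ = 0 := by simpa [hc0] using h0
      rw [hk', h6, zero_smul, add_zero]

/-- In the unnormalized formula `localTransform_eq` only `|b|` and `|u_x|` occur in denominators,
and neither vanishes; zeros of `a` do no harm. -/
theorem IsAdapted.smooth_localTransform (ε : ℝ) : ContDiffOn ℝ ∞ (localTransform ε u) U := by
  have hu := H.contDiffOn
  have s0 := H.smooth_sff hU
  have sb : ContDiffOn ℝ ∞ (bVec u) U := by
    rw [← smooth_complexify_iff]
    refine ((Smooth.const_smul' (s0.sub s0.star') (I / 2)).congr fun w hw => ?_ : Smooth U _)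
    rw [complexify_eq]
    rw [← H.aVec_bVec hU hw]
    simp only [star_sub, star_smul, star_cv]
    ext k; simp; ring_nf; simp
  have sa : ContDiffOn ℝ ∞ (aVec u) U := by
    rw [← smooth_complexify_iff]
    refine ((Smooth.const_smul' (s0.add s0.star') (1 / 2)).congr fun w hw => ?_ : Smooth U _)
    rw [complexify_eq]
    rw [← H.aVec_bVec hU hw]
    simp only [star_sub, star_smul, star_cv]
    ext k; simp; ring_nf
  have s1 := contDiffOn_D hU hu 1
  have sI := contDiffOn_D hU hu I
  have sc : ContDiffOn ℝ ∞ (crossVec u) U := by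
    have : ContDiffOn ℝ ∞ (fun w => cross₅ (u w) (D u 1 w) (D u I w) ((2 : ℝ) • aVec u w)
        ((2 : ℝ) • bVec u w)) U := by
      rw [contDiffOn_euclidean]
      intro k
      simp only [cross₅, Matrix.det_apply]
      refine ContDiffOn.sum fun σ _ => ContDiffOn.const_smul _ (contDiffOn_prod fun i _ => ?_)
      have coord : ∀ {v : ℂ → E6}, ContDiffOn ℝ ∞ v U → ∀ j : Fin 6,
          ContDiffOn ℝ ∞ (fun w => v w j) U := fun hv j => contDiffOn_euclidean.1 hv j
      generalize σ i = i'
      fin_cases i' <;> simp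
      · exact coord hu _
      · exact coord s1 _
      · exact coord sI _
      · exact contDiffOn_const.mul (coord sa _)
      · exact contDiffOn_const.mul (coord sb _)
      · exact contDiffOn_const
    refine this.congr fun w hw => ?_
    rw [crossVec, H.II_one_one hU hw, H.II_one_I hU hw]
  have nb := sb.norm_sq ℝ
  have n1 := s1.norm_sq ℝ
  have hb : ∀ w ∈ U, ‖bVec u w‖ ≠ 0 := fun w hw => (H.norm_bVec_pos hU hw).ne'
  have hD : ∀ w ∈ U, ‖D u 1 w‖ ≠ 0 := fun w hw => norm_ne_zero_iff.2 (H.D_one_ne_zero hU hw)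
  have := (((nb.inv fun w hw => pow_ne_zero 2 (hb w hw)).smul sb).neg).add
    ((contDiffOn_const (c := ε)).mul ((((contDiffOn_const (c := (4 : ℝ))).mul n1).mul nb).inv
      fun w hw => mul_ne_zero (mul_ne_zero four_ne_zero (pow_ne_zero 2 (hD w hw)))
        (pow_ne_zero 2 (hb w hw))) |>.smul sc)
  exact this.congr fun w hw => H.localTransform_eq hU hw ε

/-- The transform of an adapted surface satisfies the relations of a pair. -/
theorem IsAdapted.isPair {ε : ℝ} (hε : ε ^ 2 = 1) :
    IsPair U (complexify u) (complexify (localTransform ε u)) := by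
  have T := fun z (hz : z ∈ U) => H.isTransformAt hU hz hε
  have hg1 : ∀ z ∈ U, complexify (localTransform ε u) z ⬝ᵥ dz (complexify u) z = 0 := by
    intro z hz
    rw [dz_complexify (H.differentiableAt hU hz), dotProduct_smul, dotProduct_sub, dotProduct_smul,
      complexify_eq, cv_dot, cv_dot, (T z hz).inner_x, (T z hz).inner_y]
    simp
  refine ⟨smooth_complexify_iff.2 (H.smooth_localTransform hU ε), fun z _ => star_cv (MinimalSurfaceS5.localTransform ε u z),
    fun z hz => ?_, fun z hz => ?_, hg1, fun z hz => ?_⟩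
  · rw [complexify_eq, cv_dot, real_inner_self_eq_norm_sq, (T z hz).norm]; simp
  · rw [complexify_eq, complexify_eq, cv_dot, (T z hz).inner_u]; simp
  · rw [dz_dz_eq, dotProduct_add, dotProduct_smul, hg1 z hz, smul_zero, add_zero,
      ← H.aVec_bVec hU hz, dotProduct_sub, dotProduct_smul, complexify_eq, cv_dot, cv_dot,
      (T z hz).inner_a, (T z hz).inner_b]
    simp

theorem IsAdapted.localTransform {ε : ℝ} (hε : ε ^ 2 = 1) :
    IsAdapted U (complexify (localTransform ε u)) :=
  (H.isPair hU hε).isAdapted H hU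

/-- A pair of surfaces gives a transform, provided that the orientations are right. -/
theorem IsAdapted.isTransformAt_of_isPair {ε : ℝ} {k : ℂ → E6}
    (P : IsPair U (complexify u) (complexify k)) (hz : z ∈ U)
    (hs : 0 ≤ ε * ⟪crossVec u z, k z⟫) : IsTransformAt ε u z (k z) := by
  have h1 := P.unit z hz
  have h2 := P.hg z hz
  have h3 := P.hg1 z hz
  have h3' := P.hg1' hz
  have h4 := P.h_sff hz
  simp only [complexify_eq, cv_dot, real_inner_self_eq_norm_sq] at h1 h2
  rw [← H.aVec_bVec hU hz, dotProduct_sub, dotProduct_smul, complexify_eq, cv_dot, cv_dot] at h4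
  have e1 := congrArg Complex.re h4
  have e2 := congrArg Complex.im h4
  simp at e1 e2
  refine ⟨(pow_eq_one_iff_of_nonneg (norm_nonneg _) two_ne_zero).1 (by exact_mod_cast h1),
    by exact_mod_cast h2, ?_, ?_, e1, by linarith, hs⟩
  · have : ((⟪k z, D u 1 z⟫ : ℝ) : ℂ) = 0 := by
      rw [← cv_dot, cv_D_one (H.differentiableAt hU hz), dotProduct_add, ← complexify_eq, h3, h3',
        add_zero]
    exact_mod_cast this
  · have : ((⟪k z, D u I z⟫ : ℝ) : ℂ) = 0 := by
      rw [← cv_dot, cv_D_I (H.differentiableAt hU hz), dotProduct_smul, dotProduct_sub,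
        ← complexify_eq, h3, h3', sub_zero, smul_zero]
    exact_mod_cast this

/-- The `(-ε)`-transform is inverse to the `(ε)`-transform. -/
theorem IsAdapted.localTransform_localTransform {ε : ℝ} (hε : ε ^ 2 = 1) :
    EqOn (MinimalSurfaceS5.localTransform (-ε) (MinimalSurfaceS5.localTransform ε u)) u U := by
  have hε' : (-ε) ^ 2 = 1 := by rw [neg_sq, hε]
  have H' := H.localTransform hU hε
  refine eqOn_of_dichotomy hU (H.smooth_defect hU).continuousOn
    (H'.smooth_localTransform hU (-ε)).continuousOn H.contDiffOn.continuousOn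
    fun O hO hO' hσ z hz => ?_
  have P := (H.isPair hU hε).mono hO
  have Q := P.symm (H.mono hO) hO'
  -- By symmetry of the pair relation `u` has all the characterizing properties of the second
  -- transform; only the orientation condition remains, and `exists_det_eq` supplies the change of
  -- sign.
  refine (H'.mono hO).isTransformAt_unique hO' hz hε' ((H'.mono hO).isTransformAt hO' hz hε')
    ((H'.mono hO).isTransformAt_of_isPair hO' Q hz ?_)
  obtain ⟨r, hr, hrows⟩ := P.exists_det_eq (H.mono hO) hO' hσ hz
  have e1 := (H'.mono hO).inner_crossVec hO' hz (u z)
  have e2 := (H.mono hO).inner_crossVec hO' hz (MinimalSurfaceS5.localTransform ε u z)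
  rw [← complexify_eq] at e1 e2
  rw [hrows] at e1
  have e3 : ⟪crossVec (MinimalSurfaceS5.localTransform ε u) z, u z⟫
      = -r * ⟪crossVec u z, MinimalSurfaceS5.localTransform ε u z⟫ := by
    have : ((⟪crossVec (MinimalSurfaceS5.localTransform ε u) z, u z⟫ : ℝ) : ℂ)
      = ((-r * ⟪crossVec u z, MinimalSurfaceS5.localTransform ε u z⟫ : ℝ) : ℂ) := by
      rw [e1, ofReal_mul, e2]; push_cast; ring
    exact_mod_cast this
  rw [e3]
  have := mul_nonneg hr (H.isTransformAt hU (hO hz) hε).sign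
  linarith

end

/-! ### Behaviour of the transforms under isometries -/

/-- The map `u` followed by an isometry. -/
def applyIsom (A : E6 ≃ₗᵢ[ℝ] E6) (u : ℂ → E6) : ℂ → E6 := fun z => A (u z)

theorem D_applyIsom (A : E6 ≃ₗᵢ[ℝ] E6) (u : ℂ → E6) (X : ℂ) :
    D (applyIsom A u) X = applyIsom A (D u X) := by
  ext1 z
  have : fderiv ℝ (applyIsom A u) z = _ := A.comp_fderiv (f := u) (x := z)
  rw [D, this]; rfl

theorem normalSpace_applyIsom (A : E6 ≃ₗᵢ[ℝ] E6) (u : ℂ → E6) (z : ℂ) :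
    normalSpace (applyIsom A u) z
      = (normalSpace u z).map (A.toLinearEquiv : E6 →ₗ[ℝ] E6) := by
  ext x
  have h1 : x ∈ (normalSpace u z).map (A.toLinearEquiv : E6 →ₗ[ℝ] E6)
      ↔ A.symm x ∈ normalSpace u z := by
    constructor
    · rintro ⟨y, hy, rfl⟩; simpa using hy
    · intro h; exact ⟨_, h, by simp⟩
  have key : ∀ y : E6, ⟪A y, x⟫ = ⟪y, A.symm x⟫ := fun y => by
    rw [← A.inner_map_map y (A.symm x), A.apply_symm_apply]
  rw [h1, mem_normalSpace_iff, mem_normalSpace_iff, D_applyIsom, D_applyIsom]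
  simp only [applyIsom, key]

theorem II_applyIsom (A : E6 ≃ₗᵢ[ℝ] E6) (u : ℂ → E6) (z X Y : ℂ) :
    II (applyIsom A u) z X Y = A (II u z X Y) := by
  have h : ∀ (K L : Submodule ℝ E6), L = K.map (A.toLinearEquiv : E6 →ₗ[ℝ] E6) → ∀ x : E6,
      L.starProjection (A x) = A (K.starProjection x) := by
    rintro K _ rfl x
    have := Submodule.starProjection_map_apply A K (A x)
    rw [A.symm_apply_apply] at this
    exact this
  rw [II, D_applyIsom, D_applyIsom]
  exact h _ _ (normalSpace_applyIsom A u z) _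

theorem aVec_applyIsom (A : E6 ≃ₗᵢ[ℝ] E6) (u : ℂ → E6) (z : ℂ) :
    aVec (applyIsom A u) z = A (aVec u z) := by
  simp only [aVec, II_applyIsom, map_sub, map_smul]

theorem bVec_applyIsom (A : E6 ≃ₗᵢ[ℝ] E6) (u : ℂ → E6) (z : ℂ) :
    bVec (applyIsom A u) z = A (bVec u z) := by
  simp only [bVec, II_applyIsom, map_add, map_smul]

/-- The matrix of an isometry. -/
def isomMatrix (A : E6 ≃ₗᵢ[ℝ] E6) : Matrix (Fin 6) (Fin 6) ℝ :=
  LinearMap.toMatrix (EuclideanSpace.basisFun (Fin 6) ℝ).toBasis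
    (EuclideanSpace.basisFun (Fin 6) ℝ).toBasis (A.toLinearEquiv : E6 →ₗ[ℝ] E6)

theorem det_isomMatrix (A : E6 ≃ₗᵢ[ℝ] E6) :
    (isomMatrix A).det = LinearMap.det (A.toLinearEquiv : E6 →ₗ[ℝ] E6) :=
  LinearMap.det_toMatrix _ _

theorem isomMatrix_mulVec (A : E6 ≃ₗᵢ[ℝ] E6) (x : E6) :
    isomMatrix A *ᵥ (x : Fin 6 → ℝ) = (A x : E6) := by
  have := LinearMap.toMatrix_mulVec_repr (EuclideanSpace.basisFun (Fin 6) ℝ).toBasis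
    (EuclideanSpace.basisFun (Fin 6) ℝ).toBasis (A.toLinearEquiv : E6 →ₗ[ℝ] E6) x
  ext k
  exact congrFun this k

/-- Multiplicativity of the determinant, tested against vectors `A w`. The orientation of `A` enters
the transform only through this. -/
theorem cross₅_map (A : E6 ≃ₗᵢ[ℝ] E6) (v₀ v₁ v₂ v₃ v₄ : E6) :
    cross₅ (A v₀) (A v₁) (A v₂) (A v₃) (A v₄)
      = LinearMap.det (A.toLinearEquiv : E6 →ₗ[ℝ] E6) • A (cross₅ v₀ v₁ v₂ v₃ v₄) := by
  refine ext_inner_right ℝ fun w => ?_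
  obtain ⟨w, rfl⟩ := A.surjective w
  rw [inner_smul_left, A.inner_map_map, inner_cross₅, inner_cross₅, ← det_isomMatrix,
    ← Matrix.det_transpose (isomMatrix A), RCLike.conj_to_real, mul_comm, ← Matrix.det_mul]
  congr 1
  ext i j
  rw [Matrix.mul_apply]
  have key : ∀ x : E6, (A x) j = ∑ k, x k * (isomMatrix A)ᵀ k j := fun x => by
    rw [← isomMatrix_mulVec]
    simp only [Matrix.mulVec, dotProduct, Matrix.transpose_apply, mul_comm]
  fin_cases i <;> exact key _

/-- An isometry reversing the orientation interchanges the two transforms. -/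
theorem localTransform_applyIsom {A : E6 ≃ₗᵢ[ℝ] E6} (hA : IsOrientationReversing A) (ε : ℝ)
    (u : ℂ → E6) (z : ℂ) :
    localTransform ε (applyIsom A u) z = A (localTransform (-ε) u z) := by
  have hN : unitNormal (applyIsom A u) z = -A (unitNormal u z) := by
    simp only [unitNormal, D_applyIsom, II_applyIsom]
    simp only [applyIsom, cross₅_map,
      show LinearMap.det (A.toLinearEquiv : E6 →ₗ[ℝ] E6) = -1 from hA]
    simp
  simp only [localTransform, phi, aVec_applyIsom, bVec_applyIsom, hN, map_add, map_neg, map_smul,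
    LinearIsometryEquiv.norm_map]
  simp

theorem localTransform_congr {U : Set ℂ} (hU : IsOpen U) {u v : ℂ → E6} (h : EqOn u v U) (ε : ℝ) :
    EqOn (localTransform ε u) (localTransform ε v) U := by
  intro z hz
  have hD : ∀ {u v : ℂ → E6}, EqOn u v U → ∀ X, EqOn (D u X) (D v X) U := fun h X w hw => by
    rw [D, D, (eventuallyEq_of_eqOn hU h hw).fderiv_eq]
  have hN : normalSpace u z = normalSpace v z := by
    simp only [normalSpace, h hz, hD h _ hz]
  have hII : ∀ X Y, II u z X Y = II v z X Y := fun X Y => by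
    simp only [II, hN, hD (hD h Y) X hz]
  simp only [localTransform, phi, aVec, bVec, unitNormal, hII, h hz, hD h _ hz]

/-! ### The complexification of an isometry -/

/-- The complex matrix of an isometry. -/
def cMatrix (A : E6 ≃ₗᵢ[ℝ] E6) : Matrix (Fin 6) (Fin 6) ℂ := (isomMatrix A).map Complex.ofReal

theorem cMatrix_mulVec_cv (A : E6 ≃ₗᵢ[ℝ] E6) (x : E6) : cMatrix A *ᵥ cv x = cv (A x) := by
  ext k
  rw [cv_apply, ← isomMatrix_mulVec]
  simp [cMatrix, Matrix.mulVec, dotProduct]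

theorem star_cMatrix_mulVec (A : E6 ≃ₗᵢ[ℝ] E6) (v : V6) :
    star (cMatrix A *ᵥ v) = cMatrix A *ᵥ star v := by
  ext k
  simp [cMatrix, Matrix.mulVec, dotProduct]

theorem cMatrix_dot (A : E6 ≃ₗᵢ[ℝ] E6) (v w : V6) :
    (cMatrix A *ᵥ v) ⬝ᵥ (cMatrix A *ᵥ w) = v ⬝ᵥ w := by
  rw [eq_re_add_im v, eq_re_add_im w]
  simp only [Matrix.mulVec_add, Matrix.mulVec_smul, cMatrix_mulVec_cv, add_dotProduct,
    dotProduct_add, smul_dotProduct, dotProduct_smul, cv_dot, A.inner_map_map]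

theorem fderiv_mulVec_apply (m : Matrix (Fin 6) (Fin 6) ℂ) {F : ℂ → V6} {z : ℂ}
    (hF : DifferentiableAt ℝ F z) (X : ℂ) :
    fderiv ℝ (fun z => m *ᵥ F z) z X = m *ᵥ fderiv ℝ F z X := by
  let L : V6 →L[ℝ] V6 := ((Matrix.mulVecLin m).restrictScalars ℝ).toContinuousLinearMap
  have : fderiv ℝ (fun z => L (F z)) z = L.comp (fderiv ℝ F z) :=
    (L.hasFDerivAt.comp z hF.hasFDerivAt).fderiv
  exact congrArg (fun T : ℂ →L[ℝ] V6 => T X) this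

theorem dz_mulVec (m : Matrix (Fin 6) (Fin 6) ℂ) {F : ℂ → V6} {z : ℂ}
    (hF : DifferentiableAt ℝ F z) : dz (fun z => m *ᵥ F z) z = m *ᵥ dz F z := by
  simp only [dz, fderiv_mulVec_apply m hF, Matrix.mulVec_smul, Matrix.mulVec_sub]

/-! ### Congruence of frames -/

theorem smooth_det {U : Set ℂ} {M : ℂ → Matrix (Fin 6) (Fin 6) ℂ}
    (h : ∀ i j, Smooth U (fun z => M z i j)) : Smooth U (fun z => (M z).det) := by
  simp only [Matrix.det_apply]
  exact ContDiffOn.sum fun σ _ => ContDiffOn.const_smul _ (contDiffOn_prod fun i _ => h _ _)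

theorem smooth_matrix_inv {U : Set ℂ} {M : ℂ → Matrix (Fin 6) (Fin 6) ℂ}
    (h : ∀ i j, Smooth U (fun z => M z i j)) (hdet : ∀ z ∈ U, (M z).det ≠ 0) (i j : Fin 6) :
    Smooth U (fun z => (M z)⁻¹ i j) := by
  simp only [Matrix.inv_def, Ring.inverse_eq_inv', Matrix.smul_apply, Matrix.adjugate_apply,
    smul_eq_mul]
  refine ((smooth_det h).inv hdet).mul (smooth_det fun k l => ?_)
  by_cases hk : k = j
  · subst hk; simpa using contDiffOn_const
  · simpa [Matrix.updateRow_ne hk] using h k l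

theorem fderiv_eq_zero_of_dz {W : Type*} [NormedAddCommGroup W] [NormedSpace ℝ W]
    [NormedSpace ℂ W] {F : ℂ → W} {z : ℂ} (h : dz F z = 0) (h' : dzb F z = 0) :
    fderiv ℝ F z = 0 := by
  ext X
  have hX : X = X.re • (1 : ℂ) + X.im • I := by
    apply Complex.ext <;> simp
  rw [hX, map_add, map_smul, map_smul, fderiv_one_eq, fderiv_I_eq, h, h']
  simp

theorem exists_isom_of_orthogonal {R : Matrix (Fin 6) (Fin 6) ℝ} (hR : Rᵀ * R = 1) :
    ∃ A : E6 ≃ₗᵢ[ℝ] E6, isomMatrix A = R := by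
  have hin : ∀ x y : Fin 6 → ℝ, (R *ᵥ x) ⬝ᵥ (R *ᵥ y) = x ⬝ᵥ y := fun x y => by
    rw [Matrix.dotProduct_mulVec, ← Matrix.mulVec_transpose, Matrix.mulVec_mulVec, hR,
      Matrix.one_mulVec]
  have hdot : ∀ x : E6, ‖x‖ ^ 2 = (x : Fin 6 → ℝ) ⬝ᵥ (x : Fin 6 → ℝ) := fun x => by
    rw [EuclideanSpace.norm_sq_eq]; simp [dotProduct, sq]
  let L : E6 →ₗ[ℝ] E6 :=
    { toFun := fun x => WithLp.toLp 2 (R *ᵥ (x : Fin 6 → ℝ))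
      map_add' := fun x y => by ext k; simp [Matrix.mulVec_add]
      map_smul' := fun c x => by ext k; simp [Matrix.mulVec_smul] }
  let A : E6 ≃ₗᵢ[ℝ] E6 := LinearIsometry.toLinearIsometryEquiv ⟨L, fun x => by
    refine (sq_eq_sq₀ (norm_nonneg _) (norm_nonneg _)).1 ?_
    rw [hdot, hdot]; exact hin _ _⟩ rfl
  refine ⟨A, ?_⟩
  apply Matrix.mulVec_injective
  ext1 x
  exact isomMatrix_mulVec A (WithLp.toLp 2 x)

/-- Two frame fields with the same scalar products and the same connection forms are
congruent. -/
theorem exists_congruence {U : Set ℂ} (hU : IsOpen U) (hc : IsPreconnected U) {z₀ : ℂ}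
    (hz₀ : z₀ ∈ U) {M N : Fin 6 → ℂ → V6} (sM : ∀ i, Smooth U (M i)) (sN : ∀ i, Smooth U (N i))
    (π : Equiv.Perm (Fin 6)) (rM : ∀ i, ∀ z ∈ U, star (M i z) = M (π i) z)
    (rN : ∀ i, ∀ z ∈ U, star (N i z) = N (π i) z)
    (hdet : ∀ z ∈ U, (Matrix.of fun i => M i z).det ≠ 0)
    (hG : ∀ i j, ∀ z ∈ U, M i z ⬝ᵥ M j z = N i z ⬝ᵥ N j z)
    (hD : ∀ i j, ∀ z ∈ U, dz (M i) z ⬝ᵥ M j z = dz (N i) z ⬝ᵥ N j z) :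
    ∃ A : E6 ≃ₗᵢ[ℝ] E6, ∀ i, ∀ z ∈ U, N i z = cMatrix A *ᵥ M i z := by
  set m : ℂ → Matrix (Fin 6) (Fin 6) ℂ := fun z => Matrix.of fun i => M i z
  set n : ℂ → Matrix (Fin 6) (Fin 6) ℂ := fun z => Matrix.of fun i => N i z
  have hGm : ∀ z ∈ U, m z * (m z)ᵀ = n z * (n z)ᵀ := fun z hz => by
    ext i j; exact hG i j z hz
  have hm : ∀ z ∈ U, IsUnit (m z).det := fun z hz => isUnit_iff_ne_zero.2 (hdet z hz)
  have hn : ∀ z ∈ U, IsUnit (n z).det := fun z hz => by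
    have := congrArg Matrix.det (hGm z hz)
    simp only [Matrix.det_mul, Matrix.det_transpose] at this
    refine isUnit_iff_ne_zero.2 fun h0 => ?_
    rw [h0, mul_zero] at this
    exact mul_ne_zero (hdet z hz) (hdet z hz) this
  -- The matrix carrying the rows of one frame to those of the other; it has to be shown real,
  -- orthogonal and constant.
  set A : ℂ → Matrix (Fin 6) (Fin 6) ℂ := fun z => (m z)⁻¹ * n z
  have hmA : ∀ z ∈ U, m z * A z = n z := fun z hz => Matrix.mul_nonsing_inv_cancel_left _ _ (hm z hz)
  have hAn : ∀ z ∈ U, A z * (n z)ᵀ = (m z)ᵀ := fun z hz => by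
    rw [Matrix.mul_assoc, ← hGm z hz, Matrix.nonsing_inv_mul_cancel_left _ _ (hm z hz)]
  set a : Fin 6 → ℂ → V6 := fun k z j => A z j k
  have sa : ∀ k, Smooth U (a k) := fun k => contDiffOn_pi.2 fun j => by
    have e : (fun z => a k z j) = fun z => ∑ l, (m z)⁻¹ j l * N l z k := by
      ext z; exact Matrix.mul_apply
    rw [e]
    exact ContDiffOn.sum fun l _ => (smooth_matrix_inv (fun i j => contDiffOn_pi.1 (sM i) j)
      hdet j l).mul (contDiffOn_pi.1 (sN l) k)
  have hMa : ∀ i k, ∀ z ∈ U, M i z ⬝ᵥ a k z = N i z k := fun i k z hz =>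
    congrFun (congrFun (hmA z hz) i) k
  have inj : ∀ z ∈ U, ∀ v w : V6, (∀ i, M i z ⬝ᵥ v = M i z ⬝ᵥ w) → v = w := fun z hz v w h =>
    Matrix.mulVec_injective_of_isUnit ((Matrix.isUnit_iff_isUnit_det _).2 (hm z hz))
      (funext fun i => h i)
  -- Equal connection coefficients give `(∂m) A = ∂n`, so differentiating `m A = n` leaves `m ∂A =
  -- 0`.
  have hdz : ∀ k, ∀ z ∈ U, dz (a k) z = 0 := by
    intro k z hz
    set m' : Matrix (Fin 6) (Fin 6) ℂ := Matrix.of fun i => dz (M i) z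
    set n' : Matrix (Fin 6) (Fin 6) ℂ := Matrix.of fun i => dz (N i) z
    have h1 : m' * (m z)ᵀ = n' * (n z)ᵀ := by ext i j; exact hD i j z hz
    have h2 : m' * A z = n' := by
      have h3 : m' * A z * (n z)ᵀ = n' * (n z)ᵀ := by rw [Matrix.mul_assoc, hAn z hz, h1]
      have hu : IsUnit ((n z)ᵀ).det := by rw [Matrix.det_transpose]; exact hn z hz
      have := congrArg (· * ((n z)ᵀ)⁻¹) h3
      simpa [Matrix.mul_nonsing_inv_cancel_right _ _ hu] using this
    refine inj z hz _ _ fun i => ?_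
    rw [dotProduct_zero]
    have d1 := dz_dot ((sM i).differentiableAt hU hz) ((sa k).differentiableAt hU hz)
    have d2 := dz_dot ((sN i).differentiableAt hU hz)
      (differentiableAt_const (Pi.single k 1 : V6))
    rw [dz_const, dotProduct_zero, add_zero, dotProduct_single_one] at d2
    have d3 : dz (fun z => M i z ⬝ᵥ a k z) z = dz (fun z => N i z ⬝ᵥ Pi.single k 1) z :=
      dz_congr hU (fun w hw => by simp only [hMa i k w hw, dotProduct_single_one]) hz
    have d4 : dz (M i) z ⬝ᵥ a k z = dz (N i) z k := congrFun (congrFun h2 i) k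
    rw [d1, d2, d4] at d3
    simpa using d3
  -- Conjugation permutes the rows of both frames by the same `π`. Reality also turns `∂A = 0` into
  -- `∂̄A = 0`, so no hypothesis on `∂̄` of the frames is needed.
  have hreal : ∀ k, ∀ z ∈ U, star (a k z) = a k z := fun k z hz => by
    refine inj z hz _ _ fun i => ?_
    obtain ⟨i, rfl⟩ := π.surjective i
    rw [← rM i z hz, dot_star_comm, hMa i k z hz, rM i z hz, hMa (π i) k z hz, ← rN i z hz]
    rfl
  have hconst : ∀ k, ∀ z ∈ U, a k z = a k z₀ := fun k z hz =>
    hU.is_const_of_fderiv_eq_zero (𝕜 := ℝ) hc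
      (fun w hw => ((sa k).differentiableAt hU hw).differentiableWithinAt)
      (fun w hw => fderiv_eq_zero_of_dz (hdz k w hw) (by
        rw [dzb_eq_star_dz hU (sa k) (hreal k) hw, hdz k w hw, star_zero])) hz hz₀
  have hA : ∀ z ∈ U, A z = A z₀ := fun z hz => by
    ext j k; exact congrFun (hconst k z hz) j
  -- The transpose appears because `A` acts on row vectors from the right.
  set R : Matrix (Fin 6) (Fin 6) ℝ := (A z₀)ᵀ.map Complex.re
  have hRA : R.map Complex.ofReal = (A z₀)ᵀ := by
    ext k j
    have : conj (A z₀ j k) = A z₀ j k := congrFun (hreal k z₀ hz₀) j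
    exact Complex.conj_eq_iff_re.1 this
  have hAA : A z₀ * (A z₀)ᵀ = 1 := by
    have h1 := hAn z₀ hz₀
    rw [← hmA z₀ hz₀, Matrix.transpose_mul, ← Matrix.mul_assoc] at h1
    have hu : IsUnit ((m z₀)ᵀ).det := by rw [Matrix.det_transpose]; exact hm z₀ hz₀
    have := congrArg (· * ((m z₀)ᵀ)⁻¹) h1
    simpa [Matrix.mul_nonsing_inv_cancel_right _ _ hu, Matrix.mul_nonsing_inv _ hu] using this
  have hRR : Rᵀ * R = 1 := by
    apply Matrix.map_injective Complex.ofReal_injective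
    change (Rᵀ * R).map Complex.ofRealHom = (1 : Matrix (Fin 6) (Fin 6) ℝ).map Complex.ofRealHom
    rw [Matrix.map_mul, Matrix.map_one _ (map_zero _) (map_one _)]
    change (R.map Complex.ofReal)ᵀ * R.map Complex.ofReal = 1
    rw [hRA, Matrix.transpose_transpose, hAA]
  obtain ⟨B, hB⟩ := exists_isom_of_orthogonal hRR
  refine ⟨B, fun i z hz => ?_⟩
  ext k
  rw [cMatrix, hB, hRA, Matrix.mulVec_transpose, ← hA z hz]
  exact (hMa i k z hz).symm

/-! ### The invariant `γ` -/

theorem IsMinimal.dzb_dz_dz {U : Set ℂ} {g : ℂ → V6} (H : IsMinimal U g) (hU : IsOpen U) {z : ℂ}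
    (hz : z ∈ U) : dzb (dz (dz g)) z =
      -(dz (metricFactor g) z • g z + metricFactor g z • dz g z) := by
  rw [dzb_dz hU (H.smooth.dz hU) hz, dz_congr hU (G := fun z => -(metricFactor g z • g z))
    (fun w hw => by rw [H.harmonic w hw, neg_smul]) hz, dz_neg,
    dz_smul ((H.smooth_metricFactor hU).differentiableAt hU hz) (H.smooth.differentiableAt hU hz),
    add_comm]

theorem exists_metricFactor_eq {g : ℂ → V6} {z : ℂ} :
    ∃ r : ℝ, 0 ≤ r ∧ metricFactor g z = r := by
  refine ⟨∑ k, normSq (dz g z k), Finset.sum_nonneg fun k _ => normSq_nonneg _, ?_⟩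
  simp [metricFactor, dotProduct, Complex.mul_conj]

/-- The frame consisting of two surfaces and their first derivatives. -/
def swapFrame (g h : ℂ → V6) : Fin 6 → ℂ → V6 :=
  ![g, dz g, fun z => star (dz g z), h, dz h, fun z => star (dz h z)]

/-- The frame consisting of a surface, its derivatives up to second order, and a normal field. -/
def derivFrame (g h : ℂ → V6) : Fin 6 → ℂ → V6 :=
  ![g, dz g, fun z => star (dz g z), dz (dz g), fun z => star (dz (dz g) z), h]

section

variable {U : Set ℂ} {g h : ℂ → V6} (H : IsAdapted U g) (P : IsPair U g h) (hU : IsOpen U) {z : ℂ}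

include H P hU

/-- The derivative of the constant `(∂h, ∂g) = -i`. Thus `γ` changes sign when the two surfaces are
exchanged. -/
theorem IsPair.dz_g_dz_dz (hz : z ∈ U) :
    dz (dz h) z ⬝ᵥ dz g z = -(dz (dz g) z ⬝ᵥ dz h z) := by
  rw [dz_dot_of_const hU (P.smooth.dz hU) (H.smooth.dz hU)
    (fun w hw => P.h1_g1 H.toIsMinimal hU hw) hz, dotProduct_comm (dz h z)]

/-- Harmonicity of both maps reduces the derivative to `(∂g, ∂h) = -i` and `(g, ∂h) = 0`, together
with `(∂∂g, h) = i`. Its use is that `γ = 0` forces the induced metrics to agree. -/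
theorem IsPair.dzb_gamma (hz : z ∈ U) :
    dzb (fun z => dz (dz g) z ⬝ᵥ dz h z) z = I * (metricFactor g z - metricFactor h z) := by
  rw [dzb_dot (((H.smooth.dz hU).dz hU).differentiableAt hU hz)
    ((P.smooth.dz hU).differentiableAt hU hz), H.dzb_dz_dz hU hz,
    (P.isAdapted H hU).harmonic z hz, neg_dotProduct, add_dotProduct, smul_dotProduct,
    smul_dotProduct, dotProduct_smul, dotProduct_comm _ (h z), P.hp z hz,
    dotProduct_comm (g z), P.h1_g H.toIsMinimal hU hz, dotProduct_comm (dz g z),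
    P.h1_g1 H.toIsMinimal hU hz]
  simp only [smul_eq_mul]
  ring

theorem IsPair.metricFactor_eq (hγ : ∀ z ∈ U, dz (dz g) z ⬝ᵥ dz h z = 0) (hz : z ∈ U) :
    metricFactor h z = metricFactor g z := by
  have h1 := P.dzb_gamma H hU hz
  rw [dzb_congr hU (G := fun _ => 0) hγ hz, dzb_const] at h1
  have := (mul_eq_zero.1 h1.symm).resolve_left I_ne_zero
  exact (sub_eq_zero.1 this).symm

theorem IsPair.gram_swapFrame (hz : z ∈ U) (i j : Fin 6) :
    swapFrame g h i z ⬝ᵥ swapFrame g h j z =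
      (!![1, 0, 0, 0, 0, 0; 0, 0, metricFactor g z, 0, -I, 0; 0, metricFactor g z, 0, 0, 0, I;
        0, 0, 0, 1, 0, 0; 0, -I, 0, 0, 0, metricFactor h z;
        0, 0, I, 0, metricFactor h z, 0] : Matrix (Fin 6) (Fin 6) ℂ) i j := by
  have Q := P.symm H hU
  have H' := P.isAdapted H hU
  have e0 := H.unit z hz
  have e1 := H.g_g1 hU hz
  have e2 := H.g_g1' hU hz
  have e3 := H.conformal z hz
  have e4 : dz g z ⬝ᵥ star (dz g z) = metricFactor g z := rfl
  have f0 := H'.unit z hz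
  have f1 := H'.g_g1 hU hz
  have f2 := H'.g_g1' hU hz
  have f3 := H'.conformal z hz
  have f4 : dz h z ⬝ᵥ star (dz h z) = metricFactor h z := rfl
  have k0 := P.hg z hz
  have k1 := P.hg1 z hz
  have k2 := P.hg1' hz
  have k3 := Q.hg1 z hz
  have k4 := Q.hg1' hz
  have k5 := P.h1_g1 H.toIsMinimal hU hz
  have k6 := P.h1_g1' H.toIsMinimal hU hz
  have k7 := Q.h1_g1' H'.toIsMinimal hU hz
  fin_cases i <;> fin_cases j <;>
  simp [swapFrame, e0, e1, e2, e3, e4, f0, f1, f2, f3, f4, k0, k1, k2, k3, k4, k5, k6, k7,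
    dot_star_comm, dotProduct_comm (dz g z) (g z), dotProduct_comm (star (dz g z)) (g z),
    dotProduct_comm (star (dz g z)) (dz g z), dotProduct_comm (dz h z) (h z),
    dotProduct_comm (star (dz h z)) (h z), dotProduct_comm (star (dz h z)) (dz h z),
    dotProduct_comm (g z) (h z), dotProduct_comm (dz g z) (h z),
    dotProduct_comm (star (dz g z)) (h z), dotProduct_comm (dz h z) (g z),
    dotProduct_comm (star (dz h z)) (g z), dotProduct_comm (dz g z) (dz h z),
    dotProduct_comm (star (dz g z)) (dz h z), dotProduct_comm (star (dz h z)) (dz g z)]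

/-- With `γ = 0` every coefficient is a constant, a conformal factor or its derivative. Equal
conformal factors make the table invariant under exchange of the two surfaces, which is the input
for `exists_congruence`. -/
theorem IsPair.connection_swapFrame (hγ : dz (dz g) z ⬝ᵥ dz h z = 0) (hz : z ∈ U) (i j : Fin 6) :
    dz (swapFrame g h i) z ⬝ᵥ swapFrame g h j z =
      (!![0, 0, metricFactor g z, 0, -I, 0; 0, 0, dz (metricFactor g) z, I, 0, 0;
        -metricFactor g z, 0, 0, 0, 0, 0; 0, -I, 0, 0, 0, metricFactor h z;
        I, 0, 0, 0, 0, dz (metricFactor h) z;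
        0, 0, 0, -metricFactor h z, 0, 0] : Matrix (Fin 6) (Fin 6) ℂ) i j := by
  have Q := P.symm H hU
  have H' := P.isAdapted H hU
  have G := P.gram_swapFrame H hU hz
  have hγ' := P.dz_g_dz_dz H hU hz
  rw [hγ, neg_zero] at hγ'
  have s1 := H.dz_star_g1 hU hz
  have s2 := H'.dz_star_g1 hU hz
  have m1 : dz (dz g) z ⬝ᵥ star (dz h z) = 0 := by
    rw [dz_dot_of_const hU (H.smooth.dz hU) (P.smooth.dz hU).star' (c := 0) (fun w hw => by
      exact Q.h1_g1' H'.toIsMinimal hU hw) hz, s2, dotProduct_smul, dotProduct_comm,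
      P.hg1 z hz, smul_zero, neg_zero]
  have m2 : dz (dz h) z ⬝ᵥ star (dz g z) = 0 := by
    rw [dz_dot_of_const hU (P.smooth.dz hU) (H.smooth.dz hU).star' (c := 0) (fun w hw => by
      exact P.h1_g1' H.toIsMinimal hU hw) hz, s1, dotProduct_smul, dotProduct_comm,
      Q.hg1 z hz, smul_zero, neg_zero]
  have e0 := H.p_g hU hz
  have e1 := H.p_g1 hU hz
  have e2 := (H.dz_metricFactor hU hz).symm
  have f0 := H'.p_g hU hz
  have f1 := H'.p_g1 hU hz
  have f2 := (H'.dz_metricFactor hU hz).symm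
  have k0 := (dotProduct_comm _ _).trans (P.hp z hz)
  have k1 := (dotProduct_comm _ _).trans (Q.hp z hz)
  fin_cases i
  · exact (G 1 j).trans (by fin_cases j <;> rfl)
  · fin_cases j <;> simp [swapFrame, e0, e1, e2, k0, hγ, m1]
  · have : dz (swapFrame g h 2) z = (-metricFactor g z) • swapFrame g h 0 z := s1
    exact (congrArg (· ⬝ᵥ swapFrame g h j z) this).trans ((smul_dotProduct _ _ _).trans
      ((congrArg _ (G 0 j)).trans (by fin_cases j <;> simp)))
  · exact (G 4 j).trans (by fin_cases j <;> rfl)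
  · fin_cases j <;> simp [swapFrame, f0, f1, f2, k1, hγ', m2]
  · have : dz (swapFrame g h 5) z = (-metricFactor h z) • swapFrame g h 3 z := s2
    exact (congrArg (· ⬝ᵥ swapFrame g h j z) this).trans ((smul_dotProduct _ _ _).trans
      ((congrArg _ (G 3 j)).trans (by fin_cases j <;> simp)))

/-- The Gram matrix has an explicit inverse with denominator `E² - 1`. -/
theorem IsPair.det_swapFrame_ne_zero (hE : metricFactor h z = metricFactor g z)
    (hE' : metricFactor g z ^ 2 - 1 ≠ 0) (hz : z ∈ U) :
    (Matrix.of fun i => swapFrame g h i z).det ≠ 0 := by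
  set E := metricFactor g z
  set M : Matrix (Fin 6) (Fin 6) ℂ := Matrix.of fun i => swapFrame g h i z
  have hG : M * Mᵀ = !![1, 0, 0, 0, 0, 0; 0, 0, E, 0, -I, 0; 0, E, 0, 0, 0, I;
        0, 0, 0, 1, 0, 0; 0, -I, 0, 0, 0, E; 0, 0, I, 0, E, 0] := by
    ext i j
    have := P.gram_swapFrame H hU hz i j
    rw [hE] at this
    exact this
  have hk : (E ^ 2 - 1) * (E ^ 2 - 1)⁻¹ = 1 := mul_inv_cancel₀ hE'
  set k := (E ^ 2 - 1)⁻¹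
  have hinv : (!![1, 0, 0, 0, 0, 0; 0, 0, E, 0, -I, 0; 0, E, 0, 0, 0, I;
        0, 0, 0, 1, 0, 0; 0, -I, 0, 0, 0, E; 0, 0, I, 0, E, 0] : Matrix (Fin 6) (Fin 6) ℂ) *
      !![1, 0, 0, 0, 0, 0; 0, 0, k * E, 0, -I * k, 0; 0, k * E, 0, 0, 0, I * k;
        0, 0, 0, 1, 0, 0; 0, -I * k, 0, 0, 0, k * E; 0, 0, I * k, 0, k * E, 0] = 1 := by
    ext i j
    fin_cases i <;> fin_cases j <;> simp [Matrix.mul_apply, Fin.sum_univ_six] <;>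
    first
    | linear_combination hk + k * I_mul_I
    | ring
  intro h0
  have := congrArg Matrix.det hinv
  rw [← hG, Matrix.det_mul, Matrix.det_mul, h0, Matrix.det_one] at this
  simp at this

theorem IsPair.smooth_swapFrame (i : Fin 6) : Smooth U (swapFrame g h i) := by
  fin_cases i
  exacts [H.smooth, H.smooth.dz hU, (H.smooth.dz hU).star', P.smooth, P.smooth.dz hU,
    (P.smooth.dz hU).star']

omit hU in
theorem IsPair.star_swapFrame (hz : z ∈ U) (i : Fin 6) : star (swapFrame g h i z) =
    swapFrame g h ((Equiv.swap 1 2 * Equiv.swap 4 5 : Equiv.Perm (Fin 6)) i) z := by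
  fin_cases i
  exacts [H.real z hz, rfl, star_star _, P.real z hz, rfl, star_star _]

/-- If the conformal factors are equal to `1` then the ellipse of curvature is degenerate. -/
theorem IsPair.defect_eq_zero_of_metricFactor
    (hγ : ∀ z ∈ U, dz (dz g) z ⬝ᵥ dz h z = 0) (hE : ∀ z ∈ U, metricFactor g z ^ 2 - 1 = 0)
    (hz : z ∈ U) : defect g z = 0 := by
  have hE1 : ∀ w ∈ U, metricFactor g w = 1 := fun w hw => by
    obtain ⟨r, hr, hr'⟩ := exists_metricFactor_eq (g := g) (z := w)
    have := hE w hw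
    rw [hr'] at this ⊢
    have h1 : r ^ 2 = 1 := by
      have : ((r ^ 2 : ℝ) : ℂ) = (1 : ℝ) := by push_cast; linear_combination this
      exact_mod_cast this
    rw [(pow_eq_one_iff_of_nonneg hr two_ne_zero).1 h1]; simp
  have H' := P.isAdapted H hU
  -- Equality in the Cauchy–Schwarz inequality: both vectors have Hermitian norm one and `(∂h, ∂g) =
  -- -i`.
  have hh1 : ∀ w ∈ U, dz h w = (-I) • star (dz g w) := fun w hw => by
    rw [← sub_eq_zero]
    apply dot_star_self_eq_zero
    have e1 := P.h1_g1 H.toIsMinimal hU hw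
    have e2 : star (dz g w) ⬝ᵥ star (dz h w) = I := by
      rw [dot_star_comm, dotProduct_comm, e1]; simp
    have e3 : dz h w ⬝ᵥ star (dz h w) = 1 :=
      (P.metricFactor_eq H hU hγ hw).trans (hE1 w hw)
    have e4 : dz g w ⬝ᵥ star (dz g w) = 1 := hE1 w hw
    simp only [star_sub, star_smul, star_star, sub_dotProduct, dotProduct_sub, smul_dotProduct,
      dotProduct_smul, e1, e2, e3, dotProduct_comm (star (dz g w)) (dz g w), e4, smul_eq_mul]
    simp
  -- Applying `∂̄` and harmonicity of `h`. Consequently `∂∂g = i h` is already normal, with norm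
  -- one.
  have h1 : h z = I • star (dz (dz g) z) := by
    have e1 := H'.harmonic z hz
    rw [P.metricFactor_eq H hU hγ hz, hE1 z hz,
      dzb_congr hU hh1 hz, dzb_const_smul ((H.smooth.dz hU).star'.differentiableAt hU hz),
      dzb_star ((H.smooth.dz hU).differentiableAt hU hz), neg_smul, neg_smul, one_smul] at e1
    exact (neg_injective e1).symm
  have h2 : dz (dz g) z = I • h z := by
    rw [← P.real z hz, h1, star_smul, star_star, smul_smul]; simp
  have h3 : sff g z = I • h z := by
    have : dz (dz g) z ⬝ᵥ star (dz g z) = 0 := by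
      rw [h2, smul_dotProduct, P.hg1' hz, smul_zero]
    rw [sff, this, zero_div, zero_smul, sub_zero, h2]
  rw [defect, h3, star_smul, P.real z hz, smul_dotProduct, dotProduct_smul, P.unit z hz]
  simp

end

/-- If `γ` vanishes, a surface and its transform are congruent near the points where the conformal
factors are different from `1`. -/
theorem exists_local_congruence {U : Set ℂ} {u v : ℂ → E6} (H : IsAdapted U (complexify u))
    (P : IsPair U (complexify u) (complexify v)) (hU : IsOpen U)
    (hγ : ∀ z ∈ U, dz (dz (complexify u)) z ⬝ᵥ dz (complexify v) z = 0)
    (hE : ∀ z ∈ U, metricFactor (complexify u) z ^ 2 - 1 ≠ 0) {z₀ : ℂ} (hz₀ : z₀ ∈ U) :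
    ∃ O ⊆ U, IsOpen O ∧ z₀ ∈ O ∧ ∃ A : E6 ≃ₗᵢ[ℝ] E6, IsOrientationReversing A ∧
      EqOn (applyIsom A u) v O := by
  obtain ⟨ε, hε, hB⟩ := Metric.isOpen_iff.1 hU z₀ hz₀
  have hO : IsOpen (Metric.ball z₀ ε) := Metric.isOpen_ball
  have hzB := Metric.mem_ball_self (x := z₀) hε
  have H₁ := H.mono hB
  have P₁ := P.mono hB
  have Q₁ := P₁.symm H₁ hO
  have H₁' := P₁.isAdapted H₁ hO
  have hγ₁ : ∀ z ∈ Metric.ball z₀ ε, _ := fun z hz => hγ z (hB hz)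
  have hEE : ∀ z ∈ Metric.ball z₀ ε, _ := fun z hz => P₁.metricFactor_eq H₁ hO hγ₁ hz
  have hγ₂ : ∀ z ∈ Metric.ball z₀ ε,
      dz (dz (complexify v)) z ⬝ᵥ dz (complexify u) z = 0 := fun z hz => by
    rw [P₁.dz_g_dz_dz H₁ hO hz, hγ₁ z hz, neg_zero]
  -- `N` is `M` with the two halves interchanged; the congruence between them will send `u` to `v`.
  set M := swapFrame (complexify u) (complexify v)
  set N := swapFrame (complexify v) (complexify u)
  have hdet : ∀ z ∈ Metric.ball z₀ ε, (Matrix.of fun i => M i z).det ≠ 0 := fun z hz =>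
    P₁.det_swapFrame_ne_zero H₁ hO (hEE z hz) (hE z (hB hz)) hz
  obtain ⟨A, hA⟩ := exists_congruence hO (convex_ball z₀ ε).isPreconnected hzB (M := M) (N := N)
    (P₁.smooth_swapFrame H₁ hO) (Q₁.smooth_swapFrame H₁' hO)
    (Equiv.swap 1 2 * Equiv.swap 4 5)
    (fun i z hz => P₁.star_swapFrame H₁ hz i) (fun i z hz => Q₁.star_swapFrame H₁' hz i)
    hdet
    (fun i j z hz => by
      rw [P₁.gram_swapFrame H₁ hO hz, Q₁.gram_swapFrame H₁' hO hz, hEE z hz])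
    (fun i j z hz => by
      rw [P₁.connection_swapFrame H₁ hO (hγ₁ z hz) hz,
        Q₁.connection_swapFrame H₁' hO (hγ₂ z hz) hz, hEE z hz, dz_congr hO hEE hz])
  refine ⟨_, hB, hO, hzB, A, ?_, fun z hz => ?_⟩
  -- The interchange of halves is a product of three transpositions, hence odd; comparing
  -- determinants gives `det A = -1`.
  · set σ : Equiv.Perm (Fin 6) := Equiv.swap 0 3 * Equiv.swap 1 4 * Equiv.swap 2 5
    have hσ : (Equiv.Perm.sign σ : ℤ) = -1 := by decide
    have h1 : (Matrix.of fun i => N i z₀) = (Matrix.of fun i => M i z₀).submatrix σ id := by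
      ext i j; fin_cases i <;> rfl
    have h2 : (Matrix.of fun i => N i z₀) = (Matrix.of fun i => M i z₀) * (cMatrix A)ᵀ := by
      ext i j
      rw [Matrix.mul_apply]
      have := congrFun (hA i z₀ hzB) j
      rw [Matrix.of_apply, this]
      simp [Matrix.mulVec, dotProduct, mul_comm]
    have h3 := congrArg Matrix.det (h1.symm.trans h2)
    rw [Matrix.det_permute, Matrix.det_mul, Matrix.det_transpose, hσ, mul_comm] at h3
    have h4 := mul_left_cancel₀ (hdet z₀ hzB) h3
    have h5 : (cMatrix A).det = (((isomMatrix A).det : ℝ) : ℂ) :=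
      (RingHom.map_det Complex.ofRealHom (isomMatrix A)).symm
    rw [h5, det_isomMatrix] at h4
    have h6 : ((LinearMap.det (A.toLinearEquiv : E6 →ₗ[ℝ] E6) : ℝ) : ℂ) = ((-1 : ℝ) : ℂ) := by
      rw [← h4]; push_cast; rfl
    exact Complex.ofReal_injective h6
  · apply cv_injective
    have := hA 0 z hz
    exact ((cMatrix_mulVec_cv A (u z)).symm.trans this.symm)

/-- A vector orthogonal to a surface and its transform vanishes unless the ellipse of curvature is
degenerate. -/
theorem eq_zero_of_orthogonal {U : Set ℂ} {u v : ℂ → E6} (H : IsAdapted U (complexify u))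
    (P : IsPair U (complexify u) (complexify v)) (hU : IsOpen U) {z : ℂ} (hz : z ∈ U)
    (hσ : defect (complexify u) z ≠ 0) {m : E6} (h1 : ∀ w ∈ U, ⟪u w, m⟫ = 0)
    (h2 : ∀ w ∈ U, ⟪v w, m⟫ = 0) : m = 0 := by
  have sc : Smooth U (fun _ : ℂ => cv m) := contDiffOn_const
  have key : ∀ F : ℂ → V6, Smooth U F → (∀ w ∈ U, F w ⬝ᵥ cv m = 0) →
      ∀ w ∈ U, dz F w ⬝ᵥ cv m = 0 := fun F hF h w hw => by
    rw [dz_dot_of_const hU hF sc h hw, dz_const, dotProduct_zero, neg_zero]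
  have e0 : ∀ w ∈ U, complexify u w ⬝ᵥ cv m = 0 := fun w hw => by
    rw [complexify_eq, cv_dot, h1 w hw, ofReal_zero]
  have e1 := key _ H.smooth e0
  have e2 := key _ (H.smooth.dz hU) e1
  have e5 : complexify v z ⬝ᵥ cv m = 0 := by rw [complexify_eq, cv_dot, h2 z hz, ofReal_zero]
  have hs : ∀ X : V6, X ⬝ᵥ cv m = 0 → star X ⬝ᵥ cv m = 0 := fun X hX => by
    rw [← star_cv m, dot_star_comm, hX, map_zero]
  apply cv_injective
  rw [map_zero]
  refine dot_ext (P.det_rows_ne_zero H hU hz hσ) ?_ ?_ ?_ ?_ ?_ ?_ <;> rw [dotProduct_zero]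
  exacts [e0 z hz, e1 z hz, hs _ (e1 z hz), e2 z hz, hs _ (e2 z hz), e5]

theorem dz_applyIsom {U : Set ℂ} (hU : IsOpen U) {u : ℂ → E6} (hu : ContDiffOn ℝ ∞ u U)
    (A : E6 ≃ₗᵢ[ℝ] E6) : EqOn (dz (complexify (applyIsom A u)))
      (fun z => cMatrix A *ᵥ dz (complexify u) z) U := fun z hz => by
  have h : complexify (applyIsom A u) = fun z => cMatrix A *ᵥ complexify u z := by
    ext1 z; exact (cMatrix_mulVec_cv A (u z)).symm
  rw [h, dz_mulVec _ ((smooth_complexify_iff.2 hu).differentiableAt hU hz)]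

theorem dz_dz_applyIsom {U : Set ℂ} (hU : IsOpen U) {u : ℂ → E6} (hu : ContDiffOn ℝ ∞ u U)
    (A : E6 ≃ₗᵢ[ℝ] E6) : EqOn (dz (dz (complexify (applyIsom A u))))
      (fun z => cMatrix A *ᵥ dz (dz (complexify u)) z) U := fun z hz => by
  rw [dz_congr hU (dz_applyIsom hU hu A) hz, dz_mulVec _
    (((smooth_complexify_iff.2 hu).dz hU).differentiableAt hU hz)]

theorem complexify_eqOn {U : Set ℂ} {u v : ℂ → E6} (h : EqOn u v U) :
    EqOn (complexify u) (complexify v) U := fun z hz => by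
  rw [complexify_eq, complexify_eq, h hz]

theorem dz_eqOn {W : Type*} [NormedAddCommGroup W] [NormedSpace ℝ W] [NormedSpace ℂ W]
    {U : Set ℂ} (hU : IsOpen U) {F G : ℂ → W} (h : EqOn F G U) : EqOn (dz F) (dz G) U :=
  fun _ hz => dz_congr hU h hz

/-- An isometry interchanging a surface and its transform forces `γ = 0`. -/
theorem gamma_eq_zero_of_isom {U : Set ℂ} {u v : ℂ → E6} (H : IsAdapted U (complexify u))
    (P : IsPair U (complexify u) (complexify v)) (hU : IsOpen U) {A : E6 ≃ₗᵢ[ℝ] E6}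
    (h1 : EqOn (applyIsom A u) v U) (h2 : EqOn (applyIsom A v) u U) {z : ℂ} (hz : z ∈ U) :
    dz (dz (complexify u)) z ⬝ᵥ dz (complexify v) z = 0 := by
  have hv := smooth_complexify_iff.1 P.smooth
  have e1 : dz (dz (complexify v)) z = cMatrix A *ᵥ dz (dz (complexify u)) z :=
    (dz_eqOn hU (dz_eqOn hU (complexify_eqOn h1)) hz).symm.trans
      (dz_dz_applyIsom hU H.contDiffOn A hz)
  have e2 : dz (complexify u) z = cMatrix A *ᵥ dz (complexify v) z :=
    (dz_eqOn hU (complexify_eqOn h2) hz).symm.trans (dz_applyIsom hU hv A hz)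
  have e3 := P.dz_g_dz_dz H hU hz
  -- The isometry identifies `γ` with the invariant of the exchanged pair, which is also `-γ`.
  have e4 : dz (dz (complexify v)) z ⬝ᵥ dz (complexify u) z =
      dz (dz (complexify u)) z ⬝ᵥ dz (complexify v) z := by
    rw [e1, e2, cMatrix_dot]
  linear_combination (e3 - e4) / 2

/-! ### Sequences of transforms in a coordinate domain -/

/-- A sequence of minimal surfaces, each of which is the transform of its neighbours. -/
structure IsTransformSeq (U : Set ℂ) (u : ℤ → ℂ → E6) : Prop where
  adapted : ∀ n, IsAdapted U (complexify (u n))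
  succ : ∀ n, EqOn (u (n + 1)) (localTransform 1 (u n)) U
  pred : ∀ n, EqOn (u n) (localTransform (-1) (u (n + 1))) U

theorem IsPair.congr {U : Set ℂ} {g h k : ℂ → V6} (P : IsPair U g h) (e : EqOn k h U) :
    IsPair U g k :=
  ⟨P.smooth.congr e, fun z hz => by rw [e hz, P.real z hz], fun z hz => by rw [e hz, P.unit z hz],
    fun z hz => by rw [e hz, P.hg z hz], fun z hz => by rw [e hz, P.hg1 z hz],
    fun z hz => by rw [e hz, P.hp z hz]⟩

theorem applyIsom_eqOn_derivFrame {U : Set ℂ} (hU : IsOpen U) {u v u' v' : ℂ → E6}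
    (hu : ContDiffOn ℝ ∞ u U) (A : E6 ≃ₗᵢ[ℝ] E6) (h1 : EqOn (applyIsom A u) u' U)
    (h2 : EqOn (applyIsom A v) v' U) (i : Fin 6) :
    EqOn (derivFrame (complexify u') (complexify v') i)
      (fun z => cMatrix A *ᵥ derivFrame (complexify u) (complexify v) i z) U := by
  have e0 : EqOn (complexify u') (fun z => cMatrix A *ᵥ complexify u z) U := fun z hz =>
    (complexify_eqOn h1 hz).symm.trans (cMatrix_mulVec_cv A (u z)).symm
  have e5 : EqOn (complexify v') (fun z => cMatrix A *ᵥ complexify v z) U := fun z hz =>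
    (complexify_eqOn h2 hz).symm.trans (cMatrix_mulVec_cv A (v z)).symm
  have e1 : EqOn (dz (complexify u')) (fun z => cMatrix A *ᵥ dz (complexify u) z) U :=
    fun z hz => (dz_eqOn hU (complexify_eqOn h1) hz).symm.trans (dz_applyIsom hU hu A hz)
  have e2 : EqOn (dz (dz (complexify u'))) (fun z => cMatrix A *ᵥ dz (dz (complexify u)) z) U :=
    fun z hz => (dz_eqOn hU (dz_eqOn hU (complexify_eqOn h1)) hz).symm.trans
      (dz_dz_applyIsom hU hu A hz)
  intro z hz
  fin_cases i
  · exact e0 hz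
  · exact e1 hz
  · exact (congrArg star (e1 hz)).trans (star_cMatrix_mulVec A _)
  · exact e2 hz
  · exact (congrArg star (e2 hz)).trans (star_cMatrix_mulVec A _)
  · exact e5 hz

theorem smooth_derivFrame {U : Set ℂ} (hU : IsOpen U) {g h : ℂ → V6} (hg : Smooth U g)
    (hh : Smooth U h) (i : Fin 6) : Smooth U (derivFrame g h i) := by
  fin_cases i
  exacts [hg, hg.dz hU, (hg.dz hU).star', (hg.dz hU).dz hU, ((hg.dz hU).dz hU).star', hh]

theorem star_derivFrame {U : Set ℂ} {g h : ℂ → V6} (hg : ∀ z ∈ U, star (g z) = g z)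
    (hh : ∀ z ∈ U, star (h z) = h z) (i : Fin 6) (z : ℂ) (hz : z ∈ U) :
    star (derivFrame g h i z) =
      derivFrame g h ((Equiv.swap 1 2 * Equiv.swap 3 4 : Equiv.Perm (Fin 6)) i) z := by
  fin_cases i
  exacts [hg z hz, rfl, star_star _, rfl, star_star _, hh z hz]

theorem of_derivFrame (g h : ℂ → V6) (z : ℂ) : (Matrix.of fun i => derivFrame g h i z) =
    rows (g z) (dz g z) (star (dz g z)) (dz (dz g) z) (star (dz (dz g) z)) (h z) := by
  ext i j; fin_cases i <;> rfl

/-- A linear isometry is determined by its values on a surface and its transform. -/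
theorem isom_ext {U : Set ℂ} {u v : ℂ → E6} (H : IsAdapted U (complexify u))
    (P : IsPair U (complexify u) (complexify v)) (hU : IsOpen U) {z : ℂ} (hz : z ∈ U)
    (hσ : defect (complexify u) z ≠ 0) {A A' : E6 ≃ₗᵢ[ℝ] E6} (h1 : ∀ w ∈ U, A (u w) = A' (u w))
    (h2 : ∀ w ∈ U, A (v w) = A' (v w)) : A = A' := by
  -- Agreement at `x` is converted into orthogonality to a fixed vector, so that the spanning
  -- property of the surface and its transform applies.
  have key : ∀ x y, A x = A' x → ⟪x, A.symm y - A'.symm y⟫ = 0 := fun x y h => by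
    have e1 := A.inner_map_map x (A.symm y)
    have e2 := A'.inner_map_map x (A'.symm y)
    rw [LinearIsometryEquiv.apply_symm_apply] at e1 e2
    rw [inner_sub_right, ← e1, ← e2, h, sub_self]
  have hs : ∀ y, A.symm y = A'.symm y := fun y => sub_eq_zero.1
    (eq_zero_of_orthogonal H P hU hz hσ (fun w hw => key _ y (h1 w hw))
      fun w hw => key _ y (h2 w hw))
  ext1 x
  have := hs (A x)
  rw [LinearIsometryEquiv.symm_apply_apply] at this
  have h3 := congrArg A' this
  rw [LinearIsometryEquiv.apply_symm_apply] at h3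
  exact h3.symm

namespace IsTransformSeq

variable {U : Set ℂ} {u : ℤ → ℂ → E6} (T : IsTransformSeq U u)

include T

theorem mono {O : Set ℂ} (h : O ⊆ U) : IsTransformSeq O u :=
  ⟨fun n => (T.adapted n).mono h, fun n => (T.succ n).mono h, fun n => (T.pred n).mono h⟩

variable (hU : IsOpen U)

include hU

theorem isPair (n : ℤ) : IsPair U (complexify (u n)) (complexify (u (n + 1))) :=
  ((T.adapted n).isPair hU (one_pow 2)).congr (complexify_eqOn (T.succ n))

/-- Degeneracy on an open set passes from a surface to its transform, and the pair relation is
symmetric. -/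
theorem defect_iff (n : ℤ) : (∀ z ∈ U, defect (complexify (u (n + 1))) z = 0) ↔
    ∀ z ∈ U, defect (complexify (u n)) z = 0 := by
  have P := T.isPair hU n
  exact ⟨fun h z hz => (P.symm (T.adapted n) hU).defect_eq_zero (T.adapted _) hU h hz,
    fun h z hz => P.defect_eq_zero (T.adapted n) hU h hz⟩

theorem defect_iff_zero (n : ℤ) : (∀ z ∈ U, defect (complexify (u n)) z = 0) ↔
    ∀ z ∈ U, defect (complexify (u 0)) z = 0 := by
  induction n using Int.induction_on with
  | zero => rfl
  | succ k ih => rw [T.defect_iff hU, ih]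
  | pred k ih => rw [← ih, ← T.defect_iff hU (-(k : ℤ) - 1), sub_add_cancel]

/-- An orientation-reversing congruence between two surfaces of the sequence reflects it. -/
theorem applyIsom_reflect {A : E6 ≃ₗᵢ[ℝ] E6} (hA : IsOrientationReversing A) {m n : ℤ}
    (h : EqOn (applyIsom A (u m)) (u n) U) (r : ℤ) :
    EqOn (applyIsom A (u (m - r))) (u (n + r)) U := by
  induction r using Int.induction_on with
  | zero => simpa using h
  | succ k ih =>
    intro z hz
    have h1 := T.pred (m - (k + 1)) hz
    rw [show m - ((k : ℤ) + 1) + 1 = m - k by ring] at h1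
    have h2 := T.succ (n + k) hz
    -- Stepping forward on the image side becomes a `(-)`-transform before `A` is applied, that is,
    -- a step backward.
    rw [← add_assoc, h2, ← localTransform_congr hU ih 1 hz, localTransform_applyIsom hA]
    exact congrArg A h1
  | pred k ih =>
    intro z hz
    have h1 := T.succ (m - -(k : ℤ)) hz
    have h2 := T.pred (n + (-(k : ℤ) - 1)) hz
    rw [show n + (-(k : ℤ) - 1) + 1 = n + -(k : ℤ) by ring] at h2
    rw [show m - (-(k : ℤ) - 1) = m - -(k : ℤ) + 1 by ring, h2,
      ← localTransform_congr hU ih (-1) hz, localTransform_applyIsom hA, neg_neg]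
    exact congrArg A h1

/-- Reflecting the indices with `r = -1` shows that `A` also maps `u (q + 1)` back to `u q`. -/
theorem gamma_eq_zero {A : E6 ≃ₗᵢ[ℝ] E6} (hA : IsOrientationReversing A) {q : ℤ}
    (h : EqOn (applyIsom A (u q)) (u (q + 1)) U) {z : ℂ} (hz : z ∈ U) :
    localGamma (u q) (u (q + 1)) z = 0 := by
  have h' := T.applyIsom_reflect hU hA h (-1)
  rw [sub_neg_eq_add, add_neg_cancel_right] at h'
  exact gamma_eq_zero_of_isom (T.adapted q) (T.isPair hU q) hU h h' hz

variable (hσ : ∀ z ∈ U, defect (complexify (u 0)) z ≠ 0)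

include hσ

-- Only `u 0` is assumed non-degenerate at every point. The other surfaces may have degenerate
-- points, but not an open set of them, since that would propagate back to `u 0`.
omit hU in
theorem exists_defect_ne_zero (n : ℤ) {O : Set ℂ} (hOU : O ⊆ U) (hO : IsOpen O)
    (hne : O.Nonempty) : ∃ z ∈ O, defect (complexify (u n)) z ≠ 0 := by
  by_contra! h
  obtain ⟨z, hz⟩ := hne
  exact hσ z (hOU hz) (((T.mono hOU).defect_iff_zero hO n).1 h z hz)

theorem isom_eq {A A' : E6 ≃ₗᵢ[ℝ] E6} {n : ℤ} (hne : U.Nonempty)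
    (h1 : ∀ w ∈ U, A (u n w) = A' (u n w))
    (h2 : ∀ w ∈ U, A (u (n + 1) w) = A' (u (n + 1) w)) : A = A' := by
  obtain ⟨z, hz, hd⟩ := T.exists_defect_ne_zero hσ n subset_rfl hU hne
  exact isom_ext (T.adapted n) (T.isPair hU n) hU hz hd h1 h2

/-- If `γ` vanishes then the two surfaces are congruent near each point. -/
theorem exists_congruence {q : ℤ} (hγ : ∀ z ∈ U, localGamma (u q) (u (q + 1)) z = 0) {z₀ : ℂ}
    (hz₀ : z₀ ∈ U) : ∃ O ⊆ U, IsOpen O ∧ z₀ ∈ O ∧ ∃ A : E6 ≃ₗᵢ[ℝ] E6, IsOrientationReversing A ∧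
      EqOn (applyIsom A (u q)) (u (q + 1)) O := by
  obtain ⟨ε, hε, hB⟩ := Metric.isOpen_iff.1 hU z₀ hz₀
  have hO : IsOpen (Metric.ball z₀ ε) := Metric.isOpen_ball
  have hzB := Metric.mem_ball_self (x := z₀) hε
  set V := Metric.ball z₀ ε
  have TV := T.mono hB
  have hσV : ∀ z ∈ V, defect (complexify (u 0)) z ≠ 0 := fun z hz => hσ z (hB hz)
  set σ : ℂ → ℂ := fun z => metricFactor (complexify (u q)) z ^ 2 - 1
  have sσ : ContinuousOn σ V :=
    (((TV.adapted q).smooth_metricFactor hO).continuousOn.pow 2).sub continuousOn_const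
  -- The swap frame of `u q`, `u (q + 1)` may degenerate at zeros of `σ`. The derivative frame of `u
  -- 0` never does, and index reflection about `q + 1/2` sends `u 0`, `u 1` to `u (2q + 1)`, `u
  -- (2q)`; the congruence is therefore sought between these frames.
  set M := derivFrame (complexify (u 0)) (complexify (u 1))
  set N := derivFrame (complexify (u (2 * q + 1))) (complexify (u (2 * q)))
  have reflect : ∀ {O : Set ℂ} {A : E6 ≃ₗᵢ[ℝ] E6}, IsTransformSeq O u → IsOpen O →
      IsOrientationReversing A → EqOn (applyIsom A (u q)) (u (q + 1)) O →
      EqOn (applyIsom A (u 0)) (u (2 * q + 1)) O ∧ EqOn (applyIsom A (u 1)) (u (2 * q)) O := by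
    intro O A TO hO hA h
    have h1 := TO.applyIsom_reflect hO hA h q
    have h2 := TO.applyIsom_reflect hO hA h (q - 1)
    rw [sub_self, show q + 1 + q = 2 * q + 1 by ring] at h1
    rw [sub_sub_cancel, show q + 1 + (q - 1) = 2 * q by ring] at h2
    exact ⟨h1, h2⟩
  have near : ∀ O ⊆ V, IsOpen O → (∀ z ∈ O, σ z ≠ 0) → ∀ z ∈ O, ∃ O' ⊆ O, IsOpen O' ∧ z ∈ O' ∧
      ∃ A : E6 ≃ₗᵢ[ℝ] E6, IsOrientationReversing A ∧ EqOn (applyIsom A (u 0)) (u (2 * q + 1)) O' ∧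
        EqOn (applyIsom A (u 1)) (u (2 * q)) O' := by
    intro O hOV hO' hne z hz
    have TO := TV.mono hOV
    obtain ⟨O', hO'O, hO'o, hz', A, hA, hAu⟩ := exists_local_congruence (TO.adapted q)
      (TO.isPair hO' q) hO' (fun w hw => hγ w (hB (hOV hw))) hne hz
    exact ⟨O', hO'O, hO'o, hz', A, hA, reflect (TO.mono hO'O) hO'o hA hAu⟩
  -- Equal conformal factors with square one on an open set would make `u q` degenerate there; thus
  -- the zeros of `σ` have empty interior.
  have nondeg : ∀ O ⊆ V, IsOpen O → (∀ z ∈ O, σ z = 0) → ∀ z, z ∉ O := by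
    intro O hOV hO' h0 z hz
    have TO := TV.mono hOV
    obtain ⟨w, hw, hd⟩ := TV.exists_defect_ne_zero hσV q hOV hO' ⟨z, hz⟩
    exact hd ((TO.isPair hO' q).defect_eq_zero_of_metricFactor (TO.adapted q) hO'
      (fun w hw => hγ w (hB (hOV hw))) h0 hw)
  have sM : ∀ i, Smooth V (M i) := fun i =>
    smooth_derivFrame hO (TV.adapted 0).smooth (TV.adapted 1).smooth i
  have sN : ∀ i, Smooth V (N i) := fun i =>
    smooth_derivFrame hO (TV.adapted _).smooth (TV.adapted _).smooth i
  have frame : ∀ O ⊆ V, IsOpen O → ∀ A : E6 ≃ₗᵢ[ℝ] E6,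
      EqOn (applyIsom A (u 0)) (u (2 * q + 1)) O → EqOn (applyIsom A (u 1)) (u (2 * q)) O →
      ∀ i, EqOn (N i) (fun z => cMatrix A *ᵥ M i z) O := fun O hOV hO' A h1 h2 i =>
    applyIsom_eqOn_derivFrame hO' (TV.mono hOV |>.adapted 0).contDiffOn A h1 h2 i
  -- The local isometries away from the zeros of `σ` may a priori differ, but each gives the same
  -- Gram and connection identities. These extend by continuity and produce one isometry on the
  -- whole ball.
  obtain ⟨A, hA⟩ := MinimalSurfaceS5.exists_congruence hO (convex_ball z₀ ε).isPreconnected hzB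
    (M := M) (N := N) sM sN (Equiv.swap 1 2 * Equiv.swap 3 4)
    (star_derivFrame (TV.adapted 0).real (TV.adapted 1).real)
    (star_derivFrame (TV.adapted _).real (TV.adapted _).real)
    (fun z hz => by
      rw [of_derivFrame]
      exact (TV.isPair hO 0).det_rows_ne_zero (TV.adapted 0) hO hz (hσV z hz))
    (fun i j => eqOn_of_dichotomy hO sσ ((sM i).dot (sM j)).continuousOn
      ((sN i).dot (sN j)).continuousOn fun O hOV hO' hd z hz => by
        rcases hd with hd | hd
        · obtain ⟨O', hO'O, hO'o, hz', A, -, h1, h2⟩ := near O hOV hO' hd z hz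
          have hf := frame O' (hO'O.trans hOV) hO'o A h1 h2
          simp only [hf i hz', hf j hz', cMatrix_dot]
        · exact absurd hz (nondeg O hOV hO' hd z))
    (fun i j => eqOn_of_dichotomy hO sσ (((sM i).dz hO).dot (sM j)).continuousOn
      (((sN i).dz hO).dot (sN j)).continuousOn fun O hOV hO' hd z hz => by
        rcases hd with hd | hd
        · obtain ⟨O', hO'O, hO'o, hz', A, -, h1, h2⟩ := near O hOV hO' hd z hz
          have hf := frame O' (hO'O.trans hOV) hO'o A h1 h2
          simp only [dz_congr hO'o (hf i) hz', hf j hz',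
            dz_mulVec _ ((sM i).differentiableAt hO (hOV hz)), cMatrix_dot]
        · exact absurd hz (nondeg O hOV hO' hd z))
  have hA0 : EqOn (applyIsom A (u 0)) (u (2 * q + 1)) V := fun z hz => by
    apply cv_injective
    exact (cMatrix_mulVec_cv A (u 0 z)).symm.trans (hA 0 z hz).symm
  have hA1 : EqOn (applyIsom A (u 1)) (u (2 * q)) V := fun z hz => by
    apply cv_injective
    exact (cMatrix_mulVec_cv A (u 1 z)).symm.trans (hA 5 z hz).symm
  -- Near a point with `σ ≠ 0` there is a local orientation-reversing isometry, and `A` coincides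
  -- with it because both agree on `u 0` and `u 1`.
  have hrev : IsOrientationReversing A := by
    obtain ⟨z₁, hz₁, hσ₁⟩ : ∃ z ∈ V, σ z ≠ 0 := by
      by_contra! h
      exact nondeg V subset_rfl hO h z₀ hzB
    obtain ⟨O', hO'O, hO'o, hz', A', hA', h1, h2⟩ := near (V ∩ σ ⁻¹' {0}ᶜ)
      inter_subset_left (sσ.isOpen_inter_preimage hO isOpen_compl_singleton) (fun z hz => hz.2)
      z₁ ⟨hz₁, hσ₁⟩
    have hO'V : O' ⊆ V := hO'O.trans inter_subset_left
    rwa [(TV.mono hO'V).isom_eq hO'o (fun z hz => hσV z (hO'V hz)) (n := 0) ⟨z₁, hz'⟩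
      (fun w hw => (hA0 (hO'V hw)).trans (h1 hw).symm)
      (fun w hw => (hA1 (hO'V hw)).trans (h2 hw).symm)]
  refine ⟨V, hB, hO, hzB, A, hrev, ?_⟩
  have := TV.applyIsom_reflect hO hrev hA0 (-q)
  rwa [show 0 - -q = q by ring, show 2 * q + 1 + -q = q + 1 by ring] at this

end IsTransformSeq

/-! ### The ellipse of curvature -/

section

variable {U : Set ℂ} {u : ℂ → E6} (hU : IsOpen U) {z : ℂ}

include hU

theorem D_D_apply (hu : ContDiffOn ℝ ∞ u U) (hz : z ∈ U) (X Y : ℂ) :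
    D (D u X) Y z = fderiv ℝ (fderiv ℝ u) z Y X := by
  have hd : DifferentiableAt ℝ (fderiv ℝ u) z :=
    ((hu.fderiv_of_isOpen hU (m := ∞) (by simp)).contDiffAt (hU.mem_nhds hz)).differentiableAt
      (by simp)
  change fderiv ℝ (fun z => fderiv ℝ u z X) z Y = _
  rw [fderiv_clm_apply hd (differentiableAt_const X)]
  simp

/-- A smooth map into the unit sphere satisfying the pointwise conditions of a conformal minimal
immersion is minimal. -/
theorem isMinimal_of_isConformalMinimalAt (hu : ContDiffOn ℝ ∞ u U) (hn : ∀ z ∈ U, ‖u z‖ = 1)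
    (h : ∀ z ∈ U, IsConformalMinimalAt u z) : IsMinimal U (complexify u) := by
  have sm : Smooth U (complexify u) := smooth_complexify_iff.2 hu
  have real : ∀ z ∈ U, star (complexify u z) = complexify u z := fun z _ => star_cv _
  have unit : ∀ z ∈ U, complexify u z ⬝ᵥ complexify u z = 1 := fun z hz => by
    rw [complexify_eq, cv_dot, real_inner_self_eq_norm_sq, hn z hz]; simp
  have conf : ∀ z ∈ U, dz (complexify u) z ⬝ᵥ dz (complexify u) z = 0 := fun z hz => by
    obtain ⟨-, h2, h3, -⟩ := h z hz
    rw [dz_complexify (differentiableAt_of_contDiffOn hU hu hz)]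
    simp only [sub_dotProduct, dotProduct_sub, smul_dotProduct, dotProduct_smul, cv_dot,
      smul_eq_mul, real_inner_self_eq_norm_sq, real_inner_comm (D u 1 z), h3, h2, ofReal_zero,
      mul_zero, sub_zero, zero_sub]
    linear_combination (1 / 4 * ((‖D u I z‖ ^ 2 : ℝ) : ℂ)) * I_mul_I
  refine ⟨sm, real, unit, fun z hz h0 => ?_, conf, fun z hz => ?_⟩
  · apply (h z hz).1
    apply cv_injective
    rw [cv_D_one (differentiableAt_of_contDiffOn hU hu hz), h0, star_zero, add_zero, map_zero]
  · have hd := differentiableAt_of_contDiffOn hU hu hz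
    set g := complexify u
    set E := metricFactor g z
    have g_g1 : ∀ w ∈ U, g w ⬝ᵥ dz g w = 0 := fun w hw => by
      have h1 := dz_dot_of_const hU sm sm unit hw
      rw [dotProduct_comm] at h1
      linear_combination h1 / 2
    have g_g1' : ∀ w ∈ U, dz g w ⬝ᵥ g w = 0 := fun w hw => by rw [dotProduct_comm, g_g1 w hw]
    set L := (1 / 4 : ℝ) • (D (D u 1) 1 z + D (D u I) I z)
    have hK : dzb (dz g) z = cv L := dzb_dz_complexify hU hu hz
    have k0 : cv L ⬝ᵥ g z = -E := by
      rw [← hK, dzb_dot_of_const hU (sm.dz hU) sm g_g1' hz, dzb_eq_star_dz hU sm real hz]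
      rfl
    have k1 : cv L ⬝ᵥ dz g z = 0 := by
      have := dzb_dot_of_const hU (sm.dz hU) (sm.dz hU) conf hz
      rw [dotProduct_comm (dz g z), hK] at this
      linear_combination this / 2
    have k2 : cv L ⬝ᵥ star (dz g z) = 0 := by
      rw [dot_star_of_real (star_cv L), k1, map_zero]
    have hgs : g z ⬝ᵥ star (dz g z) = 0 := by
      rw [dot_star_of_real (real z hz), g_g1 z hz, map_zero]
    obtain ⟨r, -, hr⟩ := exists_metricFactor_eq (g := g) (z := z)
    have hx : cv (L + r • u z) = cv L + E • g z := by
      rw [map_add, cv_smul r, ← hr]; rfl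
    have inner_zero : ∀ y : E6, cv (L + r • u z) ⬝ᵥ cv y = 0 → ⟪y, L + r • u z⟫ = 0 :=
      fun y hy => by rw [cv_dot] at hy; rw [real_inner_comm]; exact_mod_cast hy
    have o0 : ⟪u z, L + r • u z⟫ = 0 := inner_zero _ (by
      rw [hx, add_dotProduct, smul_dotProduct, ← complexify_eq, k0, unit z hz]; simp)
    have o1 : ⟪D u 1 z, L + r • u z⟫ = 0 := inner_zero _ (by
      rw [hx, cv_D_one hd, add_dotProduct, smul_dotProduct, dotProduct_add, dotProduct_add, k1, k2,
        g_g1 z hz, hgs]; simp)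
    have o2 : ⟪D u I z, L + r • u z⟫ = 0 := inner_zero _ (by
      rw [hx, cv_D_I hd, add_dotProduct, smul_dotProduct, dotProduct_smul, dotProduct_smul,
        dotProduct_sub, dotProduct_sub, k1, k2, g_g1 z hz, hgs]; simp)
    have hN : L + r • u z ∈ normalSpace u z := mem_normalSpace_iff.2 ⟨o0, o1, o2⟩
    have hL : (normalSpace u z).starProjection L = 0 := by
      rw [map_smul, map_add]
      exact (congrArg _ (h z hz).2.2.2).trans (smul_zero _)
    -- The vector is normal, so it equals its own normal projection; both summands project to zero.
    have hzero : L + r • u z = 0 := by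
      have hu' : u z ∈ (normalSpace u z)ᗮ :=
        Submodule.le_orthogonal_orthogonal _ (Submodule.subset_span (by simp))
      rw [← Submodule.starProjection_eq_self_iff.2 hN, map_add, hL, map_smul,
        (Submodule.starProjection_apply_eq_zero_iff _).2 hu', smul_zero, add_zero]
    rw [hK, neg_smul]
    rw [hzero, map_zero] at hx
    exact eq_neg_of_add_eq_zero_left hx.symm

variable (H : IsMinimal U (complexify u))

include H

theorem IsMinimal.II_self (hz : z ∈ U) (x y : ℝ) : II u z (x + y * I) (x + y * I) =
    (2 * (x ^ 2 - y ^ 2)) • aVec u z + (4 * x * y) • bVec u z := by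
  have h11 := H.II_one_one hU hz
  have h1I := H.II_one_I hU hz
  have hI1 : II u z I 1 = II u z 1 I := by rw [II, II, D_comm hU H.contDiffOn hz]
  have hII : II u z I I = -((2 : ℝ) • aVec u z) := by
    have : aVec u z = (1 / 4 : ℝ) • (II u z 1 1 - II u z I I) := rfl
    rw [h11] at this
    have h4 : (4 : ℝ) • aVec u z = (2 : ℝ) • aVec u z - II u z I I := by
      nth_rw 1 [this]; rw [smul_smul]; norm_num
    rw [eq_sub_iff_add_eq, ← eq_sub_iff_add_eq'] at h4
    rw [h4]; module
  have e : ((x : ℂ) + y * I) = x • (1 : ℂ) + y • I := by simp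
  rw [e]
  have expand : II u z (x • (1 : ℂ) + y • I) (x • (1 : ℂ) + y • I) = x • x • II u z 1 1 +
      (x • y • II u z 1 I + y • x • II u z I 1) + y • y • II u z I I := by
    simp only [II, D_D_apply hU H.contDiffOn hz, map_add, map_smul, _root_.add_apply,
      _root_.smul_apply]
    module
  rw [expand, h11, hI1, h1I, hII]
  module

theorem IsMinimal.norm_D (hz : z ∈ U) (x y : ℝ) :
    ‖D u (x + y * I) z‖ ^ 2 = (x ^ 2 + y ^ 2) * ‖D u 1 z‖ ^ 2 := by
  have e : ((x : ℂ) + y * I) = x • (1 : ℂ) + y • I := by simp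
  have : D u (x + y * I) z = x • D u 1 z + y • D u I z := by
    rw [e]; simp only [D, map_add, map_smul]
  rw [this, norm_add_sq_real, norm_smul, norm_smul, inner_smul_left, inner_smul_right,
    H.inner_D hU hz, H.norm_D_I hU hz]
  simp only [mul_pow, Real.norm_eq_abs, sq_abs]
  simp
  ring

/-- A parametrization of the ellipse of curvature. -/
theorem IsMinimal.mem_curvatureEllipse_iff (hz : z ∈ U) {v : E6} :
    v ∈ curvatureEllipse u z ↔ ∃ c s : ℝ, c ^ 2 + s ^ 2 = 1 ∧
      v = (2 / ‖D u 1 z‖ ^ 2) • (c • aVec u z + s • bVec u z) := by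
  have hk : 0 < ‖D u 1 z‖ ^ 2 := pow_pos (norm_pos_iff.2 (H.D_one_ne_zero hU hz)) 2
  set k := ‖D u 1 z‖ ^ 2
  constructor
  · rintro ⟨X, hX, rfl⟩
    obtain ⟨x, y, rfl⟩ : ∃ x y : ℝ, X = x + y * I := ⟨X.re, X.im, (re_add_im X).symm⟩
    have h1 := H.norm_D hU hz x y
    rw [hX, one_pow] at h1
    refine ⟨(x ^ 2 - y ^ 2) * k, 2 * x * y * k, ?_, ?_⟩
    · linear_combination (-(x ^ 2 + y ^ 2) * k - 1) * h1
    · rw [H.II_self hU hz, smul_add, smul_smul, smul_smul]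
      congr 2 <;> field_simp
      ring
  · rintro ⟨c, s, hcs, rfl⟩
    -- `II(X, X)` depends only on the complex square of `X`, so a square root of `(c + is) / k` is
    -- the required tangent vector.
    obtain ⟨X, hX⟩ := IsAlgClosed.exists_pow_nat_eq (((c / k : ℝ) : ℂ) + ((s / k : ℝ) : ℂ) * I)
      (n := 2) two_pos
    obtain ⟨x, y, rfl⟩ : ∃ x y : ℝ, X = x + y * I := ⟨X.re, X.im, (re_add_im X).symm⟩
    have hX' : ((x ^ 2 - y ^ 2 : ℝ) : ℂ) + ((2 * x * y : ℝ) : ℂ) * I =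
        ((c / k : ℝ) : ℂ) + ((s / k : ℝ) : ℂ) * I := by
      rw [← hX]; push_cast; linear_combination -(y : ℂ) ^ 2 * I_mul_I
    have hre : x ^ 2 - y ^ 2 = c / k := by
      simpa [-ofReal_pow, -ofReal_div, -ofReal_sub, -ofReal_mul] using congrArg Complex.re hX'
    have him : 2 * x * y = s / k := by
      simpa [-ofReal_pow, -ofReal_div, -ofReal_sub, -ofReal_mul] using congrArg Complex.im hX'
    refine ⟨x + y * I, ?_, ?_⟩
    · have h1 := H.norm_D hU hz x y
      have h2 : ((x ^ 2 + y ^ 2) * k) ^ 2 = 1 := by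
        have : (x ^ 2 + y ^ 2) ^ 2 = (c / k) ^ 2 + (s / k) ^ 2 := by
          rw [← hre, ← him]; ring
        rw [mul_pow, this]; field_simp; exact hcs
      have h3 : (x ^ 2 + y ^ 2) * k = 1 :=
        (pow_eq_one_iff_of_nonneg (by positivity) two_ne_zero).1 h2
      rw [h3] at h1
      exact (pow_eq_one_iff_of_nonneg (norm_nonneg _) two_ne_zero).1 h1
    · have e1 : 2 * (x ^ 2 - y ^ 2) = 2 / k * c := by rw [hre]; ring
      have e2 : 4 * x * y = 2 / k * s := by linear_combination 2 * him
      rw [H.II_self hU hz, smul_add, smul_smul, smul_smul, e1, e2]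

theorem IsMinimal.sff_sff_eq (hz : z ∈ U) : sff (complexify u) z ⬝ᵥ sff (complexify u) z =
    ((‖aVec u z‖ ^ 2 - ‖bVec u z‖ ^ 2 : ℝ) : ℂ) - 2 * I * ((⟪aVec u z, bVec u z⟫ : ℝ) : ℂ) := by
  rw [← H.aVec_bVec hU hz]
  simp only [sub_dotProduct, dotProduct_sub, smul_dotProduct, dotProduct_smul, cv_dot,
    smul_eq_mul, real_inner_self_eq_norm_sq, real_inner_comm (aVec u z)]
  push_cast
  linear_combination (‖bVec u z‖ : ℂ) ^ 2 * I_mul_I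

/-- Vanishing would mean `|a| = |b|` and `a ⟂ b`, which makes the ellipse a circle. -/
theorem IsMinimal.sff_sff_ne_zero (hz : z ∈ U)
    (hE : NoncircularEllipse (curvatureEllipse u z)) :
    sff (complexify u) z ⬝ᵥ sff (complexify u) z ≠ 0 := by
  intro h
  rw [H.sff_sff_eq hU hz] at h
  have h1 : ‖aVec u z‖ ^ 2 = ‖bVec u z‖ ^ 2 := by
    have := congrArg Complex.re h
    simp [-ofReal_pow, -ofReal_sub] at this; linarith
  have h2 : ⟪aVec u z, bVec u z⟫ = 0 := by
    have := congrArg Complex.im h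
    simpa [-ofReal_pow, -ofReal_sub] using this
  apply hE
  refine ⟨2 / ‖D u 1 z‖ ^ 2 * ‖aVec u z‖, fun v hv => ?_⟩
  obtain ⟨c, s, hcs, rfl⟩ := (H.mem_curvatureEllipse_iff hU hz).1 hv
  have h3 : ‖c • aVec u z + s • bVec u z‖ ^ 2 = ‖aVec u z‖ ^ 2 := by
    rw [norm_add_sq_real, norm_smul, norm_smul, inner_smul_left, inner_smul_right, h2]
    simp only [mul_pow, Real.norm_eq_abs, sq_abs, ← h1]
    simp
    linear_combination ‖aVec u z‖ ^ 2 * hcs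
  rw [norm_smul, (sq_eq_sq₀ (norm_nonneg _) (norm_nonneg _)).1 h3, Real.norm_of_nonneg (by positivity)]

theorem IsMinimal.aVec_ne_zero (hz : z ∈ U)
    (hE : NondegenerateEllipse (curvatureEllipse u z)) : aVec u z ≠ 0 := by
  intro h
  have h1 : Submodule.span ℝ (curvatureEllipse u z) ≤ Submodule.span ℝ {bVec u z} := by
    rw [Submodule.span_le]
    intro v hv
    obtain ⟨c, s, -, rfl⟩ := (H.mem_curvatureEllipse_iff hU hz).1 hv
    rw [h, smul_zero, zero_add, smul_smul]
    exact Submodule.smul_mem _ _ (Submodule.mem_span_singleton_self _)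
  have h2 := Submodule.finrank_mono h1
  have h3 := finrank_span_le_card (R := ℝ) ({bVec u z} : Set E6)
  rw [NondegenerateEllipse] at hE
  simp at h3
  omega

/-- In a coordinate with `(f₂, f₂) = -1` the major axis of the ellipse of curvature is spanned by
`b`. -/
theorem IsMinimal.bVec_eq_or (hz : z ∈ U)
    (hQ : sff (complexify u) z ⬝ᵥ sff (complexify u) z = -1) {B : E6}
    (hB : IsMajorUnitVector (curvatureEllipse u z) B) :
    bVec u z = ‖bVec u z‖ • B ∨ bVec u z = -(‖bVec u z‖ • B) := by
  rw [H.sff_sff_eq hU hz] at hQ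
  have h1 : ‖bVec u z‖ ^ 2 = 1 + ‖aVec u z‖ ^ 2 := by
    have := congrArg Complex.re hQ
    simp [-ofReal_pow, -ofReal_sub] at this; linarith
  have h2 : ⟪aVec u z, bVec u z⟫ = 0 := by
    have := congrArg Complex.im hQ
    simpa [-ofReal_pow, -ofReal_sub] using this
  obtain ⟨hB1, v, hv, hmax, hvB⟩ := hB
  have hk : 0 < 2 / ‖D u 1 z‖ ^ 2 :=
    div_pos two_pos (pow_pos (norm_pos_iff.2 (H.D_one_ne_zero hU hz)) 2)
  obtain ⟨c, s, hcs, rfl⟩ := (H.mem_curvatureEllipse_iff hU hz).1 hv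
  have h3 := hmax _ ((H.mem_curvatureEllipse_iff hU hz).2 ⟨0, 1, by norm_num, rfl⟩)
  set k := 2 / ‖D u 1 z‖ ^ 2
  rw [norm_smul, norm_smul, mul_le_mul_iff_right₀ (norm_pos_iff.2 hk.ne'), zero_smul, zero_add,
    one_smul] at h3
  have h4 : ‖c • aVec u z + s • bVec u z‖ ^ 2 =
      c ^ 2 * ‖aVec u z‖ ^ 2 + s ^ 2 * ‖bVec u z‖ ^ 2 := by
    rw [norm_add_sq_real, norm_smul, norm_smul, inner_smul_left, inner_smul_right, h2]
    simp only [mul_pow, Real.norm_eq_abs, sq_abs]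
    simp
  have h5 := pow_le_pow_left₀ (norm_nonneg _) h3 2
  rw [h4, h1] at h5
  -- Comparing the maximal vector with the one along `b` gives `1 + |a|² ≤ c²|a|² + s²(1 + |a|²) = 1
  -- + |a|² - c²`.
  have hc : c = 0 := by
    have : c ^ 2 ≤ 0 := by nlinarith
    exact pow_eq_zero_iff two_ne_zero |>.1 (le_antisymm this (sq_nonneg c))
  subst hc
  have hs : s = 1 ∨ s = -1 := sq_eq_sq_iff_eq_or_eq_neg.1 (by simpa using hcs)
  rw [zero_smul, zero_add, norm_smul, norm_smul, Real.norm_of_nonneg hk.le] at hvB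
  rcases hs with rfl | rfl
  · left
    rw [norm_one, one_mul, one_smul, mul_smul] at hvB
    exact smul_right_injective _ hk.ne' hvB
  · right
    rw [norm_neg, norm_one, one_mul, neg_smul, one_smul, mul_smul] at hvB
    exact neg_eq_iff_eq_neg.1 (smul_right_injective _ hk.ne' hvB)

end

/-! ### Changes of the coordinate -/

theorem fderiv_eq_dz_dzb {W : Type*} [NormedAddCommGroup W] [NormedSpace ℝ W] [NormedSpace ℂ W]
    [IsScalarTower ℝ ℂ W] (F : ℂ → W) (z X : ℂ) :
    fderiv ℝ F z X = X • dz F z + conj X • dzb F z := by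
  have e : X = X.re • (1 : ℂ) + X.im • I := by simp
  conv_lhs => rw [e, map_add, map_smul, map_smul, fderiv_one_eq, fderiv_I_eq]
  have e1 : X = X.re + X.im * I := (re_add_im X).symm
  have e2 : conj X = X.re - X.im * I := by apply Complex.ext <;> simp
  have hr : ∀ (r : ℝ) (x : W), r • x = (r : ℂ) • x := fun r x => (algebraMap_smul ℂ r x).symm
  rw [e2, hr, hr]
  nth_rw 3 [e1]
  module

theorem fderiv_real_apply {w : ℂ → ℂ} {z : ℂ} (hw : DifferentiableAt ℂ w z) (X : ℂ) :
    fderiv ℝ w z X = deriv w z * X := by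
  rw [hw.fderiv_restrictScalars ℝ]
  simp [mul_comm]

theorem dz_eq_deriv {w : ℂ → ℂ} {z : ℂ} (hw : DifferentiableAt ℂ w z) : dz w z = deriv w z := by
  rw [dz, fderiv_real_apply hw, fderiv_real_apply hw]
  simp only [smul_eq_mul]
  linear_combination (-1 / 2 * deriv w z) * I_mul_I

theorem dz_comp {W : Type*} [NormedAddCommGroup W] [NormedSpace ℝ W] [NormedSpace ℂ W]
    [IsScalarTower ℝ ℂ W] {F : ℂ → W} {w : ℂ → ℂ} {z : ℂ} (hF : DifferentiableAt ℝ F (w z))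
    (hw : DifferentiableAt ℂ w z) : dz (fun z => F (w z)) z = deriv w z • dz F (w z) := by
  have h : ∀ X, fderiv ℝ (fun z => F (w z)) z X = fderiv ℝ F (w z) (deriv w z * X) := fun X => by
    rw [← fderiv_real_apply hw]
    exact congrArg (· X) (fderiv_comp z hF (hw.restrictScalars ℝ))
  rw [dz, h, h, fderiv_eq_dz_dzb, fderiv_eq_dz_dzb]
  simp only [map_mul, map_one, conj_I, smul_sub, smul_add, smul_smul]
  have e1 : ∀ d : ℂ, I * (d * I) = -d := fun d => by linear_combination d * I_mul_I
  have e2 : ∀ d : ℂ, I * (d * -I) = d := fun d => by linear_combination -d * I_mul_I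
  simp only [mul_one, e1, e2]
  module

section

variable {U V : Set ℂ} (hU : IsOpen U) (hV : IsOpen V) {w : ℂ → ℂ} (hw : DifferentiableOn ℂ w V)
  (hwU : MapsTo w V U) {z : ℂ}

include hU hV hw hwU

omit z in
theorem dz_comp_eqOn {F : ℂ → V6} (hF : Smooth U F) :
    EqOn (dz fun z => F (w z)) (fun z => deriv w z • dz F (w z)) V := fun _ hz =>
  dz_comp (hF.differentiableAt hU (hwU hz)) (hw.differentiableAt (hV.mem_nhds hz))

theorem dz_dz_comp {F : ℂ → V6} (hF : Smooth U F) (hz : z ∈ V) :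
    dz (dz fun z => F (w z)) z =
      deriv w z ^ 2 • dz (dz F) (w z) + deriv (deriv w) z • dz F (w z) := by
  have hw' := hw.differentiableAt (hV.mem_nhds hz)
  have hd := (hw.deriv hV).differentiableAt (hV.mem_nhds hz)
  have hG := (hF.dz hU).differentiableAt hU (hwU hz)
  rw [dz_congr hV (dz_comp_eqOn hU hV hw hwU hF) hz,
    dz_smul (hd.restrictScalars ℝ) (F := fun z => dz F (w z))
      (hG.comp z (hw'.restrictScalars ℝ)), dz_eq_deriv hd,
    dz_comp hG hw', smul_smul, sq]

/-- The extra term `w'' ∂g` of the second derivative is tangential and is removed by the projection.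
-/
theorem sff_comp {g : ℂ → V6} (H : IsMinimal U g) (hz : z ∈ V) (hw0 : deriv w z ≠ 0) :
    sff (fun z => g (w z)) z = deriv w z ^ 2 • sff g (w z) := by
  have hE := H.metricFactor_ne (hwU hz)
  have hc : star (deriv w z) ≠ 0 := star_ne_zero.2 hw0
  rw [sff, sff, metricFactor, dz_dz_comp hU hV hw hwU H.smooth hz,
    dz_comp_eqOn hU hV hw hwU H.smooth hz]
  simp only [add_dotProduct, smul_dotProduct, dotProduct_smul, star_smul, smul_eq_mul, smul_sub,
    smul_smul]
  have hm : dz g (w z) ⬝ᵥ star (dz g (w z)) = metricFactor g (w z) := rfl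
  rw [hm]
  have e : star (deriv w z) * (deriv w z ^ 2 * (dz (dz g) (w z) ⬝ᵥ star (dz g (w z))) +
      deriv (deriv w) z * metricFactor g (w z)) /
      (star (deriv w z) * (deriv w z * metricFactor g (w z))) * deriv w z =
      deriv w z ^ 2 * (dz (dz g) (w z) ⬝ᵥ star (dz g (w z)) / metricFactor g (w z)) +
        deriv (deriv w) z := by
    field_simp
  rw [e]
  module

end

section

variable {α β : ℂ}

theorem D_comp_affine (hα : α = 1 ∨ α = -1) (u : ℂ → E6) (X z : ℂ) :
    D (fun z => u (α * z + β)) X z = α.re • D u X (α * z + β) := by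
  rcases hα with rfl | rfl
  · simp only [one_mul, one_re, one_smul, D]
    rw [fderiv_comp_add_right]
  · simp only [neg_one_mul, neg_re, one_re, neg_one_smul, D]
    have : fderiv ℝ (fun z => (fun y => u (y + β)) (-z)) z = -fderiv ℝ (fun y => u (y + β)) (-z) := by
      have := fderiv_comp_smul (𝕜 := ℝ) (f := fun y => u (y + β)) (-1) (x := z)
      simpa using this
    rw [this, fderiv_comp_add_right]; rfl

theorem normalSpace_comp_affine (hα : α = 1 ∨ α = -1) (u : ℂ → E6) (z : ℂ) :
    normalSpace (fun z => u (α * z + β)) z = normalSpace u (α * z + β) := by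
  ext x
  rw [mem_normalSpace_iff, mem_normalSpace_iff, D_comp_affine hα, D_comp_affine hα]
  rcases hα with rfl | rfl <;> simp

theorem II_comp_affine (hα : α = 1 ∨ α = -1) (u : ℂ → E6) (z X Y : ℂ) :
    II (fun z => u (α * z + β)) z X Y = II u (α * z + β) X Y := by
  have h1 : D (fun z => u (α * z + β)) Y = α.re • fun z => D u Y (α * z + β) :=
    funext fun z => D_comp_affine hα u Y z
  have h2 : D (α.re • fun z => D u Y (α * z + β)) X z =
      α.re • D (fun z => D u Y (α * z + β)) X z := by
    rcases hα with rfl | rfl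
    · simp
    · simp only [neg_re, one_re, neg_smul, one_smul, D]
      rw [fderiv_neg]; rfl
  have h3 : ∀ K L : Submodule ℝ E6, K = L → ∀ x, K.starProjection x = L.starProjection x := by
    rintro K _ rfl x; rfl
  rw [II, II, h3 _ _ (normalSpace_comp_affine hα u z), h1, h2, D_comp_affine hα (D u Y), smul_smul]
  rcases hα with rfl | rfl <;> simp

/-- The transforms do not depend on the choice between the coordinates `±z + c`. -/
theorem localTransform_comp_affine (hα : α = 1 ∨ α = -1) (ε : ℝ) (u : ℂ → E6) (z : ℂ) :
    localTransform ε (fun z => u (α * z + β)) z = localTransform ε u (α * z + β) := by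
  have ha : aVec (fun z => u (α * z + β)) z = aVec u (α * z + β) := by
    simp only [aVec, II_comp_affine hα]
  have hb : bVec (fun z => u (α * z + β)) z = bVec u (α * z + β) := by
    simp only [bVec, II_comp_affine hα]
  -- The sign occurs in two rows of the determinant and cancels.
  have hc : ∀ v₀ v₁ v₂ v₃ v₄ : E6,
      cross₅ v₀ (α.re • v₁) (α.re • v₂) v₃ v₄ = cross₅ v₀ v₁ v₂ v₃ v₄ := by
    intro v₀ v₁ v₂ v₃ v₄
    rcases hα with rfl | rfl
    · simp
    · ext k
      simp only [cross₅, neg_re, one_re, neg_smul, one_smul]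
      have e : (Matrix.of ![(v₀ : Fin 6 → ℝ), (-v₁ : E6), (-v₂ : E6), v₃, v₄,
          (Pi.single k 1 : Fin 6 → ℝ)]) = Matrix.diagonal ![1, -1, -1, 1, 1, 1] *
          (Matrix.of ![(v₀ : Fin 6 → ℝ), v₁, v₂, v₃, v₄, (Pi.single k 1 : Fin 6 → ℝ)]) := by
        ext i j
        rw [Matrix.diagonal_mul]
        fin_cases i <;> simp
      rw [e, Matrix.det_mul, Matrix.det_diagonal]
      simp [Fin.prod_univ_succ]
  have hn : unitNormal (fun z => u (α * z + β)) z = unitNormal u (α * z + β) := by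
    simp only [unitNormal, D_comp_affine hα, II_comp_affine hα, hc]
  simp only [localTransform, phi, ha, hb, hn]

end

/-- A non-vanishing holomorphic function is locally the fourth power of a derivative. -/
theorem exists_deriv_pow_four {U : Set ℂ} (hU : IsOpen U) {Q : ℂ → ℂ} (hQ : DifferentiableOn ℂ Q U)
    {z₀ : ℂ} (hz₀ : z₀ ∈ U) (h0 : Q z₀ ≠ 0) {k : ℂ} (hk : k ^ 4 = Q z₀) :
    ∃ O ⊆ U, IsOpen O ∧ z₀ ∈ O ∧ ∃ w : ℂ → ℂ, DifferentiableOn ℂ w O ∧ deriv w z₀ = k ∧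
      ∀ z ∈ O, deriv w z ^ 4 = Q z := by
  -- Normalizing to `q z₀ = 1` keeps `q` in the slit plane near `z₀`, so the principal logarithm
  -- gives a fourth root; the prescribed `k` selects the branch. On a ball this root has a
  -- primitive.
  set q : ℂ → ℂ := fun z => Q z / Q z₀
  have hq : DifferentiableOn ℂ q U := hQ.div_const _
  have hq0 : q z₀ = 1 := div_self h0
  have hO : IsOpen (U ∩ q ⁻¹' slitPlane) :=
    hq.continuousOn.isOpen_inter_preimage hU isOpen_slitPlane
  obtain ⟨r, hr, hB⟩ := Metric.isOpen_iff.1 hO z₀ ⟨hz₀, by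
    rw [mem_preimage, hq0]; exact one_mem_slitPlane⟩
  set κ : ℂ → ℂ := fun z => k * exp (Complex.log (q z) / 4)
  have hκ : DifferentiableOn ℂ κ (Metric.ball z₀ r) := by
    have h1 : DifferentiableOn ℂ (fun z => Complex.log (q z)) (Metric.ball z₀ r) :=
      (hq.mono fun z hz => (hB hz).1).clog fun z hz => (hB hz).2
    exact ((h1.div_const 4).cexp).const_mul k
  obtain ⟨w, hw⟩ := hκ.isExactOn_ball
  have hz₀B := Metric.mem_ball_self (x := z₀) hr
  refine ⟨_, fun z hz => (hB hz).1, Metric.isOpen_ball, hz₀B, w,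
    fun z hz => (hw z hz).differentiableAt.differentiableWithinAt, ?_, fun z hz => ?_⟩
  · rw [(hw z₀ hz₀B).deriv]
    simp [κ, hq0]
  · rw [(hw z hz).deriv, mul_pow, ← Complex.exp_nat_mul, hk]
    have hne : q z ≠ 0 := slitPlane_ne_zero (hB hz).2
    rw [show ((4 : ℕ) : ℂ) * (Complex.log (q z) / 4) = Complex.log (q z) by push_cast; ring,
      Complex.exp_log hne, mul_div_cancel₀ _ h0]

theorem differentiableOn_quartic {U : Set ℂ} (hU : IsOpen U) {g : ℂ → V6} (H : IsMinimal U g) :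
    DifferentiableOn ℂ (fun z => sff g z ⬝ᵥ sff g z) U := fun z hz => by
  apply DifferentiableAt.differentiableWithinAt
  have hs : Smooth U (fun z => sff g z ⬝ᵥ sff g z) := (H.smooth_sff hU).dot (H.smooth_sff hU)
  refine differentiableAt_complex_iff_differentiableAt_real.2 ⟨hs.differentiableAt hU hz, ?_⟩
  rw [fderiv_I_eq, fderiv_one_eq, H.dzb_sff_sff hU hz, sub_zero, add_zero]

/-! ### Coordinates of the Riemann surface -/

section

variable {S : Type*} [TopologicalSpace S]

theorem isOpen_transition (e e' : OpenPartialHomeomorph S ℂ) :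
    IsOpen (e.symm.trans e').source := (e.symm.trans e').open_source

theorem mapsTo_transition (e e' : OpenPartialHomeomorph S ℂ) :
    MapsTo (fun z => e' (e.symm z)) (e.symm.trans e').source e'.target := fun z hz => by
  rw [OpenPartialHomeomorph.trans_source] at hz
  exact e'.map_source hz.2

theorem transition_source_subset (e e' : OpenPartialHomeomorph S ℂ) :
    (e.symm.trans e').source ⊆ e.target := fun z hz => by
  rw [OpenPartialHomeomorph.trans_source] at hz
  exact hz.1

theorem mem_transition_source {e e' : OpenPartialHomeomorph S ℂ} {p : S} (hp : p ∈ e.source)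
    (hp' : p ∈ e'.source) : e p ∈ (e.symm.trans e').source := by
  rw [OpenPartialHomeomorph.trans_source]
  exact ⟨e.map_source hp, by rwa [mem_preimage, e.left_inv hp]⟩

theorem inCoord_transition (f : S → E6) (e e' : OpenPartialHomeomorph S ℂ) :
    EqOn (inCoord f e) (fun z => inCoord f e' (e' (e.symm z))) (e.symm.trans e').source :=
  fun z hz => by
    rw [OpenPartialHomeomorph.trans_source] at hz
    simp only [inCoord, e'.left_inv hz.2]

theorem inCoord_apply (f : S → E6) {e : OpenPartialHomeomorph S ℂ} {p : S} (hp : p ∈ e.source) :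
    inCoord f e (e p) = f p := by rw [inCoord, e.left_inv hp]

variable [ChartedSpace ℂ S]

theorem differentiableOn_transition {e e' : OpenPartialHomeomorph S ℂ}
    (he : e ∈ complexCoordinates S) (he' : e' ∈ complexCoordinates S) :
    DifferentiableOn ℂ (fun z => e' (e.symm z)) (e.symm.trans e').source := by
  have h := (StructureGroupoid.compatible_of_mem_maximalAtlas he he').1
  have h' : ContDiffOn ℂ ω (fun z => e' (e.symm z)) (e.symm.trans e').source := by
    simpa [contDiffPregroupoid, Function.comp_def] using h
  exact h'.differentiableOn (by simp)

variable [IsManifold 𝓘(ℂ) ω S]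

theorem chartAt_mem_complexCoordinates (p : S) : chartAt ℂ p ∈ complexCoordinates S :=
  IsManifold.chart_mem_maximalAtlas p

theorem contDiffOn_inCoord {f : S → E6} (hf : ContMDiff 𝓘(ℝ, ℂ) 𝓘(ℝ, E6) ∞ f)
    {e : OpenPartialHomeomorph S ℂ} (he : e ∈ complexCoordinates S) :
    ContDiffOn ℝ ∞ (inCoord f e) e.target := by
  intro z hz
  set c := chartAt ℂ (e.symm z)
  have hc := chartAt_mem_complexCoordinates (e.symm z)
  have hzV : z ∈ (e.symm.trans c).source := by
    rw [OpenPartialHomeomorph.trans_source]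
    exact ⟨hz, mem_chart_source ℂ (e.symm z)⟩
  have h1 : ContDiffAt ℝ ∞ (inCoord f c) (c (e.symm z)) := by
    have := (contMDiffAt_iff.1 (hf (e.symm z))).2
    simp only [Function.comp_def, contDiffWithinAt_univ, mfld_simps] at this
    exact this
  have h2 : ContDiffAt ℝ ∞ (fun z => c (e.symm z)) z :=
    (((differentiableOn_transition he hc).analyticAt
      ((isOpen_transition e c).mem_nhds hzV)).contDiffAt (n := ∞)).restrict_scalars ℝ
  have h3 := h1.comp z h2
  exact (h3.congr_of_eventuallyEq (eventuallyEq_of_eqOn (isOpen_transition e c)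
    (inCoord_transition f e c) hzV)).contDiffWithinAt

variable {f B : S → E6}

theorem IsMinimalImmersion.isMinimal (hf : IsMinimalImmersion f) {e : OpenPartialHomeomorph S ℂ}
    (he : e ∈ complexCoordinates S) : IsMinimal e.target (complexify (inCoord f e)) :=
  isMinimal_of_isConformalMinimalAt e.open_target (contDiffOn_inCoord hf.smooth he)
    (fun z _ => hf.norm_eq_one _) fun z hz => by
      have := hf.conformalMinimal e he _ (e.map_target hz)
      rwa [e.right_inv hz] at this

theorem IsMinimalImmersion.isAdapted (hf : IsMinimalImmersion f) {e : OpenPartialHomeomorph S ℂ}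
    (he : e ∈ adaptedCoordinates f B) : IsAdapted e.target (complexify (inCoord f e)) := by
  have H := hf.isMinimal he.1
  refine ⟨H, fun z hz => ?_⟩
  have h := (he.2 _ (e.map_target hz)).1
  rwa [e.right_inv hz, H.f₂_eq e.open_target hz, H.sff_sff e.open_target hz] at h

theorem defect_ne_zero (hf : IsMinimalImmersion f) (hE : HasNondegenerateNoncircularEllipse f)
    {e : OpenPartialHomeomorph S ℂ} (he : e ∈ adaptedCoordinates f B) {z : ℂ} (hz : z ∈ e.target) :
    defect (complexify (inCoord f e)) z ≠ 0 := by
  have H := hf.isAdapted he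
  have h := (hE e he.1 _ (e.map_target hz)).1
  rw [e.right_inv hz] at h
  have ha := H.aVec_ne_zero e.open_target hz h
  rw [H.defect_eq e.open_target hz]
  exact_mod_cast mul_ne_zero two_ne_zero (pow_ne_zero 2 (norm_ne_zero_iff.2 ha))

/-- The transformation law of the second fundamental form. -/
theorem sff_transition (hf : IsMinimalImmersion f) {e e' : OpenPartialHomeomorph S ℂ}
    (he : e ∈ complexCoordinates S) (he' : e' ∈ complexCoordinates S) {z : ℂ}
    (hz : z ∈ (e.symm.trans e').source) :
    deriv (fun z => e' (e.symm z)) z ≠ 0 ∧ sff (complexify (inCoord f e)) z =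
      deriv (fun z => e' (e.symm z)) z ^ 2 •
        sff (complexify (inCoord f e')) (e' (e.symm z)) := by
  have hV := isOpen_transition e e'
  have hw := differentiableOn_transition he he'
  have hwU := mapsTo_transition e e'
  have H' := hf.isMinimal he'
  have hc : EqOn (complexify (inCoord f e))
      (fun z => complexify (inCoord f e') (e' (e.symm z))) (e.symm.trans e').source :=
    complexify_eqOn (inCoord_transition f e e')
  have h1 := (dz_congr hV hc hz).trans (dz_comp_eqOn e'.open_target hV hw hwU H'.smooth hz)
  have h0 : deriv (fun z => e' (e.symm z)) z ≠ 0 := fun h0 => by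
    simp only [h0, zero_smul] at h1
    exact (hf.isMinimal he).immersed z (transition_source_subset e e' hz) h1
  refine ⟨h0, ?_⟩
  have h2 := sff_comp e'.open_target hV hw hwU H' hz h0
  rw [← h2, sff, sff, metricFactor, metricFactor, dz_congr hV (dz_eqOn hV hc) hz, dz_congr hV hc hz]

/-- A holomorphic function with non-zero derivative defines a new coordinate. -/
theorem exists_coordinate {c : OpenPartialHomeomorph S ℂ} (hc : c ∈ complexCoordinates S) {p : S}
    (hp : p ∈ c.source) {O : Set ℂ} (hO : IsOpen O) (hpO : c p ∈ O) {w : ℂ → ℂ}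
    (hw : DifferentiableOn ℂ w O) (hw0 : ∀ z ∈ O, deriv w z ≠ 0) :
    ∃ e ∈ complexCoordinates S, p ∈ e.source ∧ ∀ x ∈ e.source, c x ∈ O ∧ x ∈ c.source ∧
      e x = w (c x) := by
  have hwA : ∀ z ∈ O, ContDiffAt ℂ ω w z := fun z hz =>
    (hw.analyticAt (hO.mem_nhds hz)).contDiffAt
  have hwd : ∀ z ∈ O, HasDerivAt w (deriv w z) z := fun z hz =>
    (hw.differentiableAt (hO.mem_nhds hz)).hasDerivAt
  have hfd : HasFDerivAt w ((ContinuousLinearEquiv.unitsEquivAut ℂ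
      (Units.mk0 (deriv w (c p)) (hw0 _ hpO)) : ℂ ≃L[ℂ] ℂ) : ℂ →L[ℂ] ℂ) (c p) := by
    have := (hwd _ hpO).hasFDerivAt_equiv (hw0 _ hpO)
    exact this
  set φ₀ := (hwA _ hpO).toOpenPartialHomeomorph w hfd (by simp)
  set φ := φ₀.restr O
  have hφs : φ.source = φ₀.source ∩ O := φ₀.restr_source' O hO
  have hφ : ∀ z, φ z = w z := fun z => rfl
  have hpφ : c p ∈ φ.source := by
    rw [hφs]
    exact ⟨(hwA _ hpO).mem_toOpenPartialHomeomorph_source hfd (by simp), hpO⟩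
  have hφO : φ.source ⊆ O := by rw [hφs]; exact inter_subset_right
  have s1 : ContMDiffOn 𝓘(ℂ) 𝓘(ℂ) ω φ φ.source :=
    contMDiffOn_iff_contDiffOn.2 fun z hz => (hwA z (hφO hz)).contDiffWithinAt
  have s2 : ContMDiffOn 𝓘(ℂ) 𝓘(ℂ) ω φ.symm φ.target :=
    contMDiffOn_iff_contDiffOn.2 fun z hz => by
      have hz' := hφO (φ.map_target hz)
      exact (φ.contDiffAt_symm_deriv (hw0 _ hz') hz (hwd _ hz') (hwA _ hz')).contDiffWithinAt
  refine ⟨c.trans φ, ?_, ?_, ?_⟩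
  · obtain ⟨c1, c2⟩ := (IsManifold.mem_maximalAtlas_iff_contMDiffOn c).1 hc
    refine (IsManifold.mem_maximalAtlas_iff_contMDiffOn _).2 ⟨?_, ?_⟩
    · refine s1.comp (c1.mono ?_) ?_
      · rw [OpenPartialHomeomorph.trans_source]; exact inter_subset_left
      · intro x hx; rw [OpenPartialHomeomorph.trans_source] at hx; exact hx.2
    · refine c2.comp (s2.mono ?_) ?_
      · rw [OpenPartialHomeomorph.trans_target]; exact inter_subset_left
      · intro x hx; rw [OpenPartialHomeomorph.trans_target] at hx; exact hx.2
  · rw [OpenPartialHomeomorph.trans_source]; exact ⟨hp, hpφ⟩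
  · intro x hx
    rw [OpenPartialHomeomorph.trans_source] at hx
    exact ⟨hφO hx.2, hx.1, rfl⟩

/-- Coordinates with `(f₂, f₂) = -1`. -/
theorem exists_quartic_coordinate (hf : IsMinimalImmersion f)
    (hE : HasNondegenerateNoncircularEllipse f) {c : OpenPartialHomeomorph S ℂ}
    (hc : c ∈ complexCoordinates S) {p : S} (hp : p ∈ c.source) {k : ℂ}
    (hk : k ^ 4 = -(sff (complexify (inCoord f c)) (c p) ⬝ᵥ sff (complexify (inCoord f c)) (c p))) :
    ∃ e ∈ complexCoordinates S, p ∈ e.source ∧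
      (∀ z ∈ e.target, sff (complexify (inCoord f e)) z ⬝ᵥ sff (complexify (inCoord f e)) z = -1) ∧
      sff (complexify (inCoord f c)) (c p) = k ^ 2 • sff (complexify (inCoord f e)) (e p) := by
  have H := hf.isMinimal hc
  set Q : ℂ → ℂ := fun z => sff (complexify (inCoord f c)) z ⬝ᵥ sff (complexify (inCoord f c)) z
  have hQ : DifferentiableOn ℂ Q c.target := differentiableOn_quartic c.open_target H
  have hQ0 : ∀ z ∈ c.target, Q z ≠ 0 := fun z hz => by
    have h := (hE c hc _ (c.map_target hz)).2
    rw [c.right_inv hz] at h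
    exact H.sff_sff_ne_zero c.open_target hz h
  -- The quantity `(g₂, g₂)` is the coefficient of a quartic differential, so a new coordinate `w`
  -- makes it `-1` exactly when `(w')⁴ = -Q`.
  obtain ⟨O, hOc, hO, hpO, w, hw, hwp, hw4⟩ := exists_deriv_pow_four c.open_target hQ.neg
    (c.map_source hp) (neg_ne_zero.2 (hQ0 _ (c.map_source hp))) hk
  have hw0 : ∀ z ∈ O, deriv w z ≠ 0 := fun z hz h0 => by
    have := hw4 z hz
    rw [h0, zero_pow four_ne_zero] at this
    exact hQ0 z (hOc hz) (neg_eq_zero.1 this.symm)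
  obtain ⟨e, he, hpe, hew⟩ := exists_coordinate hc hp hO hpO hw hw0
  have heq : EqOn (fun z => e (c.symm z)) w (c.symm.trans e).source := fun z hz => by
    rw [OpenPartialHomeomorph.trans_source] at hz
    exact (hew _ hz.2).2.2.trans (congrArg w (c.right_inv hz.1))
  have hder : ∀ z ∈ (c.symm.trans e).source, deriv (fun z => e (c.symm z)) z = deriv w z :=
    fun z hz => (eventuallyEq_of_eqOn (isOpen_transition c e) heq hz).deriv_eq
  refine ⟨e, he, hpe, fun z hz => ?_, ?_⟩
  · set x := e.symm z
    have hx : x ∈ e.source := e.map_target hz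
    obtain ⟨hxO, hxc, hxw⟩ := hew x hx
    have hcx := mem_transition_source hxc hx
    obtain ⟨-, h1⟩ := sff_transition hf hc he hcx
    rw [hder _ hcx, c.left_inv hxc, e.right_inv hz] at h1
    have h2 := hw4 _ hxO
    have h3 : Q (c x) = deriv w (c x) ^ 4 *
        (sff (complexify (inCoord f e)) z ⬝ᵥ sff (complexify (inCoord f e)) z) := by
      simp only [Q, h1, smul_dotProduct, dotProduct_smul, smul_eq_mul]
      ring
    have h4 : deriv w (c x) ^ 4 ≠ 0 := pow_ne_zero 4 (hw0 _ hxO)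
    apply mul_left_cancel₀ h4
    rw [← h3, h2]
    simp
  · have hcp := mem_transition_source hp hpe
    obtain ⟨-, h1⟩ := sff_transition hf hc he hcp
    rwa [hder _ hcp, c.left_inv hp, hwp] at h1

theorem continuousOn_bVec {U : Set ℂ} {u : ℂ → E6} (hU : IsOpen U)
    (H : IsMinimal U (complexify u)) : ContinuousOn (bVec u) U := by
  have h : EqOn (bVec u) (fun z => imPart (-sff (complexify u) z)) U := fun z hz => by
    have h1 := H.aVec_bVec hU hz
    ext k
    have := congrArg Complex.im (congrFun h1 k)
    simp at this
    simp [imPart, ← this]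
  have hc : Continuous imPart :=
    (PiLp.continuous_toLp 2 _).comp (continuous_pi fun k => continuous_im.comp (continuous_apply k))
  exact (hc.comp_continuousOn (H.smooth_sff hU).continuousOn.neg).congr h

/-- Adapted coordinates exist near each point. -/
theorem exists_adaptedCoordinate (hf : IsMinimalImmersion f)
    (hE : HasNondegenerateNoncircularEllipse f) (hB : IsMajorAxisField f B) (p : S) :
    ∃ e ∈ adaptedCoordinates f B, p ∈ e.source := by
  set c := chartAt ℂ p
  have hc : c ∈ complexCoordinates S := chartAt_mem_complexCoordinates p
  have hp : p ∈ c.source := mem_chart_source ℂ p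
  have major : ∀ e ∈ complexCoordinates S, (∀ z ∈ e.target,
      sff (complexify (inCoord f e)) z ⬝ᵥ sff (complexify (inCoord f e)) z = -1) →
      ∀ x ∈ e.source, bVec (inCoord f e) (e x) = ‖bVec (inCoord f e) (e x)‖ • B x ∨
        bVec (inCoord f e) (e x) = -(‖bVec (inCoord f e) (e x)‖ • B x) := fun e he hQ x hx =>
    (hf.isMinimal he).bVec_eq_or e.open_target (e.map_source hx) (hQ _ (e.map_source hx))
      (hB.2 e he x hx)
  obtain ⟨e, he, hpe, hQe, hbe⟩ : ∃ e ∈ complexCoordinates S, p ∈ e.source ∧ (∀ z ∈ e.target,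
      sff (complexify (inCoord f e)) z ⬝ᵥ sff (complexify (inCoord f e)) z = -1) ∧
      bVec (inCoord f e) (e p) = ‖bVec (inCoord f e) (e p)‖ • B p := by
    obtain ⟨k, hk⟩ := IsAlgClosed.exists_pow_nat_eq
      (-(sff (complexify (inCoord f c)) (c p) ⬝ᵥ sff (complexify (inCoord f c)) (c p)))
      (n := 4) (by norm_num)
    obtain ⟨e, he, hpe, hQe, hk1⟩ := exists_quartic_coordinate hf hE hc hp hk
    rcases major e he hQe p hpe with h | h
    · exact ⟨e, he, hpe, hQe, h⟩
    -- Replacing `k` by `ik` rotates the coordinate by a quarter turn, which changes the sign of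
    -- `g₂` and thus of `b`.
    · have hk' : (I * k) ^ 4 = _ := (by rw [mul_pow, I_pow_four, one_mul] : (I * k) ^ 4 = k ^ 4).trans hk
      obtain ⟨e', he', hpe', hQe', hk2⟩ := exists_quartic_coordinate hf hE hc hp hk'
      refine ⟨e', he', hpe', hQe', ?_⟩
      have hk0 : k ^ 2 ≠ 0 := by
        intro h0
        have h1 : sff (complexify (inCoord f c)) (c p) ⬝ᵥ
            sff (complexify (inCoord f c)) (c p) = 0 := by
          rw [hk1, h0, zero_smul, zero_dotProduct]
        have h2 := (hE c hc p hp).2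
        exact (hf.isMinimal hc).sff_sff_ne_zero c.open_target (c.map_source hp) h2 h1
      have h3 : sff (complexify (inCoord f e')) (e' p) = -sff (complexify (inCoord f e)) (e p) := by
        rw [hk1, mul_pow, I_sq, neg_one_mul, neg_smul, ← smul_neg] at hk2
        exact neg_eq_iff_eq_neg.1 (smul_right_injective _ hk0 (by simpa using hk2.symm))
      rw [← (hf.isMinimal he').aVec_bVec e'.open_target (e'.map_source hpe'),
        ← (hf.isMinimal he).aVec_bVec e.open_target (e.map_source hpe)] at h3
      have h4 : bVec (inCoord f e') (e' p) = -bVec (inCoord f e) (e p) := by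
        refine neg_injective (re_im_unique (x := aVec (inCoord f e') (e' p))
          (x' := -aVec (inCoord f e) (e p)) ?_).2
        simp only [map_neg, smul_neg, neg_neg, ← sub_eq_add_neg]
        rw [h3]; abel
      rw [h4, norm_neg]
      nth_rw 1 [h]
      rw [neg_neg]
  have H := hf.isMinimal he
  -- Everywhere in the chart `b` is a positive or a negative multiple of `B`. Restricting to the
  -- open set where this continuous product is positive excludes the second alternative.
  set t : S → ℝ := fun x => ⟪B x, bVec (inCoord f e) (e x)⟫
  have ht : ContinuousOn t e.source := hB.1.continuousOn.inner
    ((continuousOn_bVec e.open_target H).comp e.continuousOn fun x hx => e.map_source hx)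
  set W := e.source ∩ t ⁻¹' Ioi 0
  have hW : IsOpen W := ht.isOpen_inter_preimage e.open_source isOpen_Ioi
  have hbpos : ∀ x ∈ e.source, 0 < ‖bVec (inCoord f e) (e x)‖ := fun x hx => by
    have h := hQe _ (e.map_source hx)
    rw [H.sff_sff_eq e.open_target (e.map_source hx)] at h
    have := congrArg Complex.re h
    simp [-ofReal_pow, -ofReal_sub] at this
    have h0 : 0 < ‖bVec (inCoord f e) (e x)‖ ^ 2 := by nlinarith [sq_nonneg ‖aVec (inCoord f e) (e x)‖]
    exact (norm_nonneg _).lt_of_ne fun h => by rw [← h] at h0; norm_num at h0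
  have hBn : ∀ x ∈ e.source, ⟪B x, B x⟫ = 1 := fun x hx => by
    rw [real_inner_self_eq_norm_sq, (hB.2 e he x hx).1, one_pow]
  have hsrc : (e.restr W).source = e.source ∩ W := e.restr_source' W hW
  refine ⟨e.restr W, ⟨restr_mem_maximalAtlas _ he hW, fun x hx => ?_⟩, ?_⟩
  · rw [hsrc] at hx
    have hz := e.map_source hx.1
    refine ⟨?_, ?_⟩
    · have : f₂ (inCoord f e) (e x) ⬝ᵥ f₂ (inCoord f e) (e x) = -1 := by
        rw [H.f₂_eq e.open_target hz, hQe _ hz]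
      exact this
    · rcases major e he hQe x hx.1 with h | h
      · exact h
      · exfalso
        have h1 : 0 < t x := hx.2.2
        simp only [t] at h1
        rw [h, inner_neg_right, inner_smul_right, hBn x hx.1, mul_one] at h1
        linarith [hbpos x hx.1]
  · rw [hsrc]
    refine ⟨hpe, hpe, ?_⟩
    change 0 < t p
    simp only [t]
    rw [hbe, inner_smul_right, hBn p hpe, mul_one]
    exact hbpos p hpe

end

/-! ### The sequence of transforms on the Riemann surface -/

/-- An orientation-reversing involutive isometry is the reflection in a great subsphere. -/
theorem isGreatSubsphereReflection_of_involutive {A : E6 ≃ₗᵢ[ℝ] E6} (hA : IsOrientationReversing A)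
    (h : ∀ x, A (A x) = x) : IsGreatSubsphereReflection A := by
  set V : Submodule ℝ E6 := LinearMap.eqLocus (A.toLinearEquiv : E6 →ₗ[ℝ] E6) LinearMap.id
  have hV : ∀ x, x ∈ V ↔ A x = x := fun x => Iff.rfl
  have hmem : ∀ x, x + A x ∈ V := fun x => by rw [hV, map_add, h, add_comm]
  -- For an isometric involution `(1 + A) / 2` is the orthogonal projection to the fixed space, so
  -- `A` is the associated reflection.
  have hproj : ∀ x, V.starProjection x = (1 / 2 : ℝ) • (x + A x) := fun x => by
    refine Submodule.eq_starProjection_of_mem_of_inner_eq_zero (V.smul_mem _ (hmem x)) fun y hy => ?_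
    have e : x - (1 / 2 : ℝ) • (x + A x) = (1 / 2 : ℝ) • (x - A x) := by module
    have e2 : ⟪A x, y⟫ = ⟪x, y⟫ := by
      nth_rw 1 [← (hV y).1 hy]; exact A.inner_map_map x y
    rw [e, inner_smul_left, inner_sub_left, e2, sub_self, mul_zero]
  refine ⟨V, fun hbot => ?_, fun htop => ?_, ?_⟩
  -- Without fixed vectors `A = -1`, which has determinant `(-1)⁶ = 1`; the even dimension is what
  -- excludes this case.
  · have hneg : (A.toLinearEquiv : E6 →ₗ[ℝ] E6) = (-1 : ℝ) • LinearMap.id := by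
      ext1 x
      have := hmem x
      rw [hbot, Submodule.mem_bot] at this
      simpa using (neg_eq_of_add_eq_zero_right this).symm
    rw [IsOrientationReversing, hneg, LinearMap.det_smul, LinearMap.det_id] at hA
    norm_num at hA
  · have hid : (A.toLinearEquiv : E6 →ₗ[ℝ] E6) = LinearMap.id := by
      ext1 x
      exact (hV x).1 (htop ▸ Submodule.mem_top)
    rw [IsOrientationReversing, hid, LinearMap.det_id] at hA
    norm_num at hA
  · ext1 x
    rw [Submodule.reflection_apply, hproj, two_smul, ← two_smul ℝ, smul_smul]
    norm_num

namespace IsTransformSeq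

variable {U : Set ℂ} {u : ℤ → ℂ → E6} (T : IsTransformSeq U u) (hU : IsOpen U)
  (hσ : ∀ z ∈ U, defect (complexify (u 0)) z ≠ 0) (hne : U.Nonempty) {A A' : E6 ≃ₗᵢ[ℝ] E6} {q : ℤ}
  (hA : IsOrientationReversing A) (h : EqOn (applyIsom A (u q)) (u (q + 1)) U)

include T hU hA h

theorem applyIsom_succ : EqOn (applyIsom A (u (q + 1))) (u q) U := by
  have := T.applyIsom_reflect hU hA h (-1)
  rwa [sub_neg_eq_add, add_neg_cancel_right] at this

include hσ hne

theorem isom_unique (hA' : IsOrientationReversing A')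
    (h' : EqOn (applyIsom A' (u q)) (u (q + 1)) U) : A = A' :=
  T.isom_eq hU hσ hne (fun _ hw => (h hw).trans (h' hw).symm) fun _ hw =>
    (T.applyIsom_succ hU hA h hw).trans (T.applyIsom_succ hU hA' h' hw).symm

/-- `A` exchanges two consecutive surfaces, so `A²` fixes both pointwise, and an isometry is
determined by its values on them. -/
theorem involutive (x : E6) : A (A x) = x := by
  have : A.trans A = LinearIsometryEquiv.refl ℝ E6 := by
    refine T.isom_eq hU hσ hne (n := q) (fun w hw => ?_) fun w hw => ?_
    · exact (congrArg A (h hw)).trans (T.applyIsom_succ hU hA h hw)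
    · exact (congrArg A (T.applyIsom_succ hU hA h hw)).trans (h hw)
  exact congrArg (· x) this

end IsTransformSeq

section

variable {S : Type*} [TopologicalSpace S] [ChartedSpace ℂ S] {f B : S → E6}

theorem transformSeq_natCast (f B : S → E6) (n : ℕ) :
    transformSeq f B n = (transform (adaptedCoordinates f B) 1)^[n] f := rfl

theorem transformSeq_neg_natCast (f B : S → E6) (n : ℕ) :
    transformSeq f B (-n) = (transform (adaptedCoordinates f B) (-1))^[n] f := by
  cases n with
  | zero => rfl
  | succ n => rfl

theorem transformSeq_add_one (f B : S → E6) (n : ℕ) : transformSeq f B (n + 1) =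
    transform (adaptedCoordinates f B) 1 (transformSeq f B n) := by
  rw [transformSeq_natCast, ← Function.iterate_succ_apply' (transform (adaptedCoordinates f B) 1)]
  rfl

theorem transformSeq_neg_sub_one (f B : S → E6) (n : ℕ) : transformSeq f B (-n - 1) =
    transform (adaptedCoordinates f B) (-1) (transformSeq f B (-n)) := by
  rw [transformSeq_neg_natCast, ← Function.iterate_succ_apply'
    (transform (adaptedCoordinates f B) (-1)), ← transformSeq_neg_natCast]
  congr 1
  push_cast; ring

theorem applyIsom_inCoord {A : E6 ≃ₗᵢ[ℝ] E6} {m n : ℤ}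
    (h : ∀ p, transformSeq f B n p = A (transformSeq f B m p)) (e : OpenPartialHomeomorph S ℂ) :
    EqOn (applyIsom A (inCoord (transformSeq f B m) e)) (inCoord (transformSeq f B n) e)
      e.target := fun z _ => (h (e.symm z)).symm

variable [IsManifold 𝓘(ℂ) ω S]

/-- Two adapted coordinates differ locally by a map `z ↦ ±z + c`. -/
theorem exists_transition_eq (hf : IsMinimalImmersion f) {e e' : OpenPartialHomeomorph S ℂ}
    (he : e ∈ adaptedCoordinates f B) (he' : e' ∈ adaptedCoordinates f B) {z₀ : ℂ}
    (hz₀ : z₀ ∈ (e.symm.trans e').source) :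
    ∃ O ⊆ (e.symm.trans e').source, IsOpen O ∧ z₀ ∈ O ∧ ∃ α β : ℂ, (α = 1 ∨ α = -1) ∧
      ∀ z ∈ O, e' (e.symm z) = α * z + β := by
  have hV := isOpen_transition e e'
  set s : ℂ → ℂ := fun z => e' (e.symm z) with hs
  have hsd : DifferentiableOn ℂ s (e.symm.trans e').source := differentiableOn_transition he.1 he'.1
  have H := hf.isAdapted he
  have H' := hf.isAdapted he'
  have hder : ∀ z ∈ (e.symm.trans e').source, deriv s z ∈ ({1, -1} : Set ℂ) := by
    intro z hz
    have hzt := transition_source_subset e e' hz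
    have hst := mapsTo_transition e e' hz
    have hx : e.symm z ∈ e'.source := by
      rw [OpenPartialHomeomorph.trans_source] at hz; exact hz.2
    obtain ⟨-, h1⟩ := sff_transition hf he.1 he'.1 hz
    have q1 := H.quartic z hzt
    have q2 := H'.quartic _ hst
    rw [← H.sff_sff e.open_target hzt, h1] at q1
    rw [← H'.sff_sff e'.open_target hst] at q2
    simp only [smul_dotProduct, dotProduct_smul, q2, smul_eq_mul] at q1
    -- Both coordinates have `(g₂, g₂) = -1`, so the transition derivative is a fourth root of
    -- unity.
    have h2 : (deriv s z ^ 2) ^ 2 = 1 := by linear_combination -q1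
    rcases sq_eq_sq_iff_eq_or_eq_neg.1 (h2.trans (one_pow 2).symm) with h3 | h3
    · simpa using sq_eq_sq_iff_eq_or_eq_neg.1 (h3.trans (one_pow 2).symm)
    -- A derivative with square `-1` would reverse `b`, while in both coordinates `b` is a
    -- non-negative multiple of the same `B`.
    · exfalso
      rw [← H.aVec_bVec e.open_target hzt, ← H'.aVec_bVec e'.open_target hst, ← hs, h3] at h1
      have h4 : bVec (inCoord f e) z = -bVec (inCoord f e') (s z) := by
        refine neg_injective (re_im_unique (x := aVec (inCoord f e) z)
          (x' := -aVec (inCoord f e') (s z)) ?_).2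
        simp only [map_neg, smul_neg, neg_neg, ← sub_eq_add_neg]
        rw [h1]; module
      have b1 := (he.2 _ (e.map_target hzt)).2
      have b2 := (he'.2 _ hx).2
      rw [e.right_inv hzt] at b1
      have b3 : (‖bVec (inCoord f e) z‖ + ‖bVec (inCoord f e') (s z)‖) • B (e.symm z) = 0 := by
        rw [add_smul, ← b1]
        have : bVec (inCoord f e') (s z) = ‖bVec (inCoord f e') (s z)‖ • B (e.symm z) := b2
        rw [← this, h4, neg_add_cancel]
      have n1 := H.norm_bVec_pos e.open_target hzt
      rcases smul_eq_zero.1 b3 with h5 | h5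
      · linarith [norm_nonneg (bVec (inCoord f e') (s z))]
      · rw [h5, smul_zero] at b1
        rw [b1, norm_zero] at n1
        exact lt_irrefl _ n1
  obtain ⟨ε, hε, hB⟩ := Metric.isOpen_iff.1 hV z₀ hz₀
  have hpre : IsPreconnected (Metric.ball z₀ ε) := (convex_ball z₀ ε).isPreconnected
  -- A continuous derivative with values in `{1, -1}` is constant on the ball.
  have hcd : ContinuousOn (deriv s) (Metric.ball z₀ ε) :=
    ((hsd.deriv hV).mono hB).continuousOn
  obtain ⟨α, hα, hαeq⟩ := hpre.eqOn_const_of_mapsTo (T := {1, -1})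
    (Set.toFinite _).isDiscrete hcd (fun z hz => hder z (hB hz)) ⟨1, by simp⟩
  obtain ⟨β, hβ⟩ := Metric.isOpen_ball.exists_eq_add_of_deriv_eq (f := s) (g := fun z => α * z) hpre
    (hsd.mono hB) (differentiableOn_id.const_mul α) (fun z hz => by
      rw [hαeq hz]; simp)
  exact ⟨_, hB, Metric.isOpen_ball, Metric.mem_ball_self hε, α, β, by simpa using hα,
    fun z hz => hβ hz⟩

/-- The transform can be computed in any adapted coordinate. -/
theorem transform_apply (hf : IsMinimalImmersion f) {e : OpenPartialHomeomorph S ℂ}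
    (he : e ∈ adaptedCoordinates f B) {p : S} (hp : p ∈ e.source) (ε : ℝ) (g : S → E6) :
    transform (adaptedCoordinates f B) ε g p = localTransform ε (inCoord g e) (e p) := by
  have h : ∃ e ∈ adaptedCoordinates f B, p ∈ e.source := ⟨e, he, hp⟩
  rw [transform, dif_pos h]
  obtain ⟨he', hp'⟩ := h.choose_spec
  set e' := h.choose
  have hpV := mem_transition_source hp hp'
  obtain ⟨O, hOV, hO, hpO, α, β, hα, hαβ⟩ := exists_transition_eq hf he he' hpV
  have h1 : EqOn (inCoord g e) (fun z => inCoord g e' (α * z + β)) O := fun z hz =>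
    (inCoord_transition g e e' (hOV hz)).trans (congrArg (inCoord g e') (hαβ z hz))
  rw [localTransform_congr hO h1 ε hpO, localTransform_comp_affine hα, ← hαβ _ hpO, e.left_inv hp]

theorem inCoord_transform (hf : IsMinimalImmersion f) {e : OpenPartialHomeomorph S ℂ}
    (he : e ∈ adaptedCoordinates f B) (ε : ℝ) (g : S → E6) :
    EqOn (inCoord (transform (adaptedCoordinates f B) ε g) e) (localTransform ε (inCoord g e))
      e.target := fun z hz => by
  rw [inCoord, transform_apply hf he (e.map_target hz), e.right_inv hz]

/-- By definition the sequence uses only `(+)`-transforms upwards from `0` and only `(-)`-transforms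
downwards. The missing half of the relations follows because the two transforms are mutually
inverse. -/
theorem isTransformSeq (hf : IsMinimalImmersion f) {e : OpenPartialHomeomorph S ℂ}
    (he : e ∈ adaptedCoordinates f B) :
    IsTransformSeq e.target fun n => inCoord (transformSeq f B n) e := by
  set u : ℤ → ℂ → E6 := fun n => inCoord (transformSeq f B n) e
  have hU := e.open_target
  have pos : ∀ n : ℕ, EqOn (u (n + 1)) (localTransform 1 (u n)) e.target := fun n => by
    simp only [u, transformSeq_add_one]
    exact inCoord_transform hf he 1 _
  have neg : ∀ n : ℕ, EqOn (u (-n - 1)) (localTransform (-1) (u (-n))) e.target := fun n => by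
    simp only [u, transformSeq_neg_sub_one]
    exact inCoord_transform hf he (-1) _
  have step : ∀ {v w : ℂ → E6} {ε : ℝ}, ε ^ 2 = 1 → IsAdapted e.target (complexify v) →
      EqOn w (localTransform ε v) e.target → IsAdapted e.target (complexify w) :=
    fun hε H h => ((H.isPair hU hε).congr (complexify_eqOn h)).isAdapted H hU
  have adapted : ∀ n, IsAdapted e.target (complexify (u n)) := fun n => by
    induction n using Int.induction_on with
    | zero => exact hf.isAdapted he
    | succ k ih => exact step (by norm_num) ih (pos k)
    | pred k ih => exact step (by norm_num) ih (neg k)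
  have inv : ∀ {v w : ℂ → E6} {ε : ℝ}, ε ^ 2 = 1 → IsAdapted e.target (complexify v) →
      EqOn w (localTransform ε v) e.target → EqOn v (localTransform (-ε) w) e.target :=
    fun hε H h z hz => (H.localTransform_localTransform hU hε hz).symm.trans
      (localTransform_congr hU h _ hz).symm
  refine ⟨adapted, fun n => ?_, fun n => ?_⟩
  · rcases Int.le_total 0 n with hn | hn
    · obtain ⟨k, rfl⟩ := Int.eq_ofNat_of_zero_le hn
      exact pos k
    · rcases hn.lt_or_eq with hn | rfl
      · obtain ⟨k, hk⟩ := Int.eq_ofNat_of_zero_le (show 0 ≤ -n - 1 by omega)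
        obtain rfl : n = -(k : ℤ) - 1 := by omega
        have := inv (by norm_num) (adapted (-k)) (neg k)
        rw [neg_neg] at this
        rwa [sub_add_cancel]
      · exact pos 0
  · rcases Int.le_total 0 n with hn | hn
    · obtain ⟨k, rfl⟩ := Int.eq_ofNat_of_zero_le hn
      exact inv (by norm_num) (adapted k) (pos k)
    · rcases hn.lt_or_eq with hn | rfl
      · obtain ⟨k, hk⟩ := Int.eq_ofNat_of_zero_le (show 0 ≤ -n - 1 by omega)
        obtain rfl : n = -(k : ℤ) - 1 := by omega
        rw [sub_add_cancel]
        exact neg k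
      · exact inv (by norm_num) (adapted 0) (pos 0)

variable (hf : IsMinimalImmersion f) (hE : HasNondegenerateNoncircularEllipse f)
  (hB : IsMajorAxisField f B) {q : ℤ}

include hf

theorem gammaInvariant_eq_zero {A : E6 ≃ₗᵢ[ℝ] E6} (hA : IsOrientationReversing A)
    (h : ∀ p, transformSeq f B (q + 1) p = A (transformSeq f B q p))
    {e : OpenPartialHomeomorph S ℂ} (he : e ∈ adaptedCoordinates f B) {p : S} (hp : p ∈ e.source) :
    gammaInvariant f B q e p = 0 :=
  (isTransformSeq hf he).gamma_eq_zero e.open_target hA (applyIsom_inCoord h e) (e.map_source hp)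

include hE

/-- Agreement on any non-empty open set suffices, since the surfaces restricted to it still span
`ℝ⁶`. This rigidity is what allows the local isometries to be glued. -/
theorem isom_unique_of_eventually {A A' : E6 ≃ₗᵢ[ℝ] E6} (hA : IsOrientationReversing A)
    (hA' : IsOrientationReversing A') {e : OpenPartialHomeomorph S ℂ}
    (he : e ∈ adaptedCoordinates f B) {p : S} (hp : p ∈ e.source)
    (h : ∀ᶠ x in 𝓝 p, transformSeq f B (q + 1) x = A (transformSeq f B q x))
    (h' : ∀ᶠ x in 𝓝 p, transformSeq f B (q + 1) x = A' (transformSeq f B q x)) : A = A' := by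
  obtain ⟨W, hW, hWo, hpW⟩ := eventually_nhds_iff.1 (h.and h')
  set U := e.target ∩ e.symm ⁻¹' W
  have hUo : IsOpen U := e.symm.continuousOn.isOpen_inter_preimage e.open_target hWo
  have T := (isTransformSeq hf he).mono (inter_subset_left : U ⊆ e.target)
  exact T.isom_unique hUo (fun z hz => defect_ne_zero hf hE he hz.1)
    ⟨e p, e.map_source hp, by rwa [mem_preimage, e.left_inv hp]⟩ hA
    (fun z hz => (hW _ hz.2).1.symm) hA' (fun z hz => (hW _ hz.2).2.symm)

include hB

theorem exists_isom_eventually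
    (hγ : ∀ e ∈ adaptedCoordinates f B, ∀ p ∈ e.source, gammaInvariant f B q e p = 0) (p : S) :
    ∃ A : E6 ≃ₗᵢ[ℝ] E6, IsOrientationReversing A ∧
      ∀ᶠ x in 𝓝 p, transformSeq f B (q + 1) x = A (transformSeq f B q x) := by
  obtain ⟨e, he, hp⟩ := exists_adaptedCoordinate hf hE hB p
  obtain ⟨O, hOU, hO, hpO, A, hA, h⟩ := (isTransformSeq hf he).exists_congruence e.open_target
    (fun z hz => defect_ne_zero hf hE he hz) (q := q) (fun z hz => by
      have := hγ e he _ (e.map_target hz)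
      rwa [gammaInvariant, e.right_inv hz] at this) (e.map_source hp)
  refine ⟨A, hA, ?_⟩
  have hW : IsOpen (e.source ∩ e ⁻¹' O) := e.continuousOn.isOpen_inter_preimage e.open_source hO
  filter_upwards [hW.mem_nhds ⟨hp, hpO⟩] with x hx
  have := h hx.2
  rw [applyIsom, inCoord_apply _ hx.1, inCoord_apply _ hx.1] at this
  exact this.symm

theorem exists_isom [ConnectedSpace S]
    (hγ : ∀ e ∈ adaptedCoordinates f B, ∀ p ∈ e.source, gammaInvariant f B q e p = 0) :
    ∃ A : E6 ≃ₗᵢ[ℝ] E6, IsOrientationReversing A ∧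
      ∀ p, transformSeq f B (q + 1) p = A (transformSeq f B q p) := by
  have loc := exists_isom_eventually hf hE hB hγ
  obtain ⟨p₀⟩ := (inferInstance : Nonempty S)
  obtain ⟨A, hA, hA₀⟩ := loc p₀
  refine ⟨A, hA, ?_⟩
  set G : Set S := {p | ∀ᶠ x in 𝓝 p, transformSeq f B (q + 1) x = A (transformSeq f B q x)}
  have hGo : IsOpen G := isOpen_setOfPred_eventually_nhds
  -- At a limit point some local isometry `A'` works, and it shares an open set with `A` near a
  -- point of `G`; rigidity gives `A' = A`. Connectedness of `S` then makes `G` everything.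
  have hGc : IsClosed G := by
    refine isClosed_of_closure_subset fun p hp => ?_
    obtain ⟨A', hA', h'⟩ := loc p
    obtain ⟨x, hx', hx⟩ := mem_closure_iff_nhds.1 hp _ (eventually_eventually_nhds.2 h')
    obtain ⟨e, he, hxe⟩ := exists_adaptedCoordinate hf hE hB x
    obtain rfl := isom_unique_of_eventually hf hE hA hA' he hxe hx hx'
    exact h'
  have hG : G = univ := IsClopen.eq_univ ⟨hGc, hGo⟩ ⟨p₀, hA₀⟩
  intro p
  have : p ∈ G := hG ▸ mem_univ p
  exact this.self_of_nhds

theorem isGreatSubsphereReflection [Nonempty S] {A : E6 ≃ₗᵢ[ℝ] E6} (hA : IsOrientationReversing A)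
    (h : ∀ p, transformSeq f B (q + 1) p = A (transformSeq f B q p)) :
    IsGreatSubsphereReflection A := by
  obtain ⟨p⟩ := (inferInstance : Nonempty S)
  obtain ⟨e, he, hp⟩ := exists_adaptedCoordinate hf hE hB p
  exact isGreatSubsphereReflection_of_involutive hA ((isTransformSeq hf he).involutive e.open_target
    (fun z hz => defect_ne_zero hf hE he hz) ⟨e p, e.map_source hp⟩ hA (applyIsom_inCoord h e))

theorem transformSeq_reflect {A : E6 ≃ₗᵢ[ℝ] E6} (hA : IsOrientationReversing A)
    (h : ∀ p, transformSeq f B (q + 1) p = A (transformSeq f B q p)) (r : ℤ) (p : S) :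
    transformSeq f B (q + 1 + r) p = A (transformSeq f B (q - r) p) := by
  obtain ⟨e, he, hp⟩ := exists_adaptedCoordinate hf hE hB p
  have := (isTransformSeq hf he).applyIsom_reflect e.open_target hA (applyIsom_inCoord h e) r
    (e.map_source hp)
  simp only [applyIsom, inCoord_apply _ hp] at this
  exact this.symm

end

end MinimalSurfaceS5

end

open MinimalSurfaceS5 in
theorem theorem4 {S : Type*} [TopologicalSpace S] [T2Space S] [ConnectedSpace S]
    [ChartedSpace ℂ S] [IsManifold 𝓘(ℂ) ω S] (f B : S → E6)
    (hf : IsMinimalImmersion f) (hE : HasNondegenerateNoncircularEllipse f)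
    (hB : IsMajorAxisField f B) (q : ℤ) :
    ((∀ e ∈ adaptedCoordinates f B, ∀ p ∈ e.source, gammaInvariant f B q e p = 0) ↔
      ∃ A : E6 ≃ₗᵢ[ℝ] E6, IsOrientationReversing A ∧
        ∀ p, transformSeq f B (q + 1) p = A (transformSeq f B q p)) ∧
    ∀ A : E6 ≃ₗᵢ[ℝ] E6, IsOrientationReversing A →
      (∀ p, transformSeq f B (q + 1) p = A (transformSeq f B q p)) →
      IsGreatSubsphereReflection A ∧
        ∀ (r : ℤ) (p : S), transformSeq f B (q + 1 + r) p = A (transformSeq f B (q - r) p) :=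
  ⟨⟨exists_isom hf hE hB, fun ⟨_, hA, h⟩ _ he _ hp => gammaInvariant_eq_zero hf hA h he hp⟩,
    fun _ hA h => ⟨isGreatSubsphereReflection hf hE hB hA h, transformSeq_reflect hf hE hB hA h⟩⟩
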